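/- **Setting.** A self-avoiding polygon (SAP) is a finite, non-empty, connected union of bonds (edges) of the square lattice $\mathbb Z^2$ in which every vertex has degree $2$; SAPs are considered up to translation. A *2-4-2 polygon* is a SAP whose rows, read from top to bottom, contain $2,4,2,\dots,4,2$ vertical bonds (a single row with $2$ vertical bonds is allowed). For each $h,v$ there are finitely many 2-4-2 polygons with $2h$ horizontal and $2v$ vertical bonds. Let $$f(s;x,y)=\sum_{P} s^{w(P)}x^{h(P)}y^{v(P)}\in\mathbb Q[s][[x]][[y]]$$ be the generating function of 2-4-2 polygons $P$, where $w(P)$ is the width of the bottom row and $2h(P)$, $2v(P)$ are the numbers of horizontal and vertical bonds. **Coefficients.** Write $\langle a\rangle=\frac{a}{1-a}$ and put $$A(s,t;x)=1+\langle x\rangle+2\langle sx\rangle+2\langle tx\rangle+\langle sx\rangle\langle tx\rangle+\langle sx\rangle^2+\langle sx\rangle\langle x\rangle+\langle tx\rangle^2+\langle tx\rangle\langle x\rangle,$$ $$B(s,t;x)=1+\langle tx\rangle+\langle x\rangle,\qquad C(s,t;x)=1+\langle sx\rangle+\langle x\rangle,$$ $$\hat T(t,s;x,y)=y^4\Big(A\langle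 stx\rangle\langle tx\rangle^2B+A\langle stx\rangle\langle stx^2\rangle\langle tx\rangle^2B+A\langle stx\rangle\langle tx\rangle^3B+C\langle sx\rangle\langle tx\rangle^3B+C\langle sx\rangle\langle x\rangle\langle tx\rangle^3B\Big),$$ with $A,B,C$ evaluated at $(s,t;x)$, and $T(t,s;x,y)=2\big(\hat T(t,s;x,y)+\hat T(s,t;x,y)\big)$. There are unique $c_0,\dots,c_8\in\mathbb Q(s,x)$ such that $$\tfrac1y\,T(t/x,s;x,y)=y^3\Big[c_0+\sum_{k=0}^{5}c_{k+1}\frac{k!\,t^k}{(1-t)^{k+1}}+\frac{c_7}{1-st}+\frac{c_8}{1-stx}\Big].$$ In lowest terms, $c_i$ has denominator $d_i$, where $$\begin{aligned} d_0&=(1-x)^3(1-sx)^6, & d_1&=(1-x)^3(1-sx)^5(1-s)^6, & d_2&=(1-x)^3(1-sx)^3(1-s)^5,\\ d_3&=(1-x)^3(1-sx)^3(1-s)^4, & d_4&=(1-x)^2(1-sx)(1-s)^3, & d_5&=(1-x)(1-sx)(1-s)^2,\\ d_6&=1-s, & d_7&=(1-sx)^6(1-s)^6, & d_8&=(1-sx)^4(1-x)^2,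 \end{aligned}$$ and $$c_8=-\frac{2sx^2(s^2x^2+sx-s+1)}{(1-sx)^4(1-x)^2}.$$ Likewise there are unique $\hat c_0,\dots,\hat c_8\in\mathbb Q(x)$ with $$\tfrac1y\,T(t/x,1;x,y)=y^3\Big[\hat c_0+\sum_{k=0}^{6}\hat c_{k+1}\frac{k!\,t^k}{(1-t)^{k+1}}+\frac{\hat c_8}{1-tx}\Big],$$ namely $$\begin{aligned} \hat c_0&=-\tfrac{2x^3(1+x)(2x^2+1)}{(1-x)^6}, & \hat c_1&=\tfrac{4(1+x)(x^2+1)x^3}{(1-x)^6}, & \hat c_2&=\tfrac{2x^2(1+x)(2x^2+x+1)}{(1-x)^5},\\ \hat c_3&=\tfrac{x^2(1+x)(2x+1)}{(1-x)^4}, & \hat c_4&=\tfrac13\tfrac{(1+x)(x^2+x+1)}{(1-x)^3}, & \hat c_5&=\tfrac1{12}\tfrac{x^2+2x+3}{(1-x)^2},\\ \hat c_6&=\tfrac1{60}\tfrac{x+3}{1-x}, & \hat c_7&=\tfrac1{360}, & \hat c_8&=-\tfrac{2x^3(1+x)}{(1-x)^6}=c_8|_{s=1}. \end{aligned}$$ **Lemma.**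 The generating function satisfies, in $\mathbb Q(s)((x))[[y]]$ and in $\mathbb Q((x))[[y]]$ respectively, $$f(s;x,y)=\frac{sxy}{1-sx}+y^3\Big[\sum_{k=0}^{5}c_{k+1}\frac{\partial^kf}{\partial s^k}(1;x,y)+c_7f(s;x,y)+c_8f(sx;x,y)\Big],$$ $$f(1;x,y)=\frac{xy}{1-x}+y^3\Big[\sum_{k=0}^{6}\hat c_{k+1}\frac{\partial^kf}{\partial s^k}(1;x,y)+\hat c_8f(x;x,y)\Big].$$ Moreover $f(s;x,y)=\sum_{n\ge1}f_n(s;x)\,y^{3n-2}$, where $f_n(s;x)$ is the generating function of the 2-4-2 polygons with $2(3n-2)$ vertical bonds, and $$f_1(s;x)=\frac{sx}{1-sx},$$ $$f_{n+1}(s;x)=\sum_{k=0}^{5}c_{k+1}\frac{\partial^kf_n}{\partial s^k}(1;x)+c_7f_n(s;x)+c_8f_n(sx;x)\quad(n\ge1,\ s\text{ an indeterminate}),$$ $$f_{n+1}(1;x)=\sum_{k=0}^{6}\hat c_{k+1}\frac{\partial^kf_n}{\partial s^k}(1;x)+\hat c_8f_n(x;x)\quad(n\ge1).$$ -/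

import Mathlib

open scoped Polynomial PowerSeries LaurentSeries

namespace SAP242

/-! ### Self-avoiding polygons on the square lattice -/

/-- A finite set of bonds of the square lattice `ℤ × ℤ`.  `(i, j) ∈ hor` is the horizontal bond
joining `(i, j)` and `(i + 1, j)`; `(i, j) ∈ ver` is the vertical bond joining `(i, j)` and
`(i, j + 1)`. -/
@[ext]
structure BondSet where
  hor : Finset (ℤ × ℤ)
  ver : Finset (ℤ × ℤ)

/-- The graph on `ℤ × ℤ` whose edges are the bonds of `P`. -/
def BondSet.graph (P : BondSet) : SimpleGraph (ℤ × ℤ) :=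
  SimpleGraph.fromRel fun u v =>
    (u ∈ P.hor ∧ v = (u.1 + 1, u.2)) ∨ (u ∈ P.ver ∧ v = (u.1, u.2 + 1))

/-- The vertices of `P`, i.e. the end points of its bonds. -/
def BondSet.vertices (P : BondSet) : Set (ℤ × ℤ) := P.graph.support

/-- A self-avoiding polygon: a (non-empty, finite) connected union of bonds in which every vertex
has degree `2`. -/
def BondSet.IsPolygon (P : BondSet) : Prop :=
  P.vertices.Nonempty ∧
  (∀ u ∈ P.vertices, ∀ v ∈ P.vertices, P.graph.Reachable u v) ∧
  ∀ v ∈ P.vertices, (P.graph.neighborSet v).ncard = 2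

/-- Polygons are counted up to translation.  Each translation class is represented by its unique
member whose lowest vertex (the leftmost one among the lowest) is the origin. -/
def BondSet.IsAnchored (P : BondSet) : Prop :=
  (0, 0) ∈ P.vertices ∧ ∀ v ∈ P.vertices, 0 < v.2 ∨ (v.2 = 0 ∧ 0 ≤ v.1)

/-- The number of vertical bonds in the row between the heights `j` and `j + 1`. -/
def BondSet.rowCount (P : BondSet) (j : ℤ) : ℕ := (P.ver.filter fun b => b.2 = j).card

/-- The rows of `P`, from top to bottom, contain `2, 4, 2, …, 4, 2` vertical bonds: here `j₀` is
the height of the bottommost row, and there are `2 * m + 1` rows, `m ≥ 0`. -/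
def BondSet.Is242 (P : BondSet) : Prop :=
  ∃ (j₀ : ℤ) (m : ℕ), ∀ j : ℤ, P.rowCount j =
    if j₀ ≤ j ∧ j ≤ j₀ + 2 * m then (if Even (j - j₀) then 2 else 4) else 0

/-- The width of the bottom row of an anchored 2-4-2 polygon.  This row contains two vertical
bonds and its lower side consists of the horizontal bonds at height `0`. -/
def BondSet.bottomWidth (P : BondSet) : ℕ := (P.hor.filter fun b => b.2 = 0).card

/-- The 2-4-2 polygons (up to translation) with horizontal half-perimeter `h` and vertical
half-perimeter `v`. -/
def polygons (h v : ℕ) : Set BondSet :=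
  {P | P.IsPolygon ∧ P.IsAnchored ∧ P.Is242 ∧ P.hor.card = 2 * h ∧ P.ver.card = 2 * v}

/-- The generating function `f(s; x, y)` of 2-4-2 polygons, an element of `ℚ[s]⟦x⟧⟦y⟧`. -/
noncomputable def f : ℚ[X]⟦X⟧⟦X⟧ :=
  PowerSeries.mk fun v => PowerSeries.mk fun h =>
    ∑ᶠ P ∈ polygons h v, (Polynomial.X : ℚ[X]) ^ P.bottomWidth

/-- `fₙ(s; x) ∈ ℚ[s]⟦x⟧`, for `n ≥ 1`: the coefficient of `y ^ (3 * n - 2)` in `f(s; x, y)`. -/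
noncomputable def fn (n : ℕ) : ℚ[X]⟦X⟧ := PowerSeries.coeff (3 * n - 2) f

/-! ### Substitution for `s`, differentiation with respect to `s` -/

/-- The derivative with respect to `s` on `ℚ[s]⟦x⟧`. -/
noncomputable def dS (φ : ℚ[X]⟦X⟧) : ℚ[X]⟦X⟧ :=
  PowerSeries.mk fun h => Polynomial.derivative (PowerSeries.coeff h φ)

/-- For `φ(s; x) = ∑ₕ φₕ(s) x ^ h` in `ℚ[s]⟦x⟧` and `g ∈ R⟦x⟧`, the series
`φ(g; x) = ∑ₕ φₕ(g) x ^ h` in `R⟦x⟧`. -/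
noncomputable def substS {R : Type*} [Field R] [Algebra ℚ R] (g : R⟦X⟧) (φ : ℚ[X]⟦X⟧) : R⟦X⟧ :=
  PowerSeries.mk fun n => ∑ h ∈ Finset.range (n + 1),
    PowerSeries.coeff (n - h) (Polynomial.aeval g (PowerSeries.coeff h φ))

/-- `φ(g; x)`, regarded as a Laurent series in `x`. -/
noncomputable def evS {R : Type*} [Field R] [Algebra ℚ R] (g : R⟦X⟧) (φ : ℚ[X]⟦X⟧) : R⸨X⸩ :=
  HahnSeries.ofPowerSeries ℤ R (substS g φ)

/-- `(∂ᵏ F / ∂sᵏ)(g; x, y)` as a power series in `y` over the Laurent series in `x`. -/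
noncomputable def evSY {R : Type*} [Field R] [Algebra ℚ R] (g : R⟦X⟧) (k : ℕ)
    (F : ℚ[X]⟦X⟧⟦X⟧) : R⸨X⸩⟦X⟧ :=
  PowerSeries.mk fun m => evS g (dS^[k] (PowerSeries.coeff m F))

/-! ### Rational functions -/

/-- The field `ℚ(s)`. -/
abbrev Qs : Type := RatFunc ℚ

/-- The field `ℚ(s, x) = ℚ(s)(x)`. -/
abbrev Qsx : Type := RatFunc Qs

/-- The element `s` of `ℚ(s)`. -/
noncomputable def s₀ : Qs := RatFunc.X

/-- The element `s` of `ℚ(s, x)`. -/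
noncomputable def sv : Qsx := RatFunc.C s₀

/-- The element `x` of `ℚ(s, x)`. -/
noncomputable def xv : Qsx := RatFunc.X

open scoped RatFunc in
/-- The expansion of a rational function in `x` over `R` as a Laurent series in `x`. -/
noncomputable def toL {R : Type*} [Field R] : RatFunc R →+* R⸨X⸩ := algebraMap (RatFunc R) R⸨X⸩

section
variable {K : Type*} [Field K]

/-- `⟨a⟩ = a / (1 - a)`. -/
def sq (a : K) : K := a / (1 - a)

/-- The generating function `A(s, t; x)`. -/
def frillA (s t x : K) : K :=
  1 + sq x + 2 * sq (s * x) + 2 * sq (t * x) + sq (s * x) * sq (t * x)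
    + sq (s * x) ^ 2 + sq (s * x) * sq x + sq (t * x) ^ 2 + sq (t * x) * sq x

/-- The generating function `B(s, t; x)`. -/
def frillB (_s t x : K) : K := 1 + sq (t * x) + sq x

/-- The generating function `C(s, t; x)`. -/
def frillC (s _t x : K) : K := 1 + sq (s * x) + sq x

/-- The generating function of the 2-4-2 building blocks in one orientation. -/
def That (t s x y : K) : K :=
  y ^ 4 * (frillA s t x * sq (s * t * x) * sq (t * x) ^ 2 * frillB s t x
    + frillA s t x * sq (s * t * x) * sq (s * t * x ^ 2) * sq (t * x) ^ 2 * frillB s t x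
    + frillA s t x * sq (s * t * x) * sq (t * x) ^ 3 * frillB s t x
    + frillC s t x * sq (s * x) * sq (t * x) ^ 3 * frillB s t x
    + frillC s t x * sq (s * x) * sq x * sq (t * x) ^ 3 * frillB s t x)

/-- The generating function `T(t, s; x, y)` of the 2-4-2 building blocks. -/
def T (t s x y : K) : K := 2 * (That t s x y + That s t x y)

/-- The coefficient `c₈` as a rational expression in `s` and `x`. -/
def c8 (s x : K) : K :=
  -(2 * s * x ^ 2 * (s ^ 2 * x ^ 2 + s * x - s + 1)) / ((1 - s * x) ^ 4 * (1 - x) ^ 2)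

/-- The coefficients `ĉ₀, …, ĉ₈` as rational expressions in `x`. -/
def chat (x : K) : Fin 9 → K :=
  ![-2 * (x ^ 3 * (1 + x) * (2 * x ^ 2 + 1)) / (1 - x) ^ 6,
    4 * ((1 + x) * (x ^ 2 + 1) * x ^ 3) / (1 - x) ^ 6,
    2 * (x ^ 2 * (1 + x) * (2 * x ^ 2 + x + 1)) / (1 - x) ^ 5,
    x ^ 2 * (1 + x) * (2 * x + 1) / (1 - x) ^ 4,
    1 / 3 * ((1 + x) * (x ^ 2 + x + 1)) / (1 - x) ^ 3,
    1 / 12 * (x ^ 2 + 2 * x + 3) / (1 - x) ^ 2,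
    1 / 60 * (x + 3) / (1 - x),
    1 / 360,
    -2 * (x ^ 3 * (1 + x)) / (1 - x) ^ 6]

end

/-- The denominators `d₀, …, d₈` of the coefficients `c₀, …, c₈`, as polynomials in `s` and `x`. -/
def den {R : Type*} [CommRing R] (s x : R) : Fin 9 → R :=
  ![(1 - x) ^ 3 * (1 - s * x) ^ 6,
    (1 - x) ^ 3 * (1 - s * x) ^ 5 * (1 - s) ^ 6,
    (1 - x) ^ 3 * (1 - s * x) ^ 3 * (1 - s) ^ 5,
    (1 - x) ^ 3 * (1 - s * x) ^ 3 * (1 - s) ^ 4,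
    (1 - x) ^ 2 * (1 - s * x) * (1 - s) ^ 3,
    (1 - x) * (1 - s * x) * (1 - s) ^ 2,
    1 - s,
    (1 - s * x) ^ 6 * (1 - s) ^ 6,
    (1 - s * x) ^ 4 * (1 - x) ^ 2]

/-- `r ∈ ℚ(s, x)` is `N / D` in lowest terms, with `N ∈ ℚ[s, x]` and the given
`D ∈ ℚ[s, x]`; the variables of `MvPolynomial (Fin 2) ℚ` stand for `s` and `x`. -/
def HasDenominator (r : Qsx) (D : MvPolynomial (Fin 2) ℚ) : Prop :=
  ∃ N : MvPolynomial (Fin 2) ℚ, IsRelPrime N D ∧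
    r = MvPolynomial.aeval ![sv, xv] N / MvPolynomial.aeval ![sv, xv] D

/-- The family `c₀, …, c₈ ∈ ℚ(s, x)` gives the partial fraction form of `T(t/x, s; x, y) / y`
with respect to `t`; an identity in `ℚ(s, x)(t)` for every non-zero `y`. -/
def IsPartialFraction (c : Fin 9 → Qsx) : Prop :=
  let t : RatFunc Qsx := RatFunc.X
  let s : RatFunc Qsx := RatFunc.C sv
  let x : RatFunc Qsx := RatFunc.C xv
  let C : Qsx → RatFunc Qsx := RatFunc.C
  ∀ y : RatFunc Qsx, y ≠ 0 →
    T (t / x) s x y / y = y ^ 3 * (C (c 0)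
      + ∑ k : Fin 6, C (c ⟨k + 1, by omega⟩) * ((k : ℕ).factorial * t ^ (k : ℕ) / (1 - t) ^ (k + 1 : ℕ))
      + C (c 7) * (1 / (1 - s * t)) + C (c 8) * (1 / (1 - s * t * x)))

/-- The family `c₀, …, c₈ ∈ ℚ(x)` gives the partial fraction form of `T(t/x, 1; x, y) / y`
with respect to `t`; an identity in `ℚ(x)(t)` for every non-zero `y`. -/
def IsPartialFractionOne (c : Fin 9 → RatFunc ℚ) : Prop :=
  let t : RatFunc (RatFunc ℚ) := RatFunc.X
  let x : RatFunc (RatFunc ℚ) := RatFunc.C RatFunc.X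
  let C : RatFunc ℚ → RatFunc (RatFunc ℚ) := RatFunc.C
  ∀ y : RatFunc (RatFunc ℚ), y ≠ 0 →
    T (t / x) 1 x y / y = y ^ 3 * (C (c 0)
      + ∑ k : Fin 7, C (c ⟨k + 1, by omega⟩) * ((k : ℕ).factorial * t ^ (k : ℕ) / (1 - t) ^ (k + 1 : ℕ))
      + C (c 8) * (1 / (1 - t * x)))

end SAP242

namespace SAP242

/-! ### Polygons through local conditions and colourings -/

namespace BondSet

/-! A 2-4-2 polygon with more than one row is a smaller one from whose bottom row `{d₁, d₂}` two
further rows `{u₁, u₂, u₃, u₄}` and `{e₁, e₂}` hang; the three rows form a chunk. Since degrees are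
even, the vertical bonds force the horizontal ones: walking along a level, one toggles between bond
and no bond exactly where a single vertical bond ends (`parity_step`, `eq_of_step`). Degree 2 and
connectedness become conditions on how the ends of the rows are linked along the two levels. One
level must be of type M and the other of type L or R, for otherwise some part closes up on its own
(`HasChunk.isGood`, with the converse `attach_isPoly`). So a polygon with one more pair of rows is
the same as a polygon `P` together with a chunk whose top row is as wide as the bottom row of `P`
(`attachEquiv`), and half-perimeters add up.

Chunks of type (M, L) are encoded by the gaps between consecutive abscissae. Summing geometric
series over the gaps gives `gapSum`; exchanging the outer rows and reflecting gives the other three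
types. In the total `hasGF_chunkWeight`, `t` marks the upper width, `s` the lower width and `x` the
added horizontal half-perimeter. It equals `T(t/x, s; x, y) / y`, up to the factor `y ^ 3`
(`T_div_eq`): the cap of the old polygon disappears, whence `t/x`, and the shared row is counted
once, whence the division by `y`.

The coefficient of `t ^ w` in `t ^ k / (1 - t) ^ (k + 1)`, `1 / (1 - s t)`, `1 / (1 - s t x)` is
`w.choose k`, `s ^ w`, `(s x) ^ w`. Hence the partial fraction form says how many chunks fit below a
row of width `w ≥ 1`, and `c₀` plays no role. Summing over all polygons of `fₙ`, these three become
`1 / k!` times the `k`-th derivative at `s = 1`, `fₙ(s)` and `fₙ(s x)`, which is the recurrence; the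
functional equation collects the recurrences over `n`. For `s = 1` the poles `t = 1` and `t = 1 / s`
collide, so that the order rises to 7.

The partial fraction identity `gapSum_partialFraction` is proved in an arbitrary commutative ring
containing the inverses involved. The same identity therefore serves the rational functions of the
statement and the power series in which polygons are counted. Infinite sums are handled by `HasGF`,
summability with respect to a filtration by ideals. -/

theorem graph_adj (P : BondSet) (u v : ℤ × ℤ) :
    P.graph.Adj u v ↔ (u ∈ P.hor ∧ v = (u.1 + 1, u.2)) ∨ (u ∈ P.ver ∧ v = (u.1, u.2 + 1)) ∨
      (v ∈ P.hor ∧ u = (v.1 + 1, v.2)) ∨ (v ∈ P.ver ∧ u = (v.1, v.2 + 1)) := by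
  obtain ⟨a, b⟩ := u
  obtain ⟨c, d⟩ := v
  simp only [graph, SimpleGraph.fromRel_adj, Prod.mk.injEq, ne_eq]
  constructor
  · tauto
  · rintro (h | h | h | h) <;> refine ⟨by omega, ?_⟩ <;> tauto

theorem mem_neighborSet (P : BondSet) (i j : ℤ) (v : ℤ × ℤ) :
    v ∈ P.graph.neighborSet (i, j) ↔ ((i, j) ∈ P.hor ∧ v = (i + 1, j)) ∨
      ((i, j) ∈ P.ver ∧ v = (i, j + 1)) ∨ ((i - 1, j) ∈ P.hor ∧ v = (i - 1, j)) ∨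
      ((i, j - 1) ∈ P.ver ∧ v = (i, j - 1)) := by
  obtain ⟨c, d⟩ := v
  rw [SimpleGraph.mem_neighborSet, graph_adj]
  simp only [Prod.mk.injEq]
  refine or_congr Iff.rfl (or_congr Iff.rfl (or_congr ?_ ?_))
  · constructor
    · rintro ⟨h, rfl, rfl⟩
      simpa using h
    · rintro ⟨h, rfl, rfl⟩
      simpa using h
  · constructor
    · rintro ⟨h, rfl, rfl⟩
      simpa using h
    · rintro ⟨h, rfl, rfl⟩
      simpa using h

theorem mem_vertices (P : BondSet) (i j : ℤ) :
    (i, j) ∈ P.vertices ↔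
      (i, j) ∈ P.hor ∨ (i, j) ∈ P.ver ∨ (i - 1, j) ∈ P.hor ∨ (i, j - 1) ∈ P.ver := by
  rw [vertices, SimpleGraph.mem_support]
  simp_rw [← SimpleGraph.mem_neighborSet, mem_neighborSet]
  constructor
  · rintro ⟨w, h⟩
    tauto
  · rintro (h | h | h | h)
    exacts [⟨_, Or.inl ⟨h, rfl⟩⟩, ⟨_, Or.inr (Or.inl ⟨h, rfl⟩)⟩,
      ⟨_, Or.inr (Or.inr (Or.inl ⟨h, rfl⟩))⟩, ⟨_, Or.inr (Or.inr (Or.inr ⟨h, rfl⟩))⟩]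

open Classical in
theorem neighborSet_eq (P : BondSet) (i j : ℤ) :
    P.graph.neighborSet (i, j) =
      (((if (i, j) ∈ P.hor then {(i + 1, j)} else ∅) ∪ (if (i, j) ∈ P.ver then {(i, j + 1)} else ∅) ∪
      (if (i - 1, j) ∈ P.hor then {(i - 1, j)} else ∅) ∪
      (if (i, j - 1) ∈ P.ver then {(i, j - 1)} else ∅) : Finset (ℤ × ℤ)) : Set (ℤ × ℤ)) := by
  ext v
  rw [mem_neighborSet, Finset.mem_coe]
  simp only [Finset.mem_union, or_assoc]
  refine or_congr ?_ (or_congr ?_ (or_congr ?_ ?_)) <;> split_ifs with h <;> simp [h]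

/-- The number of bonds at `(i, j)` is `0` or `2`. -/
def IsRegularAt (P : BondSet) (i j : ℤ) : Prop :=
  (((i, j) ∈ P.hor ↔ (i - 1, j) ∈ P.hor) ↔ ((i, j) ∈ P.ver ↔ (i, j - 1) ∈ P.ver)) ∧
    ¬ ((i, j) ∈ P.hor ∧ (i, j) ∈ P.ver ∧ (i, j - 1) ∈ P.ver)

/-- The first clause of `IsRegularAt` says that the degree is even. Then three bonds force the
fourth, so the second clause excludes exactly degree 4. -/
theorem isRegularAt_iff (P : BondSet) (i j : ℤ) :
    P.IsRegularAt i j ↔ ((i, j) ∈ P.vertices → (P.graph.neighborSet (i, j)).ncard = 2) := by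
  rw [mem_vertices, neighborSet_eq, Set.ncard_coe_finset, IsRegularAt]
  have e1 : ((i + 1 : ℤ), j) ≠ (i, j + 1) := by simp
  by_cases h1 : (i, j) ∈ P.hor <;> by_cases h2 : (i, j) ∈ P.ver <;>
    by_cases h3 : (i - 1, j) ∈ P.hor <;> by_cases h4 : (i, j - 1) ∈ P.ver <;>
    simp only [h1, h2, h3, h4, if_true, if_false] <;> simp [Finset.card_insert_of_notMem] <;> grind

/-- Every colouring of the lattice that is constant along the bonds of `P` is constant on the
vertices of `P`. -/
def IsMonochromatic (P : BondSet) : Prop :=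
  ∀ χ : ℤ → ℤ → Prop, (∀ i j, (i, j) ∈ P.hor → (χ i j ↔ χ (i + 1) j)) →
    (∀ i j, (i, j) ∈ P.ver → (χ i j ↔ χ i (j + 1))) →
    ∀ i j k l, (i, j) ∈ P.vertices → (k, l) ∈ P.vertices → (χ i j ↔ χ k l)

/-- Colourings replace walks: invariance along a walk gives one direction, and the colouring by
reachability from a fixed vertex gives the other. Connectedness can then be proved or refuted by
propositional reasoning on a few points. -/
theorem isPolygon_iff (P : BondSet) :
    P.IsPolygon ↔ P.vertices.Nonempty ∧ P.IsMonochromatic ∧ ∀ i j, P.IsRegularAt i j := by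
  simp only [IsPolygon, isRegularAt_iff]
  refine and_congr Iff.rfl (and_congr ?_ ⟨fun h i j => h (i, j), fun h v => h v.1 v.2⟩)
  constructor
  · intro h χ hh hv i j k l h1 h2
    obtain ⟨p⟩ := h _ h1 _ h2
    clear h1 h2
    have key : ∀ u v : ℤ × ℤ, P.graph.Walk u v → (χ u.1 u.2 ↔ χ v.1 v.2) := by
      intro u v p
      induction p with
      | nil => rfl
      | cons a _ ih =>
        rw [← ih]
        rcases (graph_adj _ _ _).1 a with ⟨a, e⟩ | ⟨a, e⟩ | ⟨a, e⟩ | ⟨a, e⟩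
        · rw [e]; exact hh _ _ a
        · rw [e]; exact hv _ _ a
        · rw [e]; exact (hh _ _ a).symm
        · rw [e]; exact (hv _ _ a).symm
    exact key _ _ p
  · intro h u hu v hv
    have := (h (fun i j => P.graph.Reachable u (i, j)) ?_ ?_ u.1 u.2 v.1 v.2 hu hv).1
    · exact this (SimpleGraph.Reachable.refl _)
    · intro i j hij
      have a : P.graph.Adj (i, j) (i + 1, j) := (graph_adj _ _ _).2 (by simp [hij])
      exact ⟨fun h => h.trans a.reachable, fun h => h.trans a.reachable.symm⟩
    · intro i j hij
      have a : P.graph.Adj (i, j) (i, j + 1) := (graph_adj _ _ _).2 (by simp [hij])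
      exact ⟨fun h => h.trans a.reachable, fun h => h.trans a.reachable.symm⟩

end BondSet

/-! ### One level between a row with two and a row with four vertical bonds -/

/-- The parity of the number of vertical bonds ending at a level, up to the abscissa `i`. -/
def parity (d₁ d₂ u₁ u₂ u₃ u₄ i : ℤ) : ℤ :=
  ((if d₁ ≤ i then 1 else 0) + (if d₂ ≤ i then 1 else 0) + (if u₁ ≤ i then 1 else 0) +
    (if u₂ ≤ i then 1 else 0) + (if u₃ ≤ i then 1 else 0) + (if u₄ ≤ i then 1 else 0)) % 2

/-- The horizontal bonds at a level between the rows `{d₁, d₂}` and `{u₁, u₂, u₃, u₄}`. -/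
noncomputable def level (d₁ d₂ u₁ u₂ u₃ u₄ : ℤ) : Finset ℤ :=
  (Finset.Ico (min d₁ u₁) (max d₂ u₄)).filter fun i => parity d₁ d₂ u₁ u₂ u₃ u₄ i = 1

/-- The interval in `level` only serves finiteness: to its left none of the six ends is counted, to
its right all six are, and both numbers are even. -/
theorem mem_level {d₁ d₂ u₁ u₂ u₃ u₄ : ℤ} (hd : d₁ < d₂) (h₁ : u₁ < u₂) (h₂ : u₂ < u₃)
    (h₃ : u₃ < u₄) (i : ℤ) :
    i ∈ level d₁ d₂ u₁ u₂ u₃ u₄ ↔ parity d₁ d₂ u₁ u₂ u₃ u₄ i = 1 := by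
  rw [level, Finset.mem_filter, Finset.mem_Ico, and_iff_right_iff_imp]
  intro h
  by_contra hc
  rw [not_and_or, not_le, not_lt] at hc
  unfold parity at h
  rcases hc with hc | hc
  · rw [if_neg, if_neg, if_neg, if_neg, if_neg, if_neg] at h <;> omega
  · rw [if_pos, if_pos, if_pos, if_pos, if_pos, if_pos] at h <;> omega

/-- The count changes at `i` by the number of vertical bonds ending there, which is odd when exactly
one of the two rows has a bond at `i`. This is the even-degree clause of `IsRegularAt`. -/
theorem parity_step {d₁ d₂ u₁ u₂ u₃ u₄ : ℤ} (hd : d₁ < d₂) (h₁ : u₁ < u₂) (h₂ : u₂ < u₃)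
    (h₃ : u₃ < u₄) (i : ℤ) :
    ((parity d₁ d₂ u₁ u₂ u₃ u₄ i = 1 ↔ parity d₁ d₂ u₁ u₂ u₃ u₄ (i - 1) = 1) ↔
      ((i = u₁ ∨ i = u₂ ∨ i = u₃ ∨ i = u₄) ↔ (i = d₁ ∨ i = d₂))) := by
  have key : ∀ z : ℤ, (if z ≤ i then (1 : ℤ) else 0) =
      (if z ≤ i - 1 then 1 else 0) + (if i = z then 1 else 0) := by
    intro z; split_ifs <;> omega
  have hu : (if i = u₁ then (1 : ℤ) else 0) + (if i = u₂ then 1 else 0) + (if i = u₃ then 1 else 0)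
      + (if i = u₄ then 1 else 0) = if (i = u₁ ∨ i = u₂ ∨ i = u₃ ∨ i = u₄) then 1 else 0 := by
    split_ifs <;> omega
  have hd' : (if i = d₁ then (1 : ℤ) else 0) + (if i = d₂ then 1 else 0)
      = if (i = d₁ ∨ i = d₂) then 1 else 0 := by
    split_ifs <;> omega
  unfold parity
  simp only [key]
  generalize (if d₁ ≤ i - 1 then (1 : ℤ) else 0) = a1 at *
  generalize (if d₂ ≤ i - 1 then (1 : ℤ) else 0) = a2 at *
  generalize (if u₁ ≤ i - 1 then (1 : ℤ) else 0) = a3 at *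
  generalize (if u₂ ≤ i - 1 then (1 : ℤ) else 0) = a4 at *
  generalize (if u₃ ≤ i - 1 then (1 : ℤ) else 0) = a5 at *
  generalize (if u₄ ≤ i - 1 then (1 : ℤ) else 0) = a6 at *
  generalize (if i = d₁ then (1 : ℤ) else 0) = b1 at *
  generalize (if i = d₂ then (1 : ℤ) else 0) = b2 at *
  generalize (if i = u₁ then (1 : ℤ) else 0) = b3 at *
  generalize (if i = u₂ then (1 : ℤ) else 0) = b4 at *
  generalize (if i = u₃ then (1 : ℤ) else 0) = b5 at *
  generalize (if i = u₄ then (1 : ℤ) else 0) = b6 at *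
  by_cases hU : (i = u₁ ∨ i = u₂ ∨ i = u₃ ∨ i = u₄) <;> by_cases hD : (i = d₁ ∨ i = d₂) <;>
    simp only [hU, hD, if_true, if_false, iff_true, iff_false, not_true] at hu hd' ⊢ <;> omega

/-- Two sequences that toggle at the same places and both vanish far to the left coincide. Applied
to a level, it shows that the vertical bonds determine the horizontal ones. -/
theorem eq_of_step {h h' : ℤ → Prop} {R : ℤ → Prop} (hs : ∀ i, (h i ↔ h (i - 1)) ↔ R i)
    (hs' : ∀ i, (h' i ↔ h' (i - 1)) ↔ R i) (M : ℤ) (hM : ∀ i < M, ¬ h i) (hM' : ∀ i < M, ¬ h' i)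
    (i : ℤ) : h i ↔ h' i := by
  rcases lt_or_ge i M with hi | hi
  · exact iff_of_false (hM i hi) (hM' i hi)
  · induction i, hi using Int.leInduction with
    | base =>
      have a := hs M; have b := hs' M
      have c := hM (M - 1) (by omega); have d := hM' (M - 1) (by omega)
      tauto
    | succ n _ ih =>
      have a := hs (n + 1); have b := hs' (n + 1)
      rw [add_sub_cancel_right] at a b
      tauto

theorem exists_forall_lt_notMem (s : Finset (ℤ × ℤ)) (j M : ℤ) :
    ∃ N ≤ M, ∀ i < N, (i, j) ∉ s := by
  obtain ⟨b, hb⟩ := (s.image Prod.fst).bddBelow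
  refine ⟨min b M, by omega, fun i hi h => ?_⟩
  have := hb (Finset.mem_coe.2 (Finset.mem_image_of_mem Prod.fst h))
  dsimp only at this
  omega

/-- `d₁` and `d₂` are linked to `u₃` and `u₄`, and `u₁` is linked to `u₂`. -/
def LinkL (d₁ d₂ _u₁ u₂ u₃ u₄ : ℤ) : Prop := u₂ < d₁ ∧ d₁ < u₄ ∧ u₃ < d₂

/-- `d₁` and `d₂` are linked to `u₁` and `u₄`, and `u₂` is linked to `u₃`. -/
def LinkM (d₁ d₂ _u₁ u₂ u₃ _u₄ : ℤ) : Prop := d₁ < u₂ ∧ u₃ < d₂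

/-- `d₁` and `d₂` are linked to `u₁` and `u₂`, and `u₃` is linked to `u₄`. -/
def LinkR (d₁ d₂ u₁ u₂ u₃ _u₄ : ℤ) : Prop := d₁ < u₂ ∧ u₁ < d₂ ∧ d₂ < u₃

/-- `d₁` and `d₂` are linked to each other. -/
def LinkSelf (d₁ d₂ u₁ u₂ u₃ u₄ : ℤ) : Prop := d₂ < u₁ ∨ (u₂ < d₁ ∧ d₂ < u₃) ∨ u₄ < d₁

theorem link_cases {d₁ d₂ u₁ u₂ u₃ u₄ : ℤ} (hd : d₁ < d₂) (h₁ : u₁ < u₂) (h₂ : u₂ < u₃)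
    (h₃ : u₃ < u₄)
    (tie : ∀ i, ¬ (parity d₁ d₂ u₁ u₂ u₃ u₄ i = 1 ∧ (i = u₁ ∨ i = u₂ ∨ i = u₃ ∨ i = u₄) ∧
      (i = d₁ ∨ i = d₂))) :
    LinkSelf d₁ d₂ u₁ u₂ u₃ u₄ ∨ LinkL d₁ d₂ u₁ u₂ u₃ u₄ ∨ LinkM d₁ d₂ u₁ u₂ u₃ u₄ ∨
      LinkR d₁ d₂ u₁ u₂ u₃ u₄ := by
  unfold parity at tie
  -- The four coincidences excluded here happen after 3 or 5 ends, so a horizontal bond would start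
  -- at a vertex that already has both vertical bonds. The other coincidences happen at even counts
  -- and are straight passages.
  have t1 : d₁ ≠ u₂ := by
    intro h
    refine tie d₁ ⟨?_, by tauto, by tauto⟩
    rw [if_pos le_rfl, if_neg (by omega), if_pos (by omega), if_pos (by omega), if_neg (by omega),
      if_neg (by omega)]; rfl
  have t2 : d₁ ≠ u₄ := by
    intro h
    refine tie d₁ ⟨?_, by tauto, by tauto⟩
    rw [if_pos le_rfl, if_neg (by omega), if_pos (by omega), if_pos (by omega), if_pos (by omega),
      if_pos (by omega)]; rfl
  have t3 : d₂ ≠ u₁ := by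
    intro h
    refine tie d₂ ⟨?_, by tauto, by tauto⟩
    rw [if_pos (by omega), if_pos (by omega), if_pos (by omega), if_neg (by omega),
      if_neg (by omega), if_neg (by omega)]; rfl
  have t4 : d₂ ≠ u₃ := by
    intro h
    refine tie d₂ ⟨?_, by tauto, by tauto⟩
    rw [if_pos (by omega), if_pos (by omega), if_pos (by omega), if_pos (by omega),
      if_pos (by omega), if_neg (by omega)]; rfl
  unfold LinkSelf LinkL LinkM LinkR
  omega

/-- `L` is the disjoint union of the runs `[p₁, q₁)`, `[p₂, q₂)`, `[p₃, q₃)`. -/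
def IsRuns (L : Finset ℤ) (p₁ q₁ p₂ q₂ p₃ q₃ : ℤ) : Prop :=
  (p₁ ≤ q₁ ∧ q₁ < p₂ ∧ p₂ ≤ q₂ ∧ q₂ < p₃ ∧ p₃ ≤ q₃) ∧
    ∀ i, i ∈ L ↔ (p₁ ≤ i ∧ i < q₁) ∨ (p₂ ≤ i ∧ i < q₂) ∨ (p₃ ≤ i ∧ i < q₃)

theorem IsRuns.card {L : Finset ℤ} {p₁ q₁ p₂ q₂ p₃ q₃ : ℤ} (h : IsRuns L p₁ q₁ p₂ q₂ p₃ q₃) :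
    (L.card : ℤ) = (q₁ - p₁) + (q₂ - p₂) + (q₃ - p₃) := by
  obtain ⟨⟨h1, h2, h3, h4, h5⟩, h⟩ := h
  have e : L = (Finset.Ico p₁ q₁ ∪ Finset.Ico p₂ q₂) ∪ Finset.Ico p₃ q₃ := by
    ext i; simp only [h, Finset.mem_union, Finset.mem_Ico, or_assoc]
  rw [e, Finset.card_union_of_disjoint, Finset.card_union_of_disjoint]
  · simp only [Int.card_Ico]; omega
  · rw [Finset.disjoint_left]; intro i; simp only [Finset.mem_Ico]; omega
  · rw [Finset.disjoint_left]; intro i; simp only [Finset.mem_Ico, Finset.mem_union]; omega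

theorem run_colour {χ : ℤ → Prop} {p q : ℤ} (h : ∀ i, p ≤ i → i < q → (χ i ↔ χ (i + 1))) (i : ℤ)
    (hp : p ≤ i) (hq : i ≤ q) : χ i ↔ χ p := by
  induction i, hp using Int.leInduction with
  | base => rfl
  | succ n hn ih => rw [← h n hn (by omega), ih (by omega)]

/-- In each run all colours agree. -/
theorem IsRuns.colour {L : Finset ℤ} {p₁ q₁ p₂ q₂ p₃ q₃ : ℤ} (h : IsRuns L p₁ q₁ p₂ q₂ p₃ q₃)
    {χ : ℤ → Prop} (hχ : ∀ i ∈ L, (χ i ↔ χ (i + 1))) :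
    (∀ i, p₁ ≤ i → i ≤ q₁ → (χ i ↔ χ p₁)) ∧ (∀ i, p₂ ≤ i → i ≤ q₂ → (χ i ↔ χ p₂)) ∧
      (∀ i, p₃ ≤ i → i ≤ q₃ → (χ i ↔ χ p₃)) := by
  refine ⟨run_colour fun i a b => hχ i ((h.2 i).2 ?_), run_colour fun i a b => hχ i ((h.2 i).2 ?_),
    run_colour fun i a b => hχ i ((h.2 i).2 ?_)⟩ <;> omega

section
variable {d₁ d₂ u₁ u₂ u₃ u₄ : ℤ}

/-- Each run joins two linked ends. Ends from different rows may come in either order, or coincide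
in a run without bonds, whence `min` and `max`. -/
theorem LinkL.isRuns (h : LinkL d₁ d₂ u₁ u₂ u₃ u₄) (hd : d₁ < d₂) (h₁ : u₁ < u₂) (h₂ : u₂ < u₃)
    (h₃ : u₃ < u₄) : IsRuns (level d₁ d₂ u₁ u₂ u₃ u₄) u₁ u₂ (min d₁ u₃) (max d₁ u₃) (min d₂ u₄)
      (max d₂ u₄) := by
  obtain ⟨a, b, c⟩ := h
  refine ⟨by omega, fun i => ?_⟩
  rw [mem_level hd h₁ h₂ h₃, parity]
  rcases lt_or_ge i (min d₁ u₃) with hi | hi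
  · rw [if_neg (by omega), if_neg (by omega), if_neg (c := u₃ ≤ i) (by omega),
      if_neg (c := u₄ ≤ i) (by omega)]
    split_ifs <;> omega
  · rw [if_pos (c := u₁ ≤ i) (by omega), if_pos (c := u₂ ≤ i) (by omega)]
    split_ifs <;> omega

theorem LinkM.isRuns (h : LinkM d₁ d₂ u₁ u₂ u₃ u₄) (hd : d₁ < d₂) (h₁ : u₁ < u₂) (h₂ : u₂ < u₃)
    (h₃ : u₃ < u₄) : IsRuns (level d₁ d₂ u₁ u₂ u₃ u₄) (min d₁ u₁) (max d₁ u₁) u₂ u₃ (min d₂ u₄)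
      (max d₂ u₄) := by
  obtain ⟨a, b⟩ := h
  refine ⟨by omega, fun i => ?_⟩
  rw [mem_level hd h₁ h₂ h₃, parity]
  rcases lt_or_ge i u₂ with hi | hi
  · rw [if_neg (c := d₂ ≤ i) (by omega), if_neg (c := u₂ ≤ i) (by omega),
      if_neg (c := u₃ ≤ i) (by omega), if_neg (c := u₄ ≤ i) (by omega)]
    split_ifs <;> omega
  · rw [if_pos (c := d₁ ≤ i) (by omega), if_pos (c := u₁ ≤ i) (by omega),
      if_pos (c := u₂ ≤ i) (by omega)]
    split_ifs <;> omega

theorem LinkR.isRuns (h : LinkR d₁ d₂ u₁ u₂ u₃ u₄) (hd : d₁ < d₂) (h₁ : u₁ < u₂) (h₂ : u₂ < u₃)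
    (h₃ : u₃ < u₄) : IsRuns (level d₁ d₂ u₁ u₂ u₃ u₄) (min d₁ u₁) (max d₁ u₁) (min d₂ u₂)
      (max d₂ u₂) u₃ u₄ := by
  obtain ⟨a, b, c⟩ := h
  refine ⟨by omega, fun i => ?_⟩
  rw [mem_level hd h₁ h₂ h₃, parity]
  rcases lt_or_ge i u₃ with hi | hi
  · rw [if_neg (c := u₃ ≤ i) (by omega), if_neg (c := u₄ ≤ i) (by omega)]
    split_ifs <;> omega
  · rw [if_pos (c := d₁ ≤ i) (by omega), if_pos (c := d₂ ≤ i) (by omega),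
      if_pos (c := u₁ ≤ i) (by omega), if_pos (c := u₂ ≤ i) (by omega),
      if_pos (c := u₃ ≤ i) (by omega)]
    split_ifs <;> omega

/-- Outside the three intervals the six indicators cancel in pairs modulo 2. The inclusion suffices
for the colourings that refute this case. -/
theorem LinkSelf.mem_level (_h : LinkSelf d₁ d₂ u₁ u₂ u₃ u₄) (hd : d₁ < d₂) (h₁ : u₁ < u₂)
    (h₂ : u₂ < u₃) (h₃ : u₃ < u₄) (i : ℤ) (hi : i ∈ level d₁ d₂ u₁ u₂ u₃ u₄) :
    (d₁ ≤ i ∧ i < d₂) ∨ (u₁ ≤ i ∧ i < u₂) ∨ (u₃ ≤ i ∧ i < u₄) := by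
  rw [SAP242.mem_level hd h₁ h₂ h₃, parity] at hi
  by_contra hc
  have a : (if d₁ ≤ i then (1 : ℤ) else 0) = (if d₂ ≤ i then (1 : ℤ) else 0) := by
    split_ifs <;> omega
  have b : (if u₁ ≤ i then (1 : ℤ) else 0) = (if u₂ ≤ i then (1 : ℤ) else 0) := by
    split_ifs <;> omega
  have c : (if u₃ ≤ i then (1 : ℤ) else 0) = (if u₄ ≤ i then (1 : ℤ) else 0) := by
    split_ifs <;> omega
  rw [a, b, c] at hi
  omega

theorem IsRuns.notMem {p₁ q₁ p₂ q₂ p₃ q₃ : ℤ} {L : Finset ℤ} (h : IsRuns L p₁ q₁ p₂ q₂ p₃ q₃)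
    {i : ℤ} (hi : ¬ ((p₁ ≤ i ∧ i < q₁) ∨ (p₂ ≤ i ∧ i < q₂) ∨ (p₃ ≤ i ∧ i < q₃))) : i ∉ L :=
  fun hL => hi ((h.2 i).1 hL)

theorem tie_of_link (hd : d₁ < d₂) (h₁ : u₁ < u₂) (h₂ : u₂ < u₃) (h₃ : u₃ < u₄)
    (h : LinkL d₁ d₂ u₁ u₂ u₃ u₄ ∨ LinkM d₁ d₂ u₁ u₂ u₃ u₄ ∨ LinkR d₁ d₂ u₁ u₂ u₃ u₄) (i : ℤ)
    (hu : i = u₁ ∨ i = u₂ ∨ i = u₃ ∨ i = u₄) (hd' : i = d₁ ∨ i = d₂) :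
    i ∉ level d₁ d₂ u₁ u₂ u₃ u₄ := by
  rcases h with h | h | h
  · refine (h.isRuns hd h₁ h₂ h₃).notMem ?_
    obtain ⟨a, b, c⟩ := h
    rcases hu with rfl | rfl | rfl | rfl <;> rcases hd' with hd' | hd' <;> omega
  · refine (h.isRuns hd h₁ h₂ h₃).notMem ?_
    obtain ⟨a, b⟩ := h
    rcases hu with rfl | rfl | rfl | rfl <;> rcases hd' with hd' | hd' <;> omega
  · refine (h.isRuns hd h₁ h₂ h₃).notMem ?_
    obtain ⟨a, b, c⟩ := h
    rcases hu with rfl | rfl | rfl | rfl <;> rcases hd' with hd' | hd' <;> omega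

end

/-! ### Chunks and their attachment at the bottom of a polygon -/

/-- Three consecutive rows `{d₁, d₂}`, `{u₁, u₂, u₃, u₄}`, `{e₁, e₂}` of a polygon, from top to
bottom. -/
@[ext]
structure Chunk where
  (d₁ d₂ u₁ u₂ u₃ u₄ e₁ e₂ : ℤ)

namespace Chunk

structure IsOrdered (c : Chunk) : Prop where
  hd : c.d₁ < c.d₂
  h₁ : c.u₁ < c.u₂
  h₂ : c.u₂ < c.u₃
  h₃ : c.u₃ < c.u₄
  he : c.e₁ < c.e₂

def Lu (c : Chunk) : Prop := LinkL c.d₁ c.d₂ c.u₁ c.u₂ c.u₃ c.u₄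
def Mu (c : Chunk) : Prop := LinkM c.d₁ c.d₂ c.u₁ c.u₂ c.u₃ c.u₄
def Ru (c : Chunk) : Prop := LinkR c.d₁ c.d₂ c.u₁ c.u₂ c.u₃ c.u₄
def Ll (c : Chunk) : Prop := LinkL c.e₁ c.e₂ c.u₁ c.u₂ c.u₃ c.u₄
def Ml (c : Chunk) : Prop := LinkM c.e₁ c.e₂ c.u₁ c.u₂ c.u₃ c.u₄
def Rl (c : Chunk) : Prop := LinkR c.e₁ c.e₂ c.u₁ c.u₂ c.u₃ c.u₄

/-- The rows form two strands joining the top to the bottom. -/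
def IsGood (c : Chunk) : Prop :=
  c.IsOrdered ∧ ((c.Mu ∧ c.Ll) ∨ (c.Lu ∧ c.Ml) ∨ (c.Mu ∧ c.Rl) ∨ (c.Ru ∧ c.Ml))

theorem IsGood.upper {c : Chunk} (h : c.IsGood) : c.Lu ∨ c.Mu ∨ c.Ru := by
  unfold IsGood at h; tauto

theorem IsGood.lower {c : Chunk} (h : c.IsGood) : c.Ll ∨ c.Ml ∨ c.Rl := by
  unfold IsGood at h; tauto

/-- The horizontal bonds between the first two rows. -/
noncomputable def upperLevel (c : Chunk) : Finset ℤ := level c.d₁ c.d₂ c.u₁ c.u₂ c.u₃ c.u₄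

/-- The horizontal bonds between the last two rows. -/
noncomputable def lowerLevel (c : Chunk) : Finset ℤ := level c.e₁ c.e₂ c.u₁ c.u₂ c.u₃ c.u₄

end Chunk

section
variable {d₁ d₂ u₁ u₂ u₃ u₄ : ℤ} {χ : ℤ → Prop}

theorem LinkL.colour (h : LinkL d₁ d₂ u₁ u₂ u₃ u₄) (hd : d₁ < d₂) (h₁ : u₁ < u₂) (h₂ : u₂ < u₃)
    (h₃ : u₃ < u₄) (hχ : ∀ i ∈ level d₁ d₂ u₁ u₂ u₃ u₄, (χ i ↔ χ (i + 1))) :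
    (χ d₁ ↔ χ u₃) ∧ (χ d₂ ↔ χ u₄) ∧ (χ u₁ ↔ χ u₂) := by
  obtain ⟨a, b, c⟩ := (h.isRuns hd h₁ h₂ h₃).colour hχ
  refine ⟨(b _ ?_ ?_).trans (b _ ?_ ?_).symm, (c _ ?_ ?_).trans (c _ ?_ ?_).symm,
    (a _ ?_ ?_).trans (a _ ?_ ?_).symm⟩ <;> omega

theorem LinkM.colour (h : LinkM d₁ d₂ u₁ u₂ u₃ u₄) (hd : d₁ < d₂) (h₁ : u₁ < u₂) (h₂ : u₂ < u₃)
    (h₃ : u₃ < u₄) (hχ : ∀ i ∈ level d₁ d₂ u₁ u₂ u₃ u₄, (χ i ↔ χ (i + 1))) :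
    (χ d₁ ↔ χ u₁) ∧ (χ d₂ ↔ χ u₄) ∧ (χ u₂ ↔ χ u₃) := by
  obtain ⟨a, b, c⟩ := (h.isRuns hd h₁ h₂ h₃).colour hχ
  refine ⟨(a _ ?_ ?_).trans (a _ ?_ ?_).symm, (c _ ?_ ?_).trans (c _ ?_ ?_).symm,
    (b _ ?_ ?_).trans (b _ ?_ ?_).symm⟩ <;> omega

theorem LinkR.colour (h : LinkR d₁ d₂ u₁ u₂ u₃ u₄) (hd : d₁ < d₂) (h₁ : u₁ < u₂) (h₂ : u₂ < u₃)
    (h₃ : u₃ < u₄) (hχ : ∀ i ∈ level d₁ d₂ u₁ u₂ u₃ u₄, (χ i ↔ χ (i + 1))) :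
    (χ d₁ ↔ χ u₁) ∧ (χ d₂ ↔ χ u₂) ∧ (χ u₃ ↔ χ u₄) := by
  obtain ⟨a, b, c⟩ := (h.isRuns hd h₁ h₂ h₃).colour hχ
  refine ⟨(a _ ?_ ?_).trans (a _ ?_ ?_).symm, (b _ ?_ ?_).trans (b _ ?_ ?_).symm,
    (c _ ?_ ?_).trans (c _ ?_ ?_).symm⟩ <;> omega

/-- A colouring that is constant on the rows adjacent to a level is constant on the level. -/
theorem level_colour (hd : d₁ < d₂) (h₁ : u₁ < u₂) (h₂ : u₂ < u₃)
    (h₃ : u₃ < u₄) (hχ : ∀ i ∈ level d₁ d₂ u₁ u₂ u₃ u₄, (χ i ↔ χ (i + 1)))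
    (h : LinkL d₁ d₂ u₁ u₂ u₃ u₄ ∨ LinkM d₁ d₂ u₁ u₂ u₃ u₄ ∨ LinkR d₁ d₂ u₁ u₂ u₃ u₄) {A : Prop}
    (hdA : ∀ i, (i = d₁ ∨ i = d₂) → (χ i ↔ A))
    (huA : ∀ i, (i = u₁ ∨ i = u₂ ∨ i = u₃ ∨ i = u₄) → (χ i ↔ A)) (i : ℤ)
    (hi : i ∈ level d₁ d₂ u₁ u₂ u₃ u₄ ∨ i - 1 ∈ level d₁ d₂ u₁ u₂ u₃ u₄) : χ i ↔ A := by
  have key : ∀ {p₁ q₁ p₂ q₂ p₃ q₃ : ℤ}, IsRuns (level d₁ d₂ u₁ u₂ u₃ u₄) p₁ q₁ p₂ q₂ p₃ q₃ →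
      (χ p₁ ↔ A) → (χ p₂ ↔ A) → (χ p₃ ↔ A) → (χ i ↔ A) := by
    intro p₁ q₁ p₂ q₂ p₃ q₃ hr e1 e2 e3
    obtain ⟨a, b, c⟩ := hr.colour hχ
    rw [hr.2, hr.2] at hi
    have : (p₁ ≤ i ∧ i ≤ q₁) ∨ (p₂ ≤ i ∧ i ≤ q₂) ∨ (p₃ ≤ i ∧ i ≤ q₃) := by omega
    rcases this with ⟨x, y⟩ | ⟨x, y⟩ | ⟨x, y⟩
    · rw [a i x y, e1]
    · rw [b i x y, e2]
    · rw [c i x y, e3]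
  have hmin : ∀ d u, (d = d₁ ∨ d = d₂) → (u = u₁ ∨ u = u₂ ∨ u = u₃ ∨ u = u₄) →
      (χ (min d u) ↔ A) := by
    intro d u h1 h2
    rcases min_choice d u with e | e <;> rw [e]
    exacts [hdA _ h1, huA _ h2]
  rcases h with h | h | h
  · exact key (h.isRuns hd h₁ h₂ h₃) (huA _ (by simp)) (hmin _ _ (by simp) (by simp))
      (hmin _ _ (by simp) (by simp))
  · exact key (h.isRuns hd h₁ h₂ h₃) (hmin _ _ (by simp) (by simp)) (huA _ (by simp))
      (hmin _ _ (by simp) (by simp))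
  · exact key (h.isRuns hd h₁ h₂ h₃) (hmin _ _ (by simp) (by simp))
      (hmin _ _ (by simp) (by simp)) (huA _ (by simp))

end

/-- A 2-4-2 polygon with `2 * m + 1` rows whose bottommost row has height `j₀`. -/
def IsPoly (P : BondSet) (j₀ : ℤ) (m : ℕ) : Prop :=
  P.IsPolygon ∧ ∀ j : ℤ, P.rowCount j =
    if j₀ ≤ j ∧ j ≤ j₀ + 2 * m then (if Even (j - j₀) then 2 else 4) else 0

/-! ### Rows as sets of abscissae -/

theorem rowCount_eq_card_image (P : BondSet) (j : ℤ) :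
    P.rowCount j = ((P.ver.filter fun b => b.2 = j).image Prod.fst).card := by
  rw [BondSet.rowCount, Finset.card_image_of_injOn]
  rintro ⟨a, b⟩ h ⟨c, d⟩ h' e
  simp only [Finset.coe_filter, Set.mem_ofPred_eq] at h h'
  ext
  exacts [e, h.2.trans h'.2.symm]

theorem mem_row_image (P : BondSet) (j i : ℤ) :
    i ∈ (P.ver.filter fun b => b.2 = j).image Prod.fst ↔ (i, j) ∈ P.ver := by
  simp only [Finset.mem_image, Finset.mem_filter, Prod.exists, exists_and_right, exists_eq_right]

theorem rowCount_eq_zero {P : BondSet} {j : ℤ} : P.rowCount j = 0 ↔ ∀ i, (i, j) ∉ P.ver := by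
  rw [rowCount_eq_card_image, Finset.card_eq_zero, Finset.eq_empty_iff_forall_notMem]
  simp only [mem_row_image]

theorem rowCount_eq_two {P : BondSet} {j : ℤ} :
    P.rowCount j = 2 ↔ ∃ a b, a < b ∧ ∀ i, (i, j) ∈ P.ver ↔ i = a ∨ i = b := by
  rw [rowCount_eq_card_image, Finset.card_eq_two]
  simp only [← mem_row_image]
  constructor
  · rintro ⟨a, b, hab, h⟩
    rcases lt_or_gt_of_ne hab with hlt | hlt
    · exact ⟨a, b, hlt, fun i => by rw [h]; simp⟩
    · exact ⟨b, a, hlt, fun i => by rw [h]; simp [or_comm]⟩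
  · rintro ⟨a, b, hab, h⟩
    exact ⟨a, b, hab.ne, by ext i; rw [h]; simp⟩

theorem rowCount_eq_four {P : BondSet} {j : ℤ} :
    P.rowCount j = 4 ↔ ∃ a b c d, a < b ∧ b < c ∧ c < d ∧
      ∀ i, (i, j) ∈ P.ver ↔ i = a ∨ i = b ∨ i = c ∨ i = d := by
  rw [rowCount_eq_card_image]
  simp only [← mem_row_image]
  generalize (P.ver.filter fun b => b.2 = j).image Prod.fst = S
  constructor
  · intro h
    refine ⟨S.orderEmbOfFin h 0, S.orderEmbOfFin h 1, S.orderEmbOfFin h 2, S.orderEmbOfFin h 3,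
      by simp, by simp, by simp, fun i => ?_⟩
    rw [← Finset.mem_coe, ← S.range_orderEmbOfFin h, Set.mem_range, Fin.exists_fin_succ]
    simp only [Fin.exists_fin_succ, eq_comm (b := i)]
    simp
  · rintro ⟨a, b, c, d, hab, hbc, hcd, h⟩
    have : S = {a, b, c, d} := by ext i; rw [h]; simp
    rw [this, Finset.card_insert_of_notMem, Finset.card_insert_of_notMem,
      Finset.card_insert_of_notMem, Finset.card_singleton] <;>
    simp only [Finset.mem_insert, Finset.mem_singleton] <;> omega

/-- The bottommost row of `P` has height `j₀` and consists of the bonds at `d₁` and `d₂`. -/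
structure IsBottom (P : BondSet) (j₀ d₁ d₂ : ℤ) : Prop where
  lt : d₁ < d₂
  row : ∀ i, (i, j₀) ∈ P.ver ↔ i = d₁ ∨ i = d₂
  below : ∀ i j, j < j₀ → (i, j) ∉ P.ver
  cap : ∀ i, (i, j₀) ∈ P.hor ↔ d₁ ≤ i ∧ i < d₂
  hbelow : ∀ i j, j < j₀ → (i, j) ∉ P.hor

/-- If a level toggles only at `d₁` and `d₂`, it is the single run between them. This gives the
lowest level of every polygon and the top of a rectangle. -/
theorem hor_of_cap {P : BondSet} (hP : ∀ i j, P.IsRegularAt i j) {j d₁ d₂ : ℤ} (hd : d₁ < d₂)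
    (h : ∀ i, ((i, j) ∈ P.ver ↔ (i, j - 1) ∈ P.ver) ↔ ¬ (i = d₁ ∨ i = d₂)) (i : ℤ) :
    (i, j) ∈ P.hor ↔ d₁ ≤ i ∧ i < d₂ := by
  obtain ⟨M, hM, hM'⟩ := exists_forall_lt_notMem P.hor j d₁
  refine eq_of_step (h := fun i => (i, j) ∈ P.hor) (h' := fun i => d₁ ≤ i ∧ i < d₂)
    (fun i => (hP i j).1) (fun i => ?_) M hM' (fun i hi => by omega) i
  rw [h]
  omega

theorem IsPoly.exists_isBottom {P : BondSet} {j₀ : ℤ} {m : ℕ} (h : IsPoly P j₀ m) :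
    ∃ d₁ d₂, IsBottom P j₀ d₁ d₂ := by
  have hr := ((BondSet.isPolygon_iff P).1 h.1).2.2
  obtain ⟨d₁, d₂, hd, hrow⟩ := rowCount_eq_two.1 ((h.2 j₀).trans (by simp))
  have hb : ∀ i j, j < j₀ → (i, j) ∉ P.ver := fun i j hj =>
    rowCount_eq_zero.1 ((h.2 j).trans (if_neg (by omega))) i
  refine ⟨d₁, d₂, hd, hrow, hb, hor_of_cap hr hd fun i => ?_, fun i j hj => ?_⟩
  · have := hb i (j₀ - 1) (by omega)
    rw [hrow]; tauto
  · obtain ⟨M, -, hM'⟩ := exists_forall_lt_notMem P.hor j 0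
    refine fun hi => (eq_of_step (h := fun i => (i, j) ∈ P.hor) (h' := fun _ => False)
      (fun i => (hr i j).1) (fun i => ?_) M hM' (fun i hi => id) i).1 hi
    have h1 := hb i j hj
    have h2 := hb i (j - 1) (by omega)
    tauto

/-- The bond set obtained by attaching a chunk below the bottommost row, at height `j₀`. -/
noncomputable def attach (P : BondSet) (j₀ : ℤ) (c : Chunk) : BondSet where
  hor := (P.hor.filter fun b => j₀ < b.2) ∪ c.upperLevel.image (fun i => (i, j₀)) ∪
    c.lowerLevel.image (fun i => (i, j₀ - 1)) ∪ (Finset.Ico c.e₁ c.e₂).image (fun i => (i, j₀ - 2))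
  ver := P.ver ∪ ({c.u₁, c.u₂, c.u₃, c.u₄} : Finset ℤ).image (fun i => (i, j₀ - 1)) ∪
    ({c.e₁, c.e₂} : Finset ℤ).image (fun i => (i, j₀ - 2))

theorem mem_attach_ver {P : BondSet} {j₀ : ℤ} {c : Chunk} {i j : ℤ} :
    (i, j) ∈ (attach P j₀ c).ver ↔ (i, j) ∈ P.ver ∨
      (j = j₀ - 1 ∧ (i = c.u₁ ∨ i = c.u₂ ∨ i = c.u₃ ∨ i = c.u₄)) ∨
      (j = j₀ - 2 ∧ (i = c.e₁ ∨ i = c.e₂)) := by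
  simp only [attach, Finset.mem_union, Finset.mem_image, Prod.mk.injEq, Finset.mem_insert,
    Finset.mem_singleton, exists_eq_or_imp, exists_eq_left, or_assoc]
  refine or_congr Iff.rfl ?_
  grind

theorem mem_attach_hor {P : BondSet} {j₀ : ℤ} {c : Chunk} {i j : ℤ} :
    (i, j) ∈ (attach P j₀ c).hor ↔ (j₀ < j ∧ (i, j) ∈ P.hor) ∨ (j = j₀ ∧ i ∈ c.upperLevel) ∨
      (j = j₀ - 1 ∧ i ∈ c.lowerLevel) ∨ (j = j₀ - 2 ∧ c.e₁ ≤ i ∧ i < c.e₂) := by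
  simp only [attach, Finset.mem_union, Finset.mem_image, Prod.mk.injEq, Finset.mem_filter,
    Finset.mem_Ico, or_assoc]
  grind

/-! ### Attaching a chunk yields a polygon -/

section
variable {P : BondSet} {j₀ : ℤ} {c : Chunk}

theorem attach_ver_of_le {i j : ℤ} (hj : j₀ ≤ j) :
    (i, j) ∈ (attach P j₀ c).ver ↔ (i, j) ∈ P.ver := by
  rw [mem_attach_ver, or_iff_left]; omega

theorem attach_hor_of_lt {i j : ℤ} (hj : j₀ < j) :
    (i, j) ∈ (attach P j₀ c).hor ↔ (i, j) ∈ P.hor := by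
  rw [mem_attach_hor]; simp only [hj, true_and]; rw [or_iff_left]; omega

theorem attach_ver_one (hP : IsBottom P j₀ c.d₁ c.d₂) {i : ℤ} :
    (i, j₀ - 1) ∈ (attach P j₀ c).ver ↔ (i = c.u₁ ∨ i = c.u₂ ∨ i = c.u₃ ∨ i = c.u₄) := by
  have := hP.below i (j₀ - 1) (by omega)
  rw [mem_attach_ver]; grind

theorem attach_ver_two (hP : IsBottom P j₀ c.d₁ c.d₂) {i : ℤ} :
    (i, j₀ - 2) ∈ (attach P j₀ c).ver ↔ (i = c.e₁ ∨ i = c.e₂) := by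
  have := hP.below i (j₀ - 2) (by omega)
  rw [mem_attach_ver]; grind

theorem attach_ver_below (hP : IsBottom P j₀ c.d₁ c.d₂) {i j : ℤ} (hj : j < j₀ - 2) :
    (i, j) ∉ (attach P j₀ c).ver := by
  have := hP.below i j (by omega)
  rw [mem_attach_ver]; grind

theorem attach_hor_zero {i : ℤ} : (i, j₀) ∈ (attach P j₀ c).hor ↔ i ∈ c.upperLevel := by
  rw [mem_attach_hor]; grind

theorem attach_hor_one {i : ℤ} : (i, j₀ - 1) ∈ (attach P j₀ c).hor ↔ i ∈ c.lowerLevel := by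
  rw [mem_attach_hor]; grind

theorem attach_hor_two {i : ℤ} :
    (i, j₀ - 2) ∈ (attach P j₀ c).hor ↔ c.e₁ ≤ i ∧ i < c.e₂ := by
  rw [mem_attach_hor]; grind

theorem attach_hor_below {i j : ℤ} (hj : j < j₀ - 2) : (i, j) ∉ (attach P j₀ c).hor := by
  rw [mem_attach_hor]; grind

theorem attach_isBottom (hP : IsBottom P j₀ c.d₁ c.d₂) (hc : c.IsOrdered) :
    IsBottom (attach P j₀ c) (j₀ - 2) c.e₁ c.e₂ :=
  ⟨hc.he, fun _ => attach_ver_two hP, fun _ _ hj => attach_ver_below hP hj,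
    fun _ => attach_hor_two, fun _ _ hj => attach_hor_below hj⟩

theorem attach_isRegularAt (hP : IsBottom P j₀ c.d₁ c.d₂) (hr : ∀ i j, P.IsRegularAt i j)
    (hc : c.IsGood) (i j : ℤ) : (attach P j₀ c).IsRegularAt i j := by
  obtain ⟨⟨hd, h₁, h₂, h₃, he⟩, -⟩ := id hc
  unfold BondSet.IsRegularAt
  have hj : j₀ < j ∨ j = j₀ ∨ j = j₀ - 1 ∨ j = j₀ - 2 ∨ j < j₀ - 2 := by omega
  rcases hj with hj | rfl | rfl | rfl | hj
  · rw [attach_hor_of_lt hj, attach_hor_of_lt hj, attach_ver_of_le hj.le,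
      attach_ver_of_le (by omega)]
    exact hr i j
  · rw [attach_hor_zero, attach_hor_zero, attach_ver_of_le le_rfl, attach_ver_one hP, hP.row,
      Chunk.upperLevel]
    have h1 := tie_of_link hd h₁ h₂ h₃ hc.upper i
    have h2 := parity_step hd h₁ h₂ h₃ i
    rw [← mem_level hd h₁ h₂ h₃, ← mem_level hd h₁ h₂ h₃] at h2
    refine ⟨h2.trans ⟨Iff.symm, Iff.symm⟩, fun h => h1 h.2.2 h.2.1 h.1⟩
  · rw [attach_hor_one, attach_hor_one, attach_ver_one hP, sub_sub, one_add_one_eq_two,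
      attach_ver_two hP, Chunk.lowerLevel]
    have h1 := tie_of_link he h₁ h₂ h₃ hc.lower i
    have h2 := parity_step he h₁ h₂ h₃ i
    rw [← mem_level he h₁ h₂ h₃, ← mem_level he h₁ h₂ h₃] at h2
    exact ⟨h2, fun h => h1 h.2.1 h.2.2 h.1⟩
  · have := attach_ver_below hP (i := i) (j := j₀ - 2 - 1) (by omega)
    rw [attach_hor_two, attach_hor_two, attach_ver_two hP]
    simp only [this, iff_false, and_false, not_false_iff, and_true]
    omega
  · have h1 := attach_ver_below hP (i := i) hj
    have h2 := attach_ver_below hP (i := i) (j := j - 1) (by omega)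
    have h3 := attach_hor_below (P := P) (c := c) (i := i) hj
    have h4 := attach_hor_below (P := P) (c := c) (i := i - 1) hj
    tauto

/-- The two strands of the chunk, closed by the new cap, give all ends of its rows the colour of
`d₁`; in particular they join `d₁` to `d₂`, as the removed cap of `P` did. The rest follows from `P`
above the chunk and from the runs inside it. -/
theorem attach_isMonochromatic (hP : IsBottom P j₀ c.d₁ c.d₂) (hm : P.IsMonochromatic)
    (hc : c.IsGood) : (attach P j₀ c).IsMonochromatic := by
  obtain ⟨⟨hd, h₁, h₂, h₃, he⟩, hlink⟩ := id hc
  intro χ hh hv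
  have hup : ∀ i ∈ level c.d₁ c.d₂ c.u₁ c.u₂ c.u₃ c.u₄, (χ i j₀ ↔ χ (i + 1) j₀) :=
    fun i hi => hh i j₀ (attach_hor_zero.2 hi)
  have hlo : ∀ i ∈ level c.e₁ c.e₂ c.u₁ c.u₂ c.u₃ c.u₄, (χ i (j₀ - 1) ↔ χ (i + 1) (j₀ - 1)) :=
    fun i hi => hh i (j₀ - 1) (attach_hor_one.2 hi)
  have hcap : ∀ i, c.e₁ ≤ i → i ≤ c.e₂ → (χ i (j₀ - 2) ↔ χ c.e₁ (j₀ - 2)) :=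
    run_colour (χ := fun i => χ i (j₀ - 2)) fun i h h' => hh i (j₀ - 2) (attach_hor_two.2 ⟨h, h'⟩)
  have hu : ∀ i, (i = c.u₁ ∨ i = c.u₂ ∨ i = c.u₃ ∨ i = c.u₄) → (χ i (j₀ - 1) ↔ χ i j₀) := by
    intro i hi
    have := hv i (j₀ - 1) ((attach_ver_one hP).2 hi)
    rwa [sub_add_cancel] at this
  have hve : ∀ i, (i = c.e₁ ∨ i = c.e₂) → (χ i (j₀ - 2) ↔ χ i (j₀ - 1)) := by
    intro i hi
    have := hv i (j₀ - 2) ((attach_ver_two hP).2 hi)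
    rwa [show j₀ - 2 + 1 = j₀ - 1 by ring] at this
  have a1 := hu c.u₁ (by simp)
  have a2 := hu c.u₂ (by simp)
  have a3 := hu c.u₃ (by simp)
  have a4 := hu c.u₄ (by simp)
  have b1 := hve c.e₁ (by simp)
  have b2 := hve c.e₂ (by simp)
  have b3 := hcap c.e₂ he.le le_rfl
  have all : (χ c.d₂ j₀ ↔ χ c.d₁ j₀) ∧ (χ c.u₁ j₀ ↔ χ c.d₁ j₀) ∧ (χ c.u₂ j₀ ↔ χ c.d₁ j₀) ∧
      (χ c.u₃ j₀ ↔ χ c.d₁ j₀) ∧ (χ c.u₄ j₀ ↔ χ c.d₁ j₀) ∧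
      (χ c.e₁ (j₀ - 1) ↔ χ c.d₁ j₀) ∧ (χ c.e₂ (j₀ - 1) ↔ χ c.d₁ j₀) := by
    rcases hlink with ⟨l, l'⟩ | ⟨l, l'⟩ | ⟨l, l'⟩ | ⟨l, l'⟩
    · have x := LinkM.colour (χ := fun i => χ i j₀) l hd h₁ h₂ h₃ hup
      have y := LinkL.colour (χ := fun i => χ i (j₀ - 1)) l' he h₁ h₂ h₃ hlo
      grind
    · have x := LinkL.colour (χ := fun i => χ i j₀) l hd h₁ h₂ h₃ hup
      have y := LinkM.colour (χ := fun i => χ i (j₀ - 1)) l' he h₁ h₂ h₃ hlo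
      grind
    · have x := LinkM.colour (χ := fun i => χ i j₀) l hd h₁ h₂ h₃ hup
      have y := LinkR.colour (χ := fun i => χ i (j₀ - 1)) l' he h₁ h₂ h₃ hlo
      grind
    · have x := LinkR.colour (χ := fun i => χ i j₀) l hd h₁ h₂ h₃ hup
      have y := LinkM.colour (χ := fun i => χ i (j₀ - 1)) l' he h₁ h₂ h₃ hlo
      grind
  obtain ⟨k1, k2, k3, k4, k5, k6, k7⟩ := all
  have hdA : ∀ i, (i = c.d₁ ∨ i = c.d₂) → (χ i j₀ ↔ χ c.d₁ j₀) := by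
    rintro i (rfl | rfl)
    exacts [Iff.rfl, k1]
  have huA : ∀ i, (i = c.u₁ ∨ i = c.u₂ ∨ i = c.u₃ ∨ i = c.u₄) → (χ i j₀ ↔ χ c.d₁ j₀) := by
    rintro i (rfl | rfl | rfl | rfl)
    exacts [k2, k3, k4, k5]
  have huA' : ∀ i, (i = c.u₁ ∨ i = c.u₂ ∨ i = c.u₃ ∨ i = c.u₄) →
      (χ i (j₀ - 1) ↔ χ c.d₁ j₀) := fun i hi => (hu i hi).trans (huA i hi)
  have heA : ∀ i, (i = c.e₁ ∨ i = c.e₂) → (χ i (j₀ - 1) ↔ χ c.d₁ j₀) := by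
    rintro i (rfl | rfl)
    exacts [k6, k7]
  have hPd : (c.d₁, j₀) ∈ P.vertices :=
    (BondSet.mem_vertices _ _ _).2 (Or.inr (Or.inl ((hP.row _).2 (Or.inl rfl))))
  have main : ∀ i j, (i, j) ∈ (attach P j₀ c).vertices → (χ i j ↔ χ c.d₁ j₀) := by
    intro i j hij
    rw [BondSet.mem_vertices] at hij
    have hj : j₀ < j ∨ j = j₀ ∨ j = j₀ - 1 ∨ j = j₀ - 2 ∨ j < j₀ - 2 := by omega
    rcases hj with hj | rfl | rfl | rfl | hj
    -- The cap of `P` is gone, so `χ` need not be constant along it. Flattening the colouring at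
    -- height `j₀` and below makes it one that `P` respects.
    · have := hm (fun i j => if j₀ < j then χ i j else χ c.d₁ j₀) ?_ ?_ i j c.d₁ j₀ ?_ hPd
      · simpa [hj] using this
      · intro k l hkl
        split_ifs with h
        · exact hh _ _ ((attach_hor_of_lt h).2 hkl)
        · rfl
      · intro k l hkl
        have hl : j₀ ≤ l := le_of_not_gt fun h => hP.below _ _ h hkl
        have := hv k l ((attach_ver_of_le hl).2 hkl)
        rcases hl.lt_or_eq with h | rfl
        · simpa only [if_pos h, if_pos (h.trans (lt_add_one l))] using this
        · simp only [lt_irrefl, if_false, lt_add_one, if_true]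
          rw [← this]
          exact (hdA k ((hP.row _).1 hkl)).symm
      · rw [BondSet.mem_vertices]
        rwa [attach_hor_of_lt hj, attach_hor_of_lt hj, attach_ver_of_le hj.le,
          attach_ver_of_le (by omega)] at hij
    · rw [attach_hor_zero, attach_hor_zero, attach_ver_of_le le_rfl, attach_ver_one hP, hP.row]
        at hij
      have := level_colour (χ := fun i => χ i j) hd h₁ h₂ h₃ hup hc.upper hdA huA i
      rcases hij with h | h | h | h
      exacts [this (Or.inl h), hdA i h, this (Or.inr h), huA i h]
    · rw [attach_hor_one, attach_hor_one, attach_ver_one hP, sub_sub, one_add_one_eq_two,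
        attach_ver_two hP] at hij
      have := level_colour (χ := fun i => χ i (j₀ - 1)) he h₁ h₂ h₃ hlo hc.lower heA huA' i
      rcases hij with h | h | h | h
      exacts [this (Or.inl h), huA' i h, this (Or.inr h), heA i h]
    · rw [attach_hor_two, attach_hor_two, attach_ver_two hP] at hij
      have hn := attach_ver_below hP (i := i) (j := j₀ - 2 - 1) (by omega)
      have : c.e₁ ≤ i ∧ i ≤ c.e₂ := by
        rcases hij with h | h | h | h
        · omega
        · omega
        · omega
        · exact absurd h hn
      rw [hcap i this.1 this.2, b1, k6]
    · have h1 := attach_ver_below hP (i := i) hj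
      have h2 := attach_ver_below hP (i := i) (j := j - 1) (by omega)
      have h3 := attach_hor_below (P := P) (c := c) (i := i) hj
      have h4 := attach_hor_below (P := P) (c := c) (i := i - 1) hj
      rcases hij with h | h | h | h
      exacts [absurd h h3, absurd h h1, absurd h h4, absurd h h2]
  intro i j k l h h'
  rw [main i j h, main k l h']

theorem attach_isPoly {m : ℕ} (hP : IsPoly P j₀ m) (hb : IsBottom P j₀ c.d₁ c.d₂)
    (hc : c.IsGood) : IsPoly (attach P j₀ c) (j₀ - 2) (m + 1) := by
  have hpoly := (BondSet.isPolygon_iff P).1 hP.1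
  have ho := hc.1
  refine ⟨(BondSet.isPolygon_iff _).2 ⟨⟨(c.e₁, j₀ - 2), ?_⟩, ?_, ?_⟩, fun j => ?_⟩
  · exact (BondSet.mem_vertices _ _ _).2 (Or.inr (Or.inl ((attach_ver_two hb).2 (Or.inl rfl))))
  · exact attach_isMonochromatic hb hpoly.2.1 hc
  · exact attach_isRegularAt hb hpoly.2.2 hc
  · have hj : j₀ ≤ j ∨ j = j₀ - 1 ∨ j = j₀ - 2 ∨ j < j₀ - 2 := by omega
    rcases hj with hj | rfl | rfl | hj
    · have := hP.2 j
      rw [rowCount_eq_card_image, show ((attach P j₀ c).ver.filter fun b => b.2 = j).image Prod.fst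
        = (P.ver.filter fun b => b.2 = j).image Prod.fst from ?_, ← rowCount_eq_card_image, this]
      · have e : Even (j - j₀) ↔ Even (j - (j₀ - 2)) := by
          rw [show j - (j₀ - 2) = j - j₀ + 2 by ring, Int.even_add]; simp
        have e' : (j₀ ≤ j ∧ j ≤ j₀ + 2 * (m : ℤ)) ↔
            (j₀ - 2 ≤ j ∧ j ≤ j₀ - 2 + 2 * ((m + 1 : ℕ) : ℤ)) := by push_cast; omega
        simp only [e, e']
      · ext i
        rw [mem_row_image, mem_row_image, attach_ver_of_le hj]
    · rw [if_pos (by push_cast; omega), if_neg]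
      · exact rowCount_eq_four.2 ⟨_, _, _, _, ho.h₁, ho.h₂, ho.h₃, fun i => attach_ver_one hb⟩
      · rw [show j₀ - 1 - (j₀ - 2) = 1 by ring]; decide
    · rw [if_pos (by push_cast; omega), if_pos (by simp)]
      exact rowCount_eq_two.2 ⟨_, _, ho.he, fun i => attach_ver_two hb⟩
    · rw [if_neg (by omega)]
      exact rowCount_eq_zero.2 fun i => attach_ver_below hb hj

end

/-! ### Cutting the last two rows off a polygon -/

theorem hor_eq_level {P : BondSet} (hP : ∀ i j, P.IsRegularAt i j) {j d₁ d₂ u₁ u₂ u₃ u₄ : ℤ}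
    (hd : d₁ < d₂) (h₁ : u₁ < u₂) (h₂ : u₂ < u₃) (h₃ : u₃ < u₄)
    (h : ∀ i, ((i, j) ∈ P.ver ↔ (i, j - 1) ∈ P.ver) ↔
      ((i = u₁ ∨ i = u₂ ∨ i = u₃ ∨ i = u₄) ↔ (i = d₁ ∨ i = d₂))) (i : ℤ) :
    (i, j) ∈ P.hor ↔ i ∈ level d₁ d₂ u₁ u₂ u₃ u₄ := by
  obtain ⟨M, hM, hM'⟩ := exists_forall_lt_notMem P.hor j (min d₁ u₁)
  refine eq_of_step (h := fun i => (i, j) ∈ P.hor) (h' := fun i => i ∈ level d₁ d₂ u₁ u₂ u₃ u₄)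
    (fun i => (hP i j).1) (fun i => ?_) M hM' (fun i hi hl => ?_) i
  · rw [h, mem_level hd h₁ h₂ h₃, mem_level hd h₁ h₂ h₃]
    exact parity_step hd h₁ h₂ h₃ i
  · rw [level, Finset.mem_filter, Finset.mem_Ico] at hl
    omega

/-- Three consecutive rows of `Q`, the topmost of height `j₀`, form the chunk `c`. -/
structure HasChunk (Q : BondSet) (j₀ : ℤ) (c : Chunk) : Prop where
  ord : c.IsOrdered
  row₀ : ∀ i, (i, j₀) ∈ Q.ver ↔ i = c.d₁ ∨ i = c.d₂
  row₁ : ∀ i, (i, j₀ - 1) ∈ Q.ver ↔ i = c.u₁ ∨ i = c.u₂ ∨ i = c.u₃ ∨ i = c.u₄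
  row₂ : ∀ i, (i, j₀ - 2) ∈ Q.ver ↔ i = c.e₁ ∨ i = c.e₂
  hor₀ : ∀ i, (i, j₀) ∈ Q.hor ↔ i ∈ c.upperLevel
  hor₁ : ∀ i, (i, j₀ - 1) ∈ Q.hor ↔ i ∈ c.lowerLevel

/-- A colouring of the two levels of a chunk that extends to a colouring of the polygon is
constant. -/
theorem HasChunk.colour {Q : BondSet} {j₀ : ℤ} {c : Chunk} (h : HasChunk Q j₀ c)
    (hm : Q.IsMonochromatic) (α β : ℤ → Prop) (T B : Prop)
    (h0 : ∀ i ∈ c.upperLevel, (α i ↔ α (i + 1))) (h1 : ∀ i ∈ c.lowerLevel, (β i ↔ β (i + 1)))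
    (hd : (α c.d₁ ↔ T) ∧ (α c.d₂ ↔ T)) (hu : (α c.u₁ ↔ β c.u₁) ∧ (α c.u₂ ↔ β c.u₂) ∧
      (α c.u₃ ↔ β c.u₃) ∧ (α c.u₄ ↔ β c.u₄)) (he : (β c.e₁ ↔ B) ∧ (β c.e₂ ↔ B)) :
    (T ↔ B) ∧ (α c.u₂ ↔ B) ∧ (α c.u₃ ↔ B) := by
  -- The colouring is extended by the constants `T` above the two levels and `B` below them;
  -- monochromaticity is then compared at one vertex above, one below, and at `u₂` and `u₃`.
  have key := hm (fun i j => if j₀ < j then T else if j = j₀ then α i else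
    if j = j₀ - 1 then β i else B) ?_ ?_
  · have v1 : (c.d₁, j₀ + 1) ∈ Q.vertices := (BondSet.mem_vertices _ _ _).2
      (Or.inr (Or.inr (Or.inr (by rw [add_sub_cancel_right, h.row₀]; simp))))
    have v2 : (c.e₁, j₀ - 2) ∈ Q.vertices := (BondSet.mem_vertices _ _ _).2
      (Or.inr (Or.inl (by rw [h.row₂]; simp)))
    have v3 : (c.u₂, j₀) ∈ Q.vertices := (BondSet.mem_vertices _ _ _).2
      (Or.inr (Or.inr (Or.inr (by rw [h.row₁]; simp))))
    have v4 : (c.u₃, j₀) ∈ Q.vertices := (BondSet.mem_vertices _ _ _).2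
      (Or.inr (Or.inr (Or.inr (by rw [h.row₁]; simp))))
    have k1 := key _ _ _ _ v1 v2
    have k2 := key _ _ _ _ v3 v2
    have k3 := key _ _ _ _ v4 v2
    simp (disch := omega) only [if_pos, if_neg] at k1 k2 k3
    exact ⟨k1, k2, k3⟩
  · intro i j hij
    have hj : j₀ < j ∨ j = j₀ ∨ j = j₀ - 1 ∨ j < j₀ - 1 := by omega
    rcases hj with hj | rfl | rfl | hj
    · simp (disch := omega) only [if_pos]
    · simp (disch := omega) only [if_neg]
      exact h0 i ((h.hor₀ i).1 hij)
    · simp (disch := omega) only [if_neg]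
      exact h1 i ((h.hor₁ i).1 hij)
    · simp (disch := omega) only [if_neg]
  · intro i j hij
    have hj : j₀ < j ∨ j = j₀ ∨ j = j₀ - 1 ∨ j = j₀ - 2 ∨ j < j₀ - 2 := by omega
    rcases hj with hj | rfl | rfl | rfl | hj
    · simp (disch := omega) only [if_pos]
    · simp (disch := omega) only [if_pos, if_neg]
      rcases (h.row₀ i).1 hij with rfl | rfl
      exacts [hd.1, hd.2]
    · simp (disch := omega) only [if_pos, if_neg]
      rcases (h.row₁ i).1 hij with rfl | rfl | rfl | rfl
      exacts [hu.1.symm, hu.2.1.symm, hu.2.2.1.symm, hu.2.2.2.symm]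
    · simp (disch := omega) only [if_pos, if_neg]
      rcases (h.row₂ i).1 hij with rfl | rfl
      exacts [he.1.symm, he.2.symm]
    · simp (disch := omega) only [if_neg]

-- Each link pattern that is not good leaves a component that misses part of the polygon. Colouring
-- that component differently from the rest contradicts `HasChunk.colour`.
set_option linter.unusedSimpArgs false in
theorem HasChunk.isGood {Q : BondSet} {j₀ : ℤ} {c : Chunk} (h : HasChunk Q j₀ c)
    (hm : Q.IsMonochromatic) (hr : ∀ i j, Q.IsRegularAt i j) : c.IsGood := by
  obtain ⟨hd, h₁, h₂, h₃, he⟩ := h.ord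
  have up := link_cases hd h₁ h₂ h₃ fun i hi => (hr i j₀).2
    ⟨(h.hor₀ i).2 ((mem_level hd h₁ h₂ h₃ i).2 hi.1), (h.row₀ i).2 hi.2.2, (h.row₁ i).2 hi.2.1⟩
  have lo := link_cases he h₁ h₂ h₃ fun i hi => (hr i (j₀ - 1)).2
    ⟨(h.hor₁ i).2 ((mem_level he h₁ h₂ h₃ i).2 hi.1), (h.row₁ i).2 hi.2.1,
      by rw [sub_sub]; exact (h.row₂ i).2 hi.2.2⟩
  have col := h.colour hm
  refine ⟨h.ord, ?_⟩
  rcases up with up | up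
  -- If `d₁` and `d₂` are linked to each other, the part above closes up along `[d₁, d₂]` and never
  -- meets the middle row.
  · have := col (fun i => c.d₁ ≤ i ∧ i ≤ c.d₂) (fun _ => False) True False (fun i hi => ?_)
      (fun i _ => Iff.rfl) (by simp only [iff_true, iff_false]; omega)
      (by simp only [iff_true, iff_false]; unfold LinkSelf at up; omega) (by simp)
    · simp at this
    · have := up.mem_level hd h₁ h₂ h₃ i hi
      unfold LinkSelf at up
      omega
  rcases lo with lo | lo
  · have := col (fun _ => False) (fun i => c.e₁ ≤ i ∧ i ≤ c.e₂) False True (fun i _ => Iff.rfl)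
      (fun i hi => ?_) (by simp)
      (by unfold LinkSelf at lo; refine ⟨?_, ?_, ?_, ?_⟩ <;> simp only [false_iff] <;> omega)
      (by simp only [iff_true, iff_false]; omega)
    · simp at this
    · have := lo.mem_level he h₁ h₂ h₃ i hi
      unfold LinkSelf at lo
      omega
  -- Of the nine patterns four are good. For equal types the inner pair linked on both levels is a
  -- closed component: `u₁, u₂` for L, `u₂, u₃` for M, `u₃, u₄` for R. For L with R the strands
  -- return to the row they came from, so top and bottom are disconnected.
  rcases up with up | up | up <;> rcases lo with lo | lo | lo
  · have r := fun i => ((up.isRuns hd h₁ h₂ h₃).2 i).1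
    have r' := fun i => ((lo.isRuns he h₁ h₂ h₃).2 i).1
    unfold LinkL at up lo
    have := col (fun i => i ≤ c.u₂) (fun i => i ≤ c.u₂) False False
      (fun i hi => by have := r i hi; omega) (fun i hi => by have := r' i hi; omega)
      (by simp only [iff_true, iff_false]; omega) (by simp)
      (by simp only [iff_true, iff_false]; omega)
    simp at this
  · exact Or.inr (Or.inl ⟨up, lo⟩)
  · have r := fun i => ((up.isRuns hd h₁ h₂ h₃).2 i).1
    have r' := fun i => ((lo.isRuns he h₁ h₂ h₃).2 i).1
    unfold LinkL at up
    unfold LinkR at lo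
    have := col (fun i => i ≤ c.u₂) (fun i => i < c.u₃) False True
      (fun i hi => by have := r i hi; omega) (fun i hi => by have := r' i hi; omega)
      (by simp only [iff_true, iff_false]; omega) (by omega)
      (by simp only [iff_true, iff_false]; omega)
    simp at this
  · exact Or.inl ⟨up, lo⟩
  · have r := fun i => ((up.isRuns hd h₁ h₂ h₃).2 i).1
    have r' := fun i => ((lo.isRuns he h₁ h₂ h₃).2 i).1
    unfold LinkM at up lo
    have := col (fun i => c.u₂ ≤ i ∧ i ≤ c.u₃) (fun i => c.u₂ ≤ i ∧ i ≤ c.u₃) False False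
      (fun i hi => by have := r i hi; omega) (fun i hi => by have := r' i hi; omega)
      (by simp only [iff_true, iff_false]; omega) (by simp)
      (by simp only [iff_true, iff_false]; omega)
    have := h₂.le
    simp_all
  · exact Or.inr (Or.inr (Or.inl ⟨up, lo⟩))
  · have r := fun i => ((up.isRuns hd h₁ h₂ h₃).2 i).1
    have r' := fun i => ((lo.isRuns he h₁ h₂ h₃).2 i).1
    unfold LinkR at up
    unfold LinkL at lo
    have := col (fun i => i < c.u₃) (fun i => i ≤ c.u₂) True False
      (fun i hi => by have := r i hi; omega) (fun i hi => by have := r' i hi; omega)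
      (by simp only [iff_true, iff_false]; omega) (by omega)
      (by simp only [iff_true, iff_false]; omega)
    simp at this
  · exact Or.inr (Or.inr (Or.inr ⟨up, lo⟩))
  · have r := fun i => ((up.isRuns hd h₁ h₂ h₃).2 i).1
    have r' := fun i => ((lo.isRuns he h₁ h₂ h₃).2 i).1
    unfold LinkR at up lo
    have := col (fun i => c.u₃ ≤ i) (fun i => c.u₃ ≤ i) False False
      (fun i hi => by have := r i hi; omega) (fun i hi => by have := r' i hi; omega)
      (by simp only [iff_true, iff_false]; omega) (by simp)
      (by simp only [iff_true, iff_false]; omega)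
    simp at this

theorem IsPoly.exists_hasChunk {Q : BondSet} {j₀ : ℤ} {m : ℕ} (h : IsPoly Q (j₀ - 2) (m + 1)) :
    ∃ c, HasChunk Q j₀ c := by
  have hr := ((BondSet.isPolygon_iff Q).1 h.1).2.2
  obtain ⟨d₁, d₂, hd, hrow⟩ := rowCount_eq_two.1 ((h.2 j₀).trans (by
    rw [if_pos (by push_cast; omega), if_pos (by simp)]))
  obtain ⟨u₁, u₂, u₃, u₄, h₁, h₂, h₃, hrow'⟩ := rowCount_eq_four.1 ((h.2 (j₀ - 1)).trans (by
    rw [if_pos (by push_cast; omega), if_neg]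
    rw [show j₀ - 1 - (j₀ - 2) = 1 by ring]; decide))
  obtain ⟨e₁, e₂, he, hrow''⟩ := rowCount_eq_two.1 ((h.2 (j₀ - 2)).trans (by
    rw [if_pos (by push_cast; omega), if_pos (by simp)]))
  refine ⟨⟨d₁, d₂, u₁, u₂, u₃, u₄, e₁, e₂⟩, ⟨hd, h₁, h₂, h₃, he⟩, hrow, hrow', hrow'',
    hor_eq_level hr hd h₁ h₂ h₃ fun i => ?_, hor_eq_level hr he h₁ h₂ h₃ fun i => ?_⟩
  · rw [hrow, hrow']
    exact ⟨Iff.symm, Iff.symm⟩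
  · rw [sub_sub, one_add_one_eq_two, hrow', hrow'']

/-- The upper part of a polygon, closed by a cap at height `j₀`. -/
noncomputable def detach (Q : BondSet) (j₀ d₁ d₂ : ℤ) : BondSet where
  hor := (Q.hor.filter fun b => j₀ < b.2) ∪ (Finset.Ico d₁ d₂).image fun i => (i, j₀)
  ver := Q.ver.filter fun b => j₀ ≤ b.2

theorem mem_detach_ver {Q : BondSet} {j₀ d₁ d₂ i j : ℤ} :
    (i, j) ∈ (detach Q j₀ d₁ d₂).ver ↔ j₀ ≤ j ∧ (i, j) ∈ Q.ver := by
  simp [detach, and_comm]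

theorem mem_detach_hor {Q : BondSet} {j₀ d₁ d₂ i j : ℤ} :
    (i, j) ∈ (detach Q j₀ d₁ d₂).hor ↔ (j₀ < j ∧ (i, j) ∈ Q.hor) ∨ (j = j₀ ∧ d₁ ≤ i ∧ i < d₂) := by
  simp only [detach, Finset.mem_union, Finset.mem_image, Prod.mk.injEq, Finset.mem_filter,
    Finset.mem_Ico]
  grind

theorem detach_isBottom {Q : BondSet} {j₀ d₁ d₂ : ℤ} (hd : d₁ < d₂)
    (h : ∀ i, (i, j₀) ∈ Q.ver ↔ i = d₁ ∨ i = d₂) : IsBottom (detach Q j₀ d₁ d₂) j₀ d₁ d₂ where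
  lt := hd
  row i := by simp [mem_detach_ver, h]
  below i j hj := by rw [mem_detach_ver]; omega
  cap i := by simp [mem_detach_hor]
  hbelow i j hj := by rw [mem_detach_hor]; omega

/-- The cap takes over the role of everything cut off: a colouring respected by the upper part and
its cap extends to `Q` by the constant `χ d₁ j₀` at and below `j₀`. -/
theorem detach_isPoly {Q : BondSet} {j₀ : ℤ} {m : ℕ} (h : IsPoly Q (j₀ - 2) (m + 1)) {d₁ d₂ : ℤ}
    (hd : d₁ < d₂) (hrow : ∀ i, (i, j₀) ∈ Q.ver ↔ i = d₁ ∨ i = d₂) :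
    IsPoly (detach Q j₀ d₁ d₂) j₀ m := by
  have hb := detach_isBottom hd hrow
  obtain ⟨-, hm, hr⟩ := (BondSet.isPolygon_iff Q).1 h.1
  refine ⟨(BondSet.isPolygon_iff _).2 ⟨⟨(d₁, j₀), ?_⟩, ?_, ?_⟩, fun j => ?_⟩
  · exact (BondSet.mem_vertices _ _ _).2 (Or.inr (Or.inl ((hb.row _).2 (Or.inl rfl))))
  · intro χ hh hv
    have hcap : ∀ i, d₁ ≤ i → i ≤ d₂ → (χ i j₀ ↔ χ d₁ j₀) :=
      run_colour (χ := fun i => χ i j₀) fun i h h' => hh i j₀ ((hb.cap i).2 ⟨h, h'⟩)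
    have hQd : (d₁, j₀) ∈ Q.vertices :=
      (BondSet.mem_vertices _ _ _).2 (Or.inr (Or.inl ((hrow _).2 (Or.inl rfl))))
    have main : ∀ i j, (i, j) ∈ (detach Q j₀ d₁ d₂).vertices → (χ i j ↔ χ d₁ j₀) := by
      intro i j hij
      rw [BondSet.mem_vertices, mem_detach_hor, mem_detach_hor, mem_detach_ver, mem_detach_ver]
        at hij
      rcases lt_trichotomy j₀ j with hj | rfl | hj
      · have := hm (fun i j => if j₀ < j then χ i j else χ d₁ j₀) ?_ ?_ i j d₁ j₀ ?_ hQd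
        · simpa [hj] using this
        · intro k l hkl
          split_ifs with h
          · exact hh _ _ (mem_detach_hor.2 (Or.inl ⟨h, hkl⟩))
          · rfl
        · intro k l hkl
          rcases lt_trichotomy j₀ l with hl | rfl | hl
          · simpa only [if_pos hl, if_pos (hl.trans (lt_add_one l))] using
              hv k l (mem_detach_ver.2 ⟨hl.le, hkl⟩)
          · have := hv k j₀ (mem_detach_ver.2 ⟨le_rfl, hkl⟩)
            simp only [lt_irrefl, if_false, lt_add_one, if_true]
            rw [← this]
            rcases (hrow k).1 hkl with rfl | rfl
            exacts [Iff.rfl, (hcap _ hd.le le_rfl).symm]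
          · rw [if_neg (by omega), if_neg (by omega)]
        · rw [BondSet.mem_vertices]
          have : ¬ j = j₀ := hj.ne'
          tauto
      · rw [hrow] at hij
        exact hcap i (by omega) (by omega)
      · omega
    intro i j k l h h'
    rw [main i j h, main k l h']
  · intro i j
    unfold BondSet.IsRegularAt
    rw [mem_detach_hor, mem_detach_hor, mem_detach_ver, mem_detach_ver]
    rcases lt_trichotomy j₀ j with hj | rfl | hj
    · have := hr i j
      unfold BondSet.IsRegularAt at this
      simpa [hj, hj.le, hj.ne', show j₀ ≤ j - 1 by omega] using this
    · rw [hrow]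
      simp
      omega
    · simp [hj.ne, hj.not_gt, hj.not_ge, show ¬ j₀ ≤ j - 1 by omega]
  · rcases le_or_gt j₀ j with hj | hj
    · have := h.2 j
      rw [rowCount_eq_card_image, show ((detach Q j₀ d₁ d₂).ver.filter fun b => b.2 = j).image
        Prod.fst = (Q.ver.filter fun b => b.2 = j).image Prod.fst from ?_,
        ← rowCount_eq_card_image, this]
      · have e : Even (j - j₀) ↔ Even (j - (j₀ - 2)) := by
          rw [show j - (j₀ - 2) = j - j₀ + 2 by ring, Int.even_add]; simp
        have e' : (j₀ ≤ j ∧ j ≤ j₀ + 2 * (m : ℤ)) ↔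
            (j₀ - 2 ≤ j ∧ j ≤ j₀ - 2 + 2 * ((m + 1 : ℕ) : ℤ)) := by push_cast; omega
        simp only [e, e']
      · ext i
        rw [mem_row_image, mem_row_image, mem_detach_ver, and_iff_right hj]
    · rw [if_neg (by omega)]
      exact rowCount_eq_zero.2 fun i => by rw [mem_detach_ver]; omega

theorem IsPoly.exists_attach {Q : BondSet} {j₀ : ℤ} {m : ℕ} (h : IsPoly Q (j₀ - 2) (m + 1)) :
    ∃ P c, IsPoly P j₀ m ∧ IsBottom P j₀ c.d₁ c.d₂ ∧ c.IsGood ∧ Q = attach P j₀ c := by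
  obtain ⟨c, hc⟩ := h.exists_hasChunk
  obtain ⟨-, hm, hr⟩ := (BondSet.isPolygon_iff Q).1 h.1
  obtain ⟨e₁, e₂, he⟩ := h.exists_isBottom
  have hb := detach_isBottom hc.ord.hd hc.row₀
  -- The cap and the emptiness below it come from `exists_isBottom`, whose ends have to be
  -- identified with the last row of the chunk.
  have hee : e₁ = c.e₁ ∧ e₂ = c.e₂ := by
    have := he.lt
    have := hc.ord.he
    have a := fun i => (he.row i).symm.trans (hc.row₂ i)
    have a1 := a e₁; have a2 := a e₂; have a3 := a c.e₁; have a4 := a c.e₂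
    omega
  refine ⟨_, c, detach_isPoly h hc.ord.hd hc.row₀, hb, hc.isGood hm hr, ?_⟩
  apply BondSet.ext
  · ext ⟨i, j⟩
    have hj : j₀ < j ∨ j = j₀ ∨ j = j₀ - 1 ∨ j = j₀ - 2 ∨ j < j₀ - 2 := by omega
    rcases hj with hj | rfl | rfl | rfl | hj
    · rw [attach_hor_of_lt hj, mem_detach_hor]
      have : ¬ j = j₀ := hj.ne'
      tauto
    · rw [attach_hor_zero, hc.hor₀]
    · rw [attach_hor_one, hc.hor₁]
    · rw [attach_hor_two, he.cap, hee.1, hee.2]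
    · exact iff_of_false (he.hbelow _ _ hj) (attach_hor_below hj)
  · ext ⟨i, j⟩
    have hj : j₀ ≤ j ∨ j = j₀ - 1 ∨ j = j₀ - 2 ∨ j < j₀ - 2 := by omega
    rcases hj with hj | rfl | rfl | hj
    · rw [attach_ver_of_le hj, mem_detach_ver, and_iff_right hj]
    · rw [attach_ver_one hb, hc.row₁]
    · rw [attach_ver_two hb, hc.row₂]
    · exact iff_of_false (he.below _ _ hj) (attach_ver_below hb hj)

/-! ### Perimeters -/

theorem card_image_row (s : Finset ℤ) (j : ℤ) :
    (s.image fun i => ((i, j) : ℤ × ℤ)).card = s.card :=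
  Finset.card_image_of_injective _ fun _ _ h => (Prod.mk.inj h).1

theorem mem_image_row (s : Finset ℤ) (i j j₀ : ℤ) :
    (i, j) ∈ s.image (fun i => ((i, j₀) : ℤ × ℤ)) ↔ j = j₀ ∧ i ∈ s := by
  simp only [Finset.mem_image, Prod.mk.injEq]
  exact ⟨fun ⟨a, h, e, e'⟩ => ⟨e'.symm, e ▸ h⟩, fun ⟨e, h⟩ => ⟨i, h, rfl, e.symm⟩⟩

theorem IsBottom.card_hor {P : BondSet} {j₀ d₁ d₂ : ℤ} (h : IsBottom P j₀ d₁ d₂) :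
    (P.hor.card : ℤ) = (P.hor.filter fun b => j₀ < b.2).card + (d₂ - d₁) := by
  have e : P.hor = (P.hor.filter fun b => j₀ < b.2) ∪ (Finset.Ico d₁ d₂).image fun i => (i, j₀) := by
    ext ⟨i, j⟩
    simp only [Finset.mem_union, Finset.mem_filter, mem_image_row, Finset.mem_Ico]
    have h1 := h.cap i
    have h2 := h.hbelow i j
    rcases lt_trichotomy j₀ j with hj | rfl | hj
    · grind
    · grind
    · grind
  have hd := h.lt
  conv_lhs => rw [e]
  rw [Finset.card_union_of_disjoint, card_image_row, Int.card_Ico]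
  · push_cast; omega
  · rw [Finset.disjoint_left]
    rintro ⟨i, j⟩
    simp only [Finset.mem_filter, Finset.mem_image, Prod.mk.injEq]
    rintro h1 ⟨a, -, -, rfl⟩
    exact lt_irrefl _ h1.2

theorem IsBottom.card_attach_hor {P : BondSet} {j₀ : ℤ} {c : Chunk}
    (h : IsBottom P j₀ c.d₁ c.d₂) (hc : c.IsOrdered) :
    ((attach P j₀ c).hor.card : ℤ) = P.hor.card - (c.d₂ - c.d₁) + c.upperLevel.card +
      c.lowerLevel.card + (c.e₂ - c.e₁) := by
  have he := hc.he
  rw [h.card_hor, attach, Finset.card_union_of_disjoint, Finset.card_union_of_disjoint,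
    Finset.card_union_of_disjoint, card_image_row, card_image_row, card_image_row, Int.card_Ico]
  · push_cast; omega
  all_goals
    rw [Finset.disjoint_left]
    rintro ⟨i, j⟩
    simp only [Finset.mem_filter, Finset.mem_image, Finset.mem_union, Prod.mk.injEq]
    grind

theorem IsBottom.card_attach_ver {P : BondSet} {j₀ : ℤ} {c : Chunk}
    (h : IsBottom P j₀ c.d₁ c.d₂) (hc : c.IsOrdered) :
    (attach P j₀ c).ver.card = P.ver.card + 6 := by
  obtain ⟨hd, h₁, h₂, h₃, he⟩ := hc
  rw [attach, Finset.card_union_of_disjoint, Finset.card_union_of_disjoint, card_image_row,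
    card_image_row, Finset.card_insert_of_notMem, Finset.card_insert_of_notMem,
    Finset.card_insert_of_notMem, Finset.card_singleton, Finset.card_pair he.ne]
  · simp only [Finset.mem_singleton]; omega
  · simp only [Finset.mem_insert, Finset.mem_singleton]; omega
  · simp only [Finset.mem_insert, Finset.mem_singleton]; omega
  · rw [Finset.disjoint_left]
    rintro ⟨i, j⟩ hP
    have := h.below i j
    simp only [Finset.mem_image, Prod.mk.injEq]
    rintro ⟨a, -, -, rfl⟩
    exact this (by omega) hP
  · rw [Finset.disjoint_left]
    rintro ⟨i, j⟩ hP
    have := h.below i j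
    simp only [Finset.mem_image, Prod.mk.injEq, Finset.mem_union] at hP ⊢
    rintro ⟨a, -, -, rfl⟩
    rcases hP with hP | ⟨b, -, -, hb⟩
    · exact this (by omega) hP
    · omega

/-- The number of horizontal bonds that a chunk adds to a polygon, halved. -/
noncomputable def Chunk.cost (c : Chunk) : ℕ :=
  ((c.upperLevel.card + c.lowerLevel.card + (c.e₂ - c.e₁) - (c.d₂ - c.d₁)) / 2).toNat

theorem LinkL.card {d₁ d₂ u₁ u₂ u₃ u₄ : ℤ} (h : LinkL d₁ d₂ u₁ u₂ u₃ u₄) (hd : d₁ < d₂)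
    (h₁ : u₁ < u₂) (h₂ : u₂ < u₃) (h₃ : u₃ < u₄) : ((level d₁ d₂ u₁ u₂ u₃ u₄).card : ℤ) =
      (u₂ - u₁) + (max d₁ u₃ - min d₁ u₃) + (max d₂ u₄ - min d₂ u₄) :=
  (h.isRuns hd h₁ h₂ h₃).card

theorem LinkM.card {d₁ d₂ u₁ u₂ u₃ u₄ : ℤ} (h : LinkM d₁ d₂ u₁ u₂ u₃ u₄) (hd : d₁ < d₂)
    (h₁ : u₁ < u₂) (h₂ : u₂ < u₃) (h₃ : u₃ < u₄) : ((level d₁ d₂ u₁ u₂ u₃ u₄).card : ℤ) =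
      (max d₁ u₁ - min d₁ u₁) + (u₃ - u₂) + (max d₂ u₄ - min d₂ u₄) :=
  (h.isRuns hd h₁ h₂ h₃).card

theorem LinkR.card {d₁ d₂ u₁ u₂ u₃ u₄ : ℤ} (h : LinkR d₁ d₂ u₁ u₂ u₃ u₄) (hd : d₁ < d₂)
    (h₁ : u₁ < u₂) (h₂ : u₂ < u₃) (h₃ : u₃ < u₄) : ((level d₁ d₂ u₁ u₂ u₃ u₄).card : ℤ) =
      (max d₁ u₁ - min d₁ u₁) + (max d₂ u₂ - min d₂ u₂) + (u₄ - u₃) :=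
  (h.isRuns hd h₁ h₂ h₃).card

/-- Neither `/ 2` nor `toNat` in `cost` loses anything: every abscissa occurs an even number of
times modulo signs, and by the triangle inequality the runs and the lower row are at least as long
as the upper row. -/
theorem Chunk.IsGood.two_mul_cost {c : Chunk} (h : c.IsGood) : (2 * c.cost : ℤ) =
    c.upperLevel.card + c.lowerLevel.card + (c.e₂ - c.e₁) - (c.d₂ - c.d₁) := by
  obtain ⟨⟨hd, h₁, h₂, h₃, he⟩, h⟩ := h
  rw [Chunk.cost]
  rcases h with ⟨l, l'⟩ | ⟨l, l'⟩ | ⟨l, l'⟩ | ⟨l, l'⟩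
  · rw [Chunk.upperLevel, Chunk.lowerLevel, LinkM.card l hd h₁ h₂ h₃, LinkL.card l' he h₁ h₂ h₃]
    obtain ⟨a, b⟩ := l
    obtain ⟨a', b', c'⟩ := l'
    omega
  · rw [Chunk.upperLevel, Chunk.lowerLevel, LinkL.card l hd h₁ h₂ h₃, LinkM.card l' he h₁ h₂ h₃]
    obtain ⟨a, b, c⟩ := l
    obtain ⟨a', b'⟩ := l'
    omega
  · rw [Chunk.upperLevel, Chunk.lowerLevel, LinkM.card l hd h₁ h₂ h₃, LinkR.card l' he h₁ h₂ h₃]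
    obtain ⟨a, b⟩ := l
    obtain ⟨a', b', c'⟩ := l'
    omega
  · rw [Chunk.upperLevel, Chunk.lowerLevel, LinkR.card l hd h₁ h₂ h₃, LinkM.card l' he h₁ h₂ h₃]
    obtain ⟨a, b, c⟩ := l
    obtain ⟨a', b'⟩ := l'
    omega

/-! ### Rectangles -/

/-- The rectangle of height one with the vertical bonds `d₁` and `d₂`. -/
noncomputable def rect (j₀ d₁ d₂ : ℤ) : BondSet where
  hor := (Finset.Ico d₁ d₂).image (fun i => (i, j₀)) ∪ (Finset.Ico d₁ d₂).image fun i => (i, j₀ + 1)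
  ver := {(d₁, j₀), (d₂, j₀)}

theorem mem_rect_ver {j₀ d₁ d₂ i j : ℤ} :
    (i, j) ∈ (rect j₀ d₁ d₂).ver ↔ j = j₀ ∧ (i = d₁ ∨ i = d₂) := by
  simp only [rect, Finset.mem_insert, Finset.mem_singleton, Prod.mk.injEq]; tauto

theorem mem_rect_hor {j₀ d₁ d₂ i j : ℤ} :
    (i, j) ∈ (rect j₀ d₁ d₂).hor ↔ (j = j₀ ∨ j = j₀ + 1) ∧ d₁ ≤ i ∧ i < d₂ := by
  simp only [rect, Finset.mem_union, Finset.mem_image, Prod.mk.injEq, Finset.mem_Ico]; grind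

theorem rect_isBottom {j₀ d₁ d₂ : ℤ} (hd : d₁ < d₂) : IsBottom (rect j₀ d₁ d₂) j₀ d₁ d₂ where
  lt := hd
  row i := by simp [mem_rect_ver]
  below i j hj := by rw [mem_rect_ver]; omega
  cap i := by simp [mem_rect_hor]
  hbelow i j hj := by rw [mem_rect_hor]; omega

theorem card_rect_ver {j₀ d₁ d₂ : ℤ} (hd : d₁ < d₂) : (rect j₀ d₁ d₂).ver.card = 2 := by
  rw [rect, Finset.card_pair]; simp [hd.ne]

theorem card_rect_hor {j₀ d₁ d₂ : ℤ} (hd : d₁ < d₂) :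
    ((rect j₀ d₁ d₂).hor.card : ℤ) = 2 * (d₂ - d₁) := by
  rw [rect, Finset.card_union_of_disjoint, card_image_row, card_image_row, Int.card_Ico]
  · push_cast; omega
  · rw [Finset.disjoint_left]
    rintro ⟨i, j⟩
    simp only [Finset.mem_image, Prod.mk.injEq]
    grind

theorem rect_isPoly {j₀ d₁ d₂ : ℤ} (hd : d₁ < d₂) : IsPoly (rect j₀ d₁ d₂) j₀ 0 := by
  refine ⟨(BondSet.isPolygon_iff _).2 ⟨⟨(d₁, j₀), ?_⟩, ?_, fun i j => ?_⟩, fun j => ?_⟩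
  · rw [BondSet.mem_vertices, mem_rect_ver]; tauto
  · intro χ hh hv
    have h0 : ∀ i, d₁ ≤ i → i ≤ d₂ → (χ i j₀ ↔ χ d₁ j₀) :=
      run_colour (χ := fun i => χ i j₀) fun i h h' => hh i j₀ (mem_rect_hor.2 ⟨by simp, h, h'⟩)
    have h1 : ∀ i, d₁ ≤ i → i ≤ d₂ → (χ i (j₀ + 1) ↔ χ d₁ (j₀ + 1)) :=
      run_colour (χ := fun i => χ i (j₀ + 1)) fun i h h' =>
        hh i (j₀ + 1) (mem_rect_hor.2 ⟨by simp, h, h'⟩)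
    have h2 := hv d₁ j₀ (mem_rect_ver.2 (by simp))
    have main : ∀ i j, (i, j) ∈ (rect j₀ d₁ d₂).vertices → (χ i j ↔ χ d₁ j₀) := by
      intro i j hij
      rw [BondSet.mem_vertices, mem_rect_hor, mem_rect_hor, mem_rect_ver, mem_rect_ver] at hij
      have : (j = j₀ ∨ j = j₀ + 1) ∧ d₁ ≤ i ∧ i ≤ d₂ := by omega
      obtain ⟨rfl | rfl, a, b⟩ := this
      · exact h0 i a b
      · rw [h1 i a b, h2]
    intro i j k l h h'
    rw [main i j h, main k l h']
  · unfold BondSet.IsRegularAt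
    rw [mem_rect_hor, mem_rect_hor, mem_rect_ver, mem_rect_ver]
    rcases lt_or_ge j j₀ with hj | hj
    · omega
    rcases lt_or_ge (j₀ + 1) j with hj | hj
    · omega
    obtain rfl | rfl : j = j₀ ∨ j = j₀ + 1 := by omega
    · simp; omega
    · simp; omega
  · by_cases hj : j = j₀
    · rw [if_pos (by simp [hj]), if_pos (by simp [hj])]
      exact rowCount_eq_two.2 ⟨d₁, d₂, hd, fun i => by simp [mem_rect_ver, hj]⟩
    · rw [if_neg (by simp; omega)]
      exact rowCount_eq_zero.2 fun i => by simp [mem_rect_ver, hj]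

theorem IsPoly.eq_rect {P : BondSet} {j₀ : ℤ} (h : IsPoly P j₀ 0) :
    ∃ d₁ d₂, d₁ < d₂ ∧ P = rect j₀ d₁ d₂ := by
  obtain ⟨d₁, d₂, hb⟩ := h.exists_isBottom
  have hr := ((BondSet.isPolygon_iff P).1 h.1).2.2
  have ha : ∀ i j, j₀ < j → (i, j) ∉ P.ver := fun i j hj =>
    rowCount_eq_zero.1 ((h.2 j).trans (if_neg (by simp; omega))) i
  have hah : ∀ i j, j₀ + 1 < j → (i, j) ∉ P.hor := fun i j hj => by
    obtain ⟨M, -, hM'⟩ := exists_forall_lt_notMem P.hor j 0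
    refine fun hi => (eq_of_step (h := fun i => (i, j) ∈ P.hor) (h' := fun _ => False)
      (fun i => (hr i j).1) (fun i => ?_) M hM' (fun i hi => id) i).1 hi
    have h1 := ha i j (by omega)
    have h2 := ha i (j - 1) (by omega)
    tauto
  have htop : ∀ i, (i, j₀ + 1) ∈ P.hor ↔ d₁ ≤ i ∧ i < d₂ := hor_of_cap hr hb.lt fun i => by
    have := ha i (j₀ + 1) (by omega)
    rw [add_sub_cancel_right, hb.row]; tauto
  refine ⟨d₁, d₂, hb.lt, BondSet.ext ?_ ?_⟩
  · ext ⟨i, j⟩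
    rw [mem_rect_hor]
    have hj : j < j₀ ∨ j = j₀ ∨ j = j₀ + 1 ∨ j₀ + 1 < j := by omega
    rcases hj with hj | rfl | rfl | hj
    · exact iff_of_false (hb.hbelow i j hj) (by omega)
    · simp [hb.cap]
    · simp [htop]
    · exact iff_of_false (hah i j hj) (by omega)
  · ext ⟨i, j⟩
    rw [mem_rect_ver]
    rcases lt_trichotomy j j₀ with hj | rfl | hj
    · exact iff_of_false (hb.below i j hj) (by omega)
    · simp [hb.row]
    · exact iff_of_false (ha i j hj) (by omega)

/-! ### Bond counts by induction on the number of chunks -/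

theorem IsBottom.unique {P : BondSet} {j₀ d₁ d₂ d₁' d₂' : ℤ} (h : IsBottom P j₀ d₁ d₂)
    (h' : IsBottom P j₀ d₁' d₂') : d₁ = d₁' ∧ d₂ = d₂' := by
  have := h.lt
  have := h'.lt
  have a := fun i => (h.row i).symm.trans (h'.row i)
  have a1 := a d₁; have a2 := a d₂; have a3 := a d₁'; have a4 := a d₂'
  omega

/-- A rectangle has two vertical bonds and each chunk adds six; this is why only the powers `y ^ (3
n - 2)` occur in `f`. -/
theorem IsPoly.card_ver {P : BondSet} {j₀ : ℤ} {m : ℕ} (h : IsPoly P j₀ m) :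
    P.ver.card = 2 * (3 * m + 1) := by
  induction m generalizing P j₀ with
  | zero =>
    obtain ⟨d₁, d₂, hd, rfl⟩ := h.eq_rect
    exact card_rect_ver hd
  | succ m ih =>
    -- The smaller polygon has its bottom row at height `j₀ + 2`.
    rw [← add_sub_cancel_right j₀ 2] at h
    obtain ⟨Q, c, hQ, hb, hc, rfl⟩ := h.exists_attach
    rw [hb.card_attach_ver hc.1, ih hQ]
    ring

theorem IsPoly.even_card_hor {P : BondSet} {j₀ : ℤ} {m : ℕ} (h : IsPoly P j₀ m) :
    ∃ n : ℕ, P.hor.card = 2 * n := by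
  induction m generalizing P j₀ with
  | zero =>
    obtain ⟨d₁, d₂, hd, rfl⟩ := h.eq_rect
    have := card_rect_hor (j₀ := j₀) hd
    exact ⟨(d₂ - d₁).toNat, by omega⟩
  | succ m ih =>
    rw [← add_sub_cancel_right j₀ 2] at h
    obtain ⟨Q, c, hQ, hb, hc, rfl⟩ := h.exists_attach
    obtain ⟨n, hn⟩ := ih hQ
    have h1 := hb.card_attach_hor hc.1
    have h2 := hc.two_mul_cost
    exact ⟨n + c.cost, by omega⟩

/-! ### Translations -/

/-- The translate of `P` by `(a, b)`. -/
def shift (a b : ℤ) (P : BondSet) : BondSet where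
  hor := P.hor.map (Equiv.addRight ((a, b) : ℤ × ℤ)).toEmbedding
  ver := P.ver.map (Equiv.addRight ((a, b) : ℤ × ℤ)).toEmbedding

theorem mem_shift_hor {a b i j : ℤ} {P : BondSet} :
    (i, j) ∈ (shift a b P).hor ↔ (i - a, j - b) ∈ P.hor := by
  rw [shift, Finset.mem_map_equiv]; simp [sub_eq_add_neg]

theorem mem_shift_ver {a b i j : ℤ} {P : BondSet} :
    (i, j) ∈ (shift a b P).ver ↔ (i - a, j - b) ∈ P.ver := by
  rw [shift, Finset.mem_map_equiv]; simp [sub_eq_add_neg]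

theorem mem_shift_vertices {a b i j : ℤ} {P : BondSet} :
    (i, j) ∈ (shift a b P).vertices ↔ (i - a, j - b) ∈ P.vertices := by
  simp only [BondSet.mem_vertices, mem_shift_hor, mem_shift_ver, sub_right_comm]

theorem shift_shift (a b c d : ℤ) (P : BondSet) : shift a b (shift c d P) = shift (a + c) (b + d) P := by
  apply BondSet.ext <;> ext ⟨i, j⟩ <;> simp only [mem_shift_hor, mem_shift_ver, sub_sub]

theorem shift_zero (P : BondSet) : shift 0 0 P = P := by
  apply BondSet.ext <;> ext ⟨i, j⟩ <;> simp only [mem_shift_hor, mem_shift_ver, sub_zero]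

theorem card_shift_hor (a b : ℤ) (P : BondSet) : (shift a b P).hor.card = P.hor.card :=
  Finset.card_map _

theorem IsPoly.shift {P : BondSet} {j₀ : ℤ} {m : ℕ} (h : IsPoly P j₀ m) (a b : ℤ) :
    IsPoly (shift a b P) (j₀ + b) m := by
  obtain ⟨⟨⟨k, l⟩, hk⟩, hm, hr⟩ := (BondSet.isPolygon_iff P).1 h.1
  refine ⟨(BondSet.isPolygon_iff _).2 ⟨⟨(k + a, l + b), ?_⟩, ?_, fun i j => ?_⟩, fun j => ?_⟩
  · rw [mem_shift_vertices]; simpa using hk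
  · intro χ hh hv i j k l h1 h2
    have := hm (fun i j => χ (i + a) (j + b)) (fun i j hij => ?_) (fun i j hij => ?_)
      (i - a) (j - b) (k - a) (l - b) (mem_shift_vertices.1 h1) (mem_shift_vertices.1 h2)
    · simpa using this
    · rw [add_right_comm]
      exact hh _ _ (mem_shift_hor.2 (by simpa using hij))
    · rw [add_right_comm j]
      exact hv _ _ (mem_shift_ver.2 (by simpa using hij))
  · have := hr (i - a) (j - b)
    unfold BondSet.IsRegularAt at this ⊢
    simpa only [mem_shift_hor, mem_shift_ver, sub_right_comm] using this
  · have e : (SAP242.shift a b P).rowCount j = P.rowCount (j - b) := by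
      rw [rowCount_eq_card_image, rowCount_eq_card_image]
      refine Finset.card_bij (fun i _ => i - a) (fun i hi => ?_) (fun _ _ _ _ h => by simpa using h)
        fun i hi => ⟨i + a, ?_, by simp⟩
      · rwa [mem_row_image, mem_shift_ver, ← mem_row_image] at hi
      · rw [mem_row_image] at hi
        rw [mem_row_image, mem_shift_ver]
        simpa using hi
    rw [e, h.2]
    have e1 : (j₀ ≤ j - b ∧ j - b ≤ j₀ + 2 * (m : ℤ)) ↔
      (j₀ + b ≤ j ∧ j ≤ j₀ + b + 2 * (m : ℤ)) := by omega
    have e2 : j - b - j₀ = j - (j₀ + b) := by ring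
    simp only [e1, e2]

theorem IsBottom.shift {P : BondSet} {j₀ d₁ d₂ : ℤ} (h : IsBottom P j₀ d₁ d₂) (a b : ℤ) :
    IsBottom (shift a b P) (j₀ + b) (d₁ + a) (d₂ + a) where
  lt := by have := h.lt; omega
  row i := by rw [mem_shift_ver, add_sub_cancel_right, h.row]; omega
  below i j hj := by rw [mem_shift_ver]; exact h.below _ _ (by omega)
  cap i := by rw [mem_shift_hor, add_sub_cancel_right, h.cap]; omega
  hbelow i j hj := by rw [mem_shift_hor]; exact h.hbelow _ _ (by omega)

theorem IsBottom.isAnchored_iff {P : BondSet} {j₀ d₁ d₂ : ℤ} (h : IsBottom P j₀ d₁ d₂) :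
    P.IsAnchored ↔ j₀ = 0 ∧ d₁ = 0 := by
  have hlt := h.lt
  have hv : ∀ i j, (i, j) ∈ P.vertices → j₀ < j ∨ (j = j₀ ∧ d₁ ≤ i) := by
    intro i j hij
    rw [BondSet.mem_vertices] at hij
    rcases lt_trichotomy j₀ j with hj | rfl | hj
    · exact Or.inl hj
    · right
      have := h.below i (j₀ - 1) (by omega)
      rw [h.cap, h.cap, h.row] at hij
      simp only [this, or_false] at hij
      omega
    · have h1 := h.below i j hj
      have h2 := h.below i (j - 1) (by omega)
      have h3 := h.hbelow i j hj
      have h4 := h.hbelow (i - 1) j hj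
      tauto
  have hd : (d₁, j₀) ∈ P.vertices :=
    (BondSet.mem_vertices _ _ _).2 (Or.inr (Or.inl ((h.row _).2 (Or.inl rfl))))
  constructor
  · rintro ⟨h0, hall⟩
    have h1 := hall _ hd
    have h2 := hv _ _ h0
    dsimp only at h1
    omega
  · rintro ⟨rfl, rfl⟩
    exact ⟨hd, fun v hv' => by have := hv v.1 v.2 hv'; omega⟩

theorem IsBottom.bottomWidth {P : BondSet} {d : ℤ} (h : IsBottom P 0 0 d) :
    (P.bottomWidth : ℤ) = d := by
  have := h.lt
  rw [BondSet.bottomWidth, show (P.hor.filter fun b => b.2 = 0) =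
    (Finset.Ico 0 d).image fun i => ((i, 0) : ℤ × ℤ) from ?_, card_image_row, Int.card_Ico]
  · omega
  · ext ⟨i, j⟩
    simp only [Finset.mem_filter, mem_image_row, Finset.mem_Ico]
    have := h.cap i
    grind

/-- The vertical bonds at three heights return the ordered rows of the chunk. The only bonds of `P`
lost in attaching are those of its cap, and the cap is determined by `d₁` and `d₂`. -/
theorem attach_injective {P P' : BondSet} {j₀ : ℤ} {c c' : Chunk} (hP : IsBottom P j₀ c.d₁ c.d₂)
    (hP' : IsBottom P' j₀ c'.d₁ c'.d₂) (hc : c.IsOrdered) (hc' : c'.IsOrdered)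
    (h : attach P j₀ c = attach P' j₀ c') : P = P' ∧ c = c' := by
  have hv : ∀ i j, (i, j) ∈ (attach P j₀ c).ver ↔ (i, j) ∈ (attach P' j₀ c').ver := by simp [h]
  have hh : ∀ i j, (i, j) ∈ (attach P j₀ c).hor ↔ (i, j) ∈ (attach P' j₀ c').hor := by simp [h]
  have hd := fun i => hv i j₀
  have hu := fun i => hv i (j₀ - 1)
  have he := fun i => hv i (j₀ - 2)
  simp only [attach_ver_of_le le_rfl, hP.row, hP'.row] at hd
  simp only [attach_ver_one hP, attach_ver_one hP'] at hu
  simp only [attach_ver_two hP, attach_ver_two hP'] at he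
  obtain ⟨o1, o2, o3, o4, o5⟩ := hc
  obtain ⟨o1', o2', o3', o4', o5'⟩ := hc'
  have hcc : c = c' := by
    have d1 := hd c.d₁; have d2 := hd c.d₂; have d3 := hd c'.d₁; have d4 := hd c'.d₂
    have e1 := he c.e₁; have e2 := he c.e₂; have e3 := he c'.e₁; have e4 := he c'.e₂
    have u1 := hu c.u₁; have u2 := hu c.u₂; have u3 := hu c.u₃; have u4 := hu c.u₄
    have v1 := hu c'.u₁; have v2 := hu c'.u₂; have v3 := hu c'.u₃; have v4 := hu c'.u₄
    clear hd hu he hv hh h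
    have : c.d₁ = c'.d₁ ∧ c.d₂ = c'.d₂ := by clear u1 u2 u3 u4 v1 v2 v3 v4 e1 e2 e3 e4; omega
    have : c.e₁ = c'.e₁ ∧ c.e₂ = c'.e₂ := by clear u1 u2 u3 u4 v1 v2 v3 v4 d1 d2 d3 d4; omega
    have : c.u₁ = c'.u₁ ∧ c.u₂ = c'.u₂ ∧ c.u₃ = c'.u₃ ∧ c.u₄ = c'.u₄ := by
      clear e1 e2 e3 e4 d1 d2 d3 d4
      simp only [true_or, or_true, true_iff, iff_true] at u1 u2 u3 u4 v1 v2 v3 v4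
      omega
    ext <;> omega
  refine ⟨?_, hcc⟩
  subst hcc
  apply BondSet.ext
  · ext ⟨i, j⟩
    rcases lt_trichotomy j₀ j with hj | rfl | hj
    · rw [← attach_hor_of_lt (c := c) hj, hh, attach_hor_of_lt hj]
    · rw [hP.cap, hP'.cap]
    · exact iff_of_false (hP.hbelow i j hj) (hP'.hbelow i j hj)
  · ext ⟨i, j⟩
    rcases le_or_gt j₀ j with hj | hj
    · rw [← attach_ver_of_le (c := c) hj, hv, attach_ver_of_le hj]
    · exact iff_of_false (hP.below i j hj) (hP'.below i j hj)

/-! ### The recursive structure of the set of 2-4-2 polygons -/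

/-- The anchored 2-4-2 polygons with `2 * m + 1` rows. -/
def Poly (m : ℕ) : Type := {P : BondSet // IsPoly P 0 m ∧ ∃ w, IsBottom P 0 0 w}

/-- The width of the bottom row. -/
def Poly.width {m : ℕ} (P : Poly m) : ℕ := P.1.bottomWidth

/-- The horizontal half-perimeter. -/
def Poly.half {m : ℕ} (P : Poly m) : ℕ := P.1.hor.card / 2

theorem Poly.isBottom {m : ℕ} (P : Poly m) : IsBottom P.1 0 0 P.width := by
  obtain ⟨P, h, w, hw⟩ := P
  show IsBottom P 0 0 (P.bottomWidth : ℤ)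
  rw [hw.bottomWidth]
  exact hw

theorem Poly.card_hor {m : ℕ} (P : Poly m) : P.1.hor.card = 2 * P.half := by
  obtain ⟨n, hn⟩ := P.2.1.even_card_hor
  rw [Poly.half, hn, Nat.mul_div_cancel_left _ two_pos]

theorem Poly.width_pos {m : ℕ} (P : Poly m) : 1 ≤ P.width := by
  have := P.isBottom.lt
  omega

theorem mem_polygons_iff {h v : ℕ} {P : BondSet} :
    P ∈ polygons h v ↔ ∃ m, v = 3 * m + 1 ∧ (IsPoly P 0 m ∧ ∃ w, IsBottom P 0 0 w) ∧
      P.hor.card = 2 * h := by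
  constructor
  · rintro ⟨h1, h2, ⟨j₀, m, h3⟩, h4, h5⟩
    have hP : IsPoly P j₀ m := ⟨h1, h3⟩
    obtain ⟨d₁, d₂, hb⟩ := hP.exists_isBottom
    obtain ⟨rfl, rfl⟩ := hb.isAnchored_iff.1 h2
    have := hP.card_ver
    exact ⟨m, by omega, ⟨hP, d₂, hb⟩, h4⟩
  · rintro ⟨m, rfl, ⟨hP, w, hw⟩, h4⟩
    exact ⟨hP.1, hw.isAnchored_iff.2 ⟨rfl, rfl⟩, ⟨0, m, hP.2⟩, h4, hP.card_ver⟩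

theorem polygons_eq_image (h m : ℕ) :
    polygons h (3 * m + 1) = Subtype.val '' {P : Poly m | P.half = h} := by
  ext P
  rw [mem_polygons_iff]
  constructor
  · rintro ⟨m', hm, hP, hh⟩
    obtain rfl : m = m' := by omega
    exact ⟨⟨P, hP⟩, by show P.hor.card / 2 = h; omega, rfl⟩
  · rintro ⟨P, rfl, rfl⟩
    exact ⟨m, rfl, P.2, Poly.card_hor P⟩

theorem polygons_eq_empty {h v : ℕ} (hv : ∀ m, v ≠ 3 * m + 1) : polygons h v = ∅ := by
  ext P
  rw [mem_polygons_iff]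
  simp [hv]

/-- The chunks that can be attached to a polygon whose bottom row has width `w`. -/
def ChunkBelow (w : ℕ) : Type := {c : Chunk // c.IsGood ∧ c.e₁ = 0 ∧ c.d₂ - c.d₁ = w}

theorem isBottom_shift {m : ℕ} (P : Poly m) (c : ChunkBelow P.width) :
    IsBottom (shift c.1.d₁ 2 P.1) 2 c.1.d₁ c.1.d₂ := by
  have := P.isBottom.shift c.1.d₁ 2
  rw [zero_add, zero_add] at this
  convert this using 1
  have := c.2.2.2
  omega

/-- Attaching a chunk to an anchored polygon. -/
noncomputable def attachPoly (m : ℕ) (x : Σ P : Poly m, ChunkBelow P.width) : Poly (m + 1) :=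
  -- Chunks are normalized by `e₁ = 0`, so the old polygon is moved up by 2 and sideways onto `d₁`;
  -- the result is then anchored.
  ⟨attach (shift x.2.1.d₁ 2 x.1.1) 2 x.2.1, by
    have h := attach_isPoly (x.1.2.1.shift x.2.1.d₁ 2) (by
      have := isBottom_shift x.1 x.2; rwa [zero_add]) x.2.2.1
    have h' := attach_isBottom (isBottom_shift x.1 x.2) x.2.2.1.1
    rw [x.2.2.2.1] at h'
    exact ⟨h, _, h'⟩⟩

theorem attachPoly_injective (m : ℕ) : Function.Injective (attachPoly m) := by
  rintro ⟨P, c⟩ ⟨P', c'⟩ h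
  have h1 := attach_injective (isBottom_shift P c) (isBottom_shift P' c') c.2.1.1 c'.2.1.1
    (congrArg Subtype.val h)
  have h2 : P = P' := by
    have := congrArg (shift (-c.1.d₁) (-2)) h1.1
    rw [h1.2, shift_shift, shift_shift, neg_add_cancel, neg_add_cancel, shift_zero, shift_zero]
      at this
    exact Subtype.ext this
  subst h2
  have h3 : c = c' := Subtype.ext h1.2
  rw [h3]

theorem attachPoly_surjective (m : ℕ) : Function.Surjective (attachPoly m) := by
  rintro ⟨Q, hQ, w, hw⟩
  obtain ⟨P, c, hP, hb, hc, rfl⟩ := IsPoly.exists_attach (j₀ := 2) (by simpa using hQ)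
  have he := (attach_isBottom hb hc.1).unique hw
  have hb' := hb.shift (-c.d₁) (-2)
  have hP' := hP.shift (-c.d₁) (-2)
  rw [add_neg_cancel] at hP'
  rw [add_neg_cancel, add_neg_cancel] at hb'
  have hw' := hb'.bottomWidth
  refine ⟨⟨⟨shift (-c.d₁) (-2) P, hP', _, hb'⟩, ⟨c, hc, he.1, ?_⟩⟩, ?_⟩
  · show c.d₂ - c.d₁ = (BondSet.bottomWidth _ : ℤ)
    rw [hw']; ring
  · apply Subtype.ext
    show attach (shift c.d₁ 2 (shift (-c.d₁) (-2) P)) 2 c = _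
    rw [shift_shift, add_neg_cancel, add_neg_cancel, shift_zero]

/-- Every polygon with more than one row arises in a unique way from a smaller one by attaching a
chunk. -/
noncomputable def attachEquiv (m : ℕ) : (Σ P : Poly m, ChunkBelow P.width) ≃ Poly (m + 1) :=
  Equiv.ofBijective _ ⟨attachPoly_injective m, attachPoly_surjective m⟩

theorem width_attachEquiv (m : ℕ) (x : Σ P : Poly m, ChunkBelow P.width) :
    ((attachEquiv m x).width : ℤ) = x.2.1.e₂ - x.2.1.e₁ := by
  have h := attach_isBottom (isBottom_shift x.1 x.2) x.2.2.1.1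
  have := (attachEquiv m x).isBottom.unique h
  have e := x.2.2.2.1
  omega

theorem half_attachEquiv (m : ℕ) (x : Σ P : Poly m, ChunkBelow P.width) :
    (attachEquiv m x).half = x.1.half + x.2.1.cost := by
  have h := (isBottom_shift x.1 x.2).card_attach_hor x.2.2.1.1
  have h1 := x.2.2.1.two_mul_cost
  have h2 := (attachEquiv m x).card_hor
  have h3 := x.1.card_hor
  rw [card_shift_hor] at h
  have h4 : (attachEquiv m x).1.hor.card = (attach (shift x.2.1.d₁ 2 x.1.1) 2 x.2.1).hor.card := rfl
  omega

/-- The anchored polygons with a single row are rectangles. -/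
noncomputable def rectEquiv : ℕ ≃ Poly 0 :=
  Equiv.ofBijective (fun n => ⟨rect 0 0 (n + 1), rect_isPoly (by omega), _,
    rect_isBottom (by omega)⟩) (by
    constructor
    · intro n n' h
      have e : rect 0 0 (n + 1) = rect 0 0 (n' + 1) := congrArg Subtype.val h
      have hb := rect_isBottom (j₀ := 0) (d₁ := 0) (d₂ := n + 1) (by omega)
      rw [e] at hb
      have := hb.unique (rect_isBottom (by omega))
      omega
    · rintro ⟨P, hP, w, hw⟩
      obtain ⟨d₁, d₂, hd, rfl⟩ := hP.eq_rect
      obtain ⟨rfl, rfl⟩ := (rect_isBottom hd).unique hw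
      refine ⟨(d₂ - 1).toNat, Subtype.ext ?_⟩
      show rect 0 0 (((d₂ - 1).toNat : ℤ) + 1) = _
      congr 1
      omega)

theorem width_rectEquiv (n : ℕ) : (rectEquiv n).width = n + 1 := by
  have := (rectEquiv n).isBottom.unique (rect_isBottom (j₀ := 0) (d₁ := 0) (d₂ := n + 1) (by omega))
  omega

theorem half_rectEquiv (n : ℕ) : (rectEquiv n).half = n + 1 := by
  have h := card_rect_hor (j₀ := 0) (d₁ := 0) (d₂ := n + 1) (by omega)
  have h2 := (rectEquiv n).card_hor
  have h4 : (rectEquiv n).1.hor.card = (rect 0 0 (n + 1)).hor.card := rfl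
  omega

/-! ### Sums of families with respect to a filtration by ideals -/

section
variable {A : Type*} [CommRing A] {I : ℕ → Ideal A} {ι κ : Type*}

/-- The family `M` has the sum `F` in the topology given by the ideals `I N`. -/
def HasGF (I : ℕ → Ideal A) (M : ι → A) (F : A) : Prop :=
  ∀ N, ∃ s : Finset ι, (∀ i ∉ s, M i ∈ I N) ∧ F - ∑ i ∈ s, M i ∈ I N

/-- Every finite set that contains all terms outside `I N` gives the same partial sum modulo `I N`.
Hence the finite sets in `HasGF` may be enlarged and compared. -/
theorem HasGF.sub_sum_mem {M : ι → A} {F : A} {N : ℕ} {s t : Finset ι}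
    (hs : ∀ i ∉ s, M i ∈ I N) (hF : F - ∑ i ∈ s, M i ∈ I N) (ht : ∀ i ∉ t, M i ∈ I N) :
    F - ∑ i ∈ t, M i ∈ I N := by
  classical
  have h1 : ∑ i ∈ s ∪ t, M i - ∑ i ∈ s, M i ∈ I N := by
    rw [← Finset.sum_sdiff Finset.subset_union_left, add_sub_cancel_right]
    exact Ideal.sum_mem _ fun i hi => hs i (Finset.mem_sdiff.1 hi).2
  have h2 : ∑ i ∈ s ∪ t, M i - ∑ i ∈ t, M i ∈ I N := by
    rw [← Finset.sum_sdiff Finset.subset_union_right, add_sub_cancel_right]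
    exact Ideal.sum_mem _ fun i hi => ht i (Finset.mem_sdiff.1 hi).2
  convert (I N).add_mem ((I N).sub_mem hF h1) h2 using 1
  ring

theorem HasGF.unique {M : ι → A} {F G : A} (hF : HasGF I M F) (hG : HasGF I M G)
    (hI : ∀ a, (∀ N, a ∈ I N) → a = 0) : F = G := by
  rw [← sub_eq_zero]
  refine hI _ fun N => ?_
  obtain ⟨s, h1, h2⟩ := hF N
  obtain ⟨t, h3, h4⟩ := hG N
  convert (I N).sub_mem h2 (HasGF.sub_sum_mem h3 h4 h1) using 1
  ring

theorem HasGF.mul {M : ι → A} {M' : κ → A} {F G : A} (hF : HasGF I M F) (hG : HasGF I M' G) :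
    HasGF I (fun p : ι × κ => M p.1 * M' p.2) (F * G) := by
  intro N
  obtain ⟨s, h1, h2⟩ := hF N
  obtain ⟨t, h3, h4⟩ := hG N
  refine ⟨s ×ˢ t, fun p hp => ?_, ?_⟩
  · rw [Finset.mem_product, not_and_or] at hp
    rcases hp with hp | hp
    · exact (I N).mul_mem_right _ (h1 _ hp)
    · exact (I N).mul_mem_left _ (h3 _ hp)
  · rw [Finset.sum_product, ← Finset.sum_mul_sum]
    convert (I N).add_mem ((I N).mul_mem_right G h2) ((I N).mul_mem_left (∑ i ∈ s, M i) h4) using 1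
    ring

theorem HasGF.mul_left {M : ι → A} {F : A} (hF : HasGF I M F) (a : A) :
    HasGF I (fun i => a * M i) (a * F) := by
  intro N
  obtain ⟨s, h1, h2⟩ := hF N
  refine ⟨s, fun i hi => (I N).mul_mem_left _ (h1 i hi), ?_⟩
  rw [← Finset.mul_sum, ← mul_sub]
  exact (I N).mul_mem_left _ h2

theorem HasGF.add {M M' : ι → A} {F G : A} (hF : HasGF I M F) (hG : HasGF I M' G) :
    HasGF I (fun i => M i + M' i) (F + G) := by
  classical
  intro N
  obtain ⟨s, h1, h2⟩ := hF N
  obtain ⟨t, h3, h4⟩ := hG N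
  have h5 := HasGF.sub_sum_mem (t := s ∪ t) h1 h2 fun i hi => h1 i (by simp_all)
  have h6 := HasGF.sub_sum_mem (t := s ∪ t) h3 h4 fun i hi => h3 i (by simp_all)
  refine ⟨s ∪ t, fun i hi => (I N).add_mem (h1 i (by simp_all)) (h3 i (by simp_all)), ?_⟩
  convert (I N).add_mem h5 h6 using 1
  rw [Finset.sum_add_distrib]
  ring

theorem HasGF.zero : HasGF I (fun _ : ι => (0 : A)) 0 :=
  fun _ => ⟨∅, fun _ _ => Ideal.zero_mem _, by simp⟩

theorem HasGF.sum {σ : Type*} (s : Finset σ) {M : σ → ι → A} {F : σ → A}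
    (h : ∀ k ∈ s, HasGF I (M k) (F k)) : HasGF I (fun i => ∑ k ∈ s, M k i) (∑ k ∈ s, F k) := by
  classical
  induction s using Finset.induction_on with
  | empty => simpa using HasGF.zero
  | insert a s ha ih =>
    simp only [Finset.sum_insert ha]
    exact (h a (by simp)).add (ih fun k hk => h k (by simp [hk]))

theorem HasGF.sumElim {M : ι → A} {M' : κ → A} {F G : A} (hF : HasGF I M F) (hG : HasGF I M' G) :
    HasGF I (Sum.elim M M') (F + G) := by
  intro N
  obtain ⟨s, h1, h2⟩ := hF N
  obtain ⟨t, h3, h4⟩ := hG N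
  refine ⟨s.disjSum t, ?_, ?_⟩
  · rintro (i | i) hi
    · exact h1 i (by simpa using hi)
    · exact h3 i (by simpa using hi)
  · rw [Finset.sum_disjSum]
    convert (I N).add_mem h2 h4 using 1
    simp only [Sum.elim_inl, Sum.elim_inr]
    ring

theorem HasGF.of_equiv {M : ι → A} {M' : κ → A} {F : A} (hF : HasGF I M F) (e : ι ≃ κ)
    (h : ∀ i, M' (e i) = M i) : HasGF I M' F := by
  intro N
  obtain ⟨s, h1, h2⟩ := hF N
  refine ⟨s.map e.toEmbedding, fun i hi => ?_, ?_⟩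
  · rw [← e.apply_symm_apply i, h]
    exact h1 _ fun h => hi (by rw [Finset.mem_map_equiv]; exact h)
  · rw [Finset.sum_map]
    simpa [h] using h2

theorem HasGF.of_bijective {M : ι → A} {M' : κ → A} {F : A} (hF : HasGF I M F) {f : ι → κ}
    (hf : Function.Bijective f) (h : ∀ i, M' (f i) = M i) : HasGF I M' F :=
  hF.of_equiv (Equiv.ofBijective f hf) h

theorem HasGF.congr {M M' : ι → A} {F : A} (hF : HasGF I M F) (h : ∀ i, M' i = M i) :
    HasGF I M' F := hF.of_equiv (Equiv.refl ι) h

theorem HasGF.subtype {M : ι → A} {F : A} (hF : HasGF I M F) (p : ι → Prop)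
    (h : ∀ i, ¬ p i → M i = 0) : HasGF I (fun i : Subtype p => M i) F := by
  classical
  intro N
  obtain ⟨s, h1, h2⟩ := hF N
  refine ⟨s.subtype p, fun i hi => h1 i (by simpa using hi), ?_⟩
  rw [Finset.sum_subtype_eq_sum_filter, Finset.sum_filter_of_ne]
  · exact h2
  · intro i _ hi
    by_contra hp
    exact hi (h i hp)

theorem HasGF.map {B : Type*} [CommRing B] {J : ℕ → Ideal B} {M : ι → A} {F : A}
    (hF : HasGF I M F) (φ : A →+ B) (h : ∀ N, ∃ N', ∀ a ∈ I N', φ a ∈ J N) :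
    HasGF J (fun i => φ (M i)) (φ F) := by
  intro N
  obtain ⟨N', hN⟩ := h N
  obtain ⟨s, h1, h2⟩ := hF N'
  refine ⟨s, fun i hi => hN _ (h1 i hi), ?_⟩
  rw [← map_sum, ← map_sub]
  exact hN _ h2

/-- Smallness of the terms has to be uniform in the second index outside finitely many `i`;
smallness of the inner sums `G i` would not bound their terms. -/
theorem HasGF.sigma {π : ι → Type*} {M : (Σ i, π i) → A} {G : ι → A} {F : A}
    (hM : ∀ i, HasGF I (fun c => M ⟨i, c⟩) (G i)) (hG : HasGF I G F)
    (h : ∀ N, ∃ s : Finset ι, ∀ i ∉ s, ∀ c, M ⟨i, c⟩ ∈ I N) : HasGF I M F := by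
  classical
  intro N
  obtain ⟨s, h1, h2⟩ := hG N
  obtain ⟨t, h3⟩ := h N
  choose u hu hu' using fun i => hM i N
  have h4 := HasGF.sub_sum_mem (t := s ∪ t) h1 h2 fun i hi => h1 i (by simp_all)
  refine ⟨(s ∪ t).sigma u, ?_, ?_⟩
  · rintro ⟨i, c⟩ hi
    by_cases hit : i ∈ t
    · exact hu i c fun hc => hi (by simp [hit, hc])
    · exact h3 i hit c
  · rw [Finset.sum_sigma]
    convert (I N).add_mem h4 (Ideal.sum_mem (I N) fun i (_ : i ∈ s ∪ t) => hu' i) using 1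
    rw [Finset.sum_sub_distrib]
    ring

/-- The remainder after `N` terms is `G * r ^ N`. The sum enters only as an inverse of `1 - r`, so
no concrete model of the ring is needed. -/
theorem HasGF.geom {r G : A} (hr : ∀ N, r ^ N ∈ I N) (hG : G * (1 - r) = 1) :
    HasGF I (fun n : ℕ => r ^ n) G := by
  intro N
  refine ⟨Finset.range N, fun i hi => ?_, ?_⟩
  · rw [Finset.mem_range, not_lt] at hi
    obtain ⟨k, rfl⟩ := Nat.exists_eq_add_of_le hi
    show r ^ (N + k) ∈ I N
    rw [pow_add]
    exact (I N).mul_mem_right _ (hr N)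
  · have e : G - ∑ i ∈ Finset.range N, r ^ i = G * r ^ N := by
      have h := mul_neg_geom_sum r N
      linear_combination (∑ i ∈ Finset.range N, r ^ i) * hG - G * h
    rw [e]
    exact (I N).mul_mem_left _ (hr N)

theorem HasGF.geom_succ {r G : A} (hr : ∀ N, r ^ N ∈ I N) (hG : G * (1 - r) = 1) :
    HasGF I (fun n : ℕ => r ^ (n + 1)) (r * G) :=
  ((HasGF.geom hr hG).mul_left r).congr fun n => pow_succ' r n

/-! ### The generating function of the chunks of one orientation -/

/-- Pairs of natural numbers according to their order. -/
def pairMap : ℕ ⊕ (ℕ × ℕ) ⊕ (ℕ × ℕ) → ℕ × ℕ :=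
  Sum.elim (fun n => (n, n)) (Sum.elim (fun q => (q.1, q.1 + q.2 + 1))
    fun q => (q.1 + q.2 + 1, q.1))

theorem pairMap_bijective : Function.Bijective pairMap := by
  unfold pairMap
  constructor
  · rintro (n | ⟨n, k⟩ | ⟨n, k⟩) (n' | ⟨n', k'⟩ | ⟨n', k'⟩) h <;>
      simp only [Sum.elim_inl, Sum.elim_inr, Prod.mk.injEq] at h <;> simp <;> omega
  · rintro ⟨a, b⟩
    rcases lt_trichotomy a b with h | h | h
    · exact ⟨Sum.inr (Sum.inl (a, b - a - 1)), by simp; omega⟩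
    · exact ⟨Sum.inl a, by simp [h]⟩
    · exact ⟨Sum.inr (Sum.inr (b, a - b - 1)), by simp; omega⟩

/-- Two ends beyond a common point: the first is weighted by its distance, the second only by its
excess over the first, expressed by truncated subtraction. Equal, longer and shorter second gaps
give the three terms. This is the source of the factors `B` and `C`. -/
theorem hasGF_pair {a b Ga Gb : A} (ha : ∀ N, a ^ N ∈ I N) (hb : ∀ N, b ^ N ∈ I N)
    (hGa : Ga * (1 - a) = 1) (hGb : Gb * (1 - b) = 1) :
    HasGF I (fun p : ℕ × ℕ => a ^ (p.1 + 1) * b ^ (p.2 - p.1))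
      (a * Ga * (1 + a * Ga + b * Gb)) := by
  have h1 := HasGF.geom_succ ha hGa
  have h2 := HasGF.geom_succ hb hGb
  have h := h1.sumElim ((h1.mul h2).sumElim (h1.mul h1))
  convert h.of_bijective pairMap_bijective (M' := fun p : ℕ × ℕ => a ^ (p.1 + 1) * b ^ (p.2 - p.1)) ?_ using 1
  · ring
  · rintro (n | ⟨n, k⟩ | ⟨n, k⟩) <;>
      simp only [pairMap, Sum.elim_inl, Sum.elim_inr]
    · simp
    · rw [show n + k + 1 - n = k + 1 by omega]
    · rw [show n - (n + k + 1) = 0 by omega, pow_zero, mul_one, ← pow_add]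
      congr 1; omega

/-- Triples of natural numbers according to the position of the minimum. -/
def tripleMap (x : ℕ × ((ℕ × ℕ) ⊕ (ℕ ⊕ (ℕ × ℕ)) ⊕ (ℕ × ℕ))) : ℕ × ℕ × ℕ :=
  Sum.elim (fun q => (x.1 + q.1, x.1, x.1 + q.2))
    (Sum.elim (Sum.elim (fun q => (x.1, x.1 + q + 1, x.1))
      fun q => (x.1, x.1 + q.2 + 1, x.1 + q.1 + 1))
      fun q => (x.1 + q.1 + 1, x.1 + q.2 + 1, x.1)) x.2

theorem tripleMap_bijective : Function.Bijective tripleMap := by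
  unfold tripleMap
  constructor
  · rintro ⟨n, ⟨p, r⟩ | (q | ⟨r, q⟩) | ⟨p, q⟩⟩ ⟨n', ⟨p', r'⟩ | (q' | ⟨r', q'⟩) | ⟨p', q'⟩⟩ h <;>
      simp only [Sum.elim_inl, Sum.elim_inr, Prod.mk.injEq] at h <;> simp <;> omega
  · rintro ⟨p, q, r⟩
    by_cases h1 : q ≤ p ∧ q ≤ r
    · exact ⟨(q, Sum.inl (p - q, r - q)), by simp; omega⟩
    by_cases h2 : p ≤ r
    · by_cases h3 : r = p
      · exact ⟨(p, Sum.inr (Sum.inl (Sum.inl (q - p - 1)))), by simp; omega⟩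
      · exact ⟨(p, Sum.inr (Sum.inl (Sum.inr (r - p - 1, q - p - 1)))), by simp; omega⟩
    · exact ⟨(r, Sum.inr (Sum.inr (p - r - 1, q - r - 1))), by simp; omega⟩

/-- Three ends beyond a common point. The distance to the nearest is shared and weighted by `c`; the
excesses of the outer ends have the weights `a` and `b`, and the middle row costs only where it
sticks out beyond both. With the inverses expanded as `1 + ⟨·⟩`, the bracket is the factor `A`. -/
theorem hasGF_triple {a b x c Ga Gb Gx Gc : A} (ha : ∀ N, a ^ N ∈ I N) (hb : ∀ N, b ^ N ∈ I N)
    (hx : ∀ N, x ^ N ∈ I N) (hc : ∀ N, c ^ N ∈ I N)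
    (hGa : Ga * (1 - a) = 1) (hGb : Gb * (1 - b) = 1) (hGx : Gx * (1 - x) = 1)
    (hGc : Gc * (1 - c) = 1) :
    HasGF I (fun p : ℕ × ℕ × ℕ => c ^ (min p.1 (min p.2.1 p.2.2) + 1) *
      a ^ (p.1 - min p.1 (min p.2.1 p.2.2)) * b ^ (p.2.2 - min p.1 (min p.2.1 p.2.2)) *
      x ^ (p.2.1 - max p.1 p.2.2))
      (c * Gc * (Ga * Gb + (x * Gx + b * Gb * (1 + b * Gb + x * Gx)) +
        a * Ga * (1 + a * Ga + x * Gx))) := by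
  have h := (HasGF.geom_succ hc hGc).mul (((HasGF.geom ha hGa).mul (HasGF.geom hb hGb)).sumElim
    (((HasGF.geom_succ hx hGx).sumElim (hasGF_pair hb hx hGb hGx)).sumElim
      (hasGF_pair ha hx hGa hGx)))
  convert h.of_bijective tripleMap_bijective (M' := fun p : ℕ × ℕ × ℕ => c ^ (min p.1 (min p.2.1 p.2.2) + 1) *
      a ^ (p.1 - min p.1 (min p.2.1 p.2.2)) * b ^ (p.2.2 - min p.1 (min p.2.1 p.2.2)) *
      x ^ (p.2.1 - max p.1 p.2.2)) ?_ using 1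
  · ring
  · rintro ⟨n, ⟨p, r⟩ | (q | ⟨r, q⟩) | ⟨p, q⟩⟩ <;>
      simp only [tripleMap, Sum.elim_inl, Sum.elim_inr]
    · rw [show min (n + p) (min n (n + r)) = n by omega, show n + p - n = p by omega,
        show n + r - n = r by omega, show n - max (n + p) (n + r) = 0 by omega]
      ring
    · rw [show min n (min (n + q + 1) n) = n by omega, show n - n = 0 by omega,
        show n + q + 1 - max n n = q + 1 by omega]
      ring
    · rw [show min n (min (n + q + 1) (n + r + 1)) = n by omega, show n - n = 0 by omega,
        show n + r + 1 - n = r + 1 by omega, show n + q + 1 - max n (n + r + 1) = q - r by omega]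
      ring
    · rw [show min (n + p + 1) (min (n + q + 1) n) = n by omega, show n - n = 0 by omega,
        show n + p + 1 - n = p + 1 by omega, show n + q + 1 - max (n + p + 1) n = q - p by omega]
      ring

/-- The gaps of a chunk whose outer row is linked to the outermost bonds of the middle row. -/
abbrev Gaps : Type := (ℕ × ℕ) × ((ℕ × ℕ) × (ℕ × ℕ × ℕ) ⊕ (ℕ × ℕ × ℕ) × (ℕ × ℕ))

/-- The weight of a chunk with the given gaps. -/
def gapWeight (a b x c : A) (j : Gaps) : A :=
  a ^ (j.1.1 + 1) * x ^ (j.1.2 - j.1.1) * Sum.elim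
    (fun k : (ℕ × ℕ) × (ℕ × ℕ × ℕ) => a ^ (k.1.1 + 1) * (a * b) ^ (k.1.2 - k.1.1) *
      (c ^ (min k.2.1 (min k.2.2.1 k.2.2.2) + 1) * a ^ (k.2.1 - min k.2.1 (min k.2.2.1 k.2.2.2)) *
        b ^ (k.2.2.2 - min k.2.1 (min k.2.2.1 k.2.2.2)) * x ^ (k.2.2.1 - max k.2.1 k.2.2.2)))
    (fun k : (ℕ × ℕ × ℕ) × (ℕ × ℕ) => a ^ (k.1.1 + 1) * (a ^ (k.1.2.1 + 1) * x ^ k.1.2.2) *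
      (b ^ (k.2.1 + 1) * x ^ (k.2.2 - k.2.1))) j.2

/-- The sum of the weights of all gaps, in terms of inverses of `1 - a`, `1 - b`, `1 - x`, `1 - c` and
`1 - a * b`. -/
def gapSum (a b x c Ga Gb Gx Gc Gab : A) : A :=
  a * Ga * (1 + a * Ga + x * Gx) *
      (a * Ga * (1 + a * Ga + a * b * Gab) *
        (c * Gc * (Ga * Gb + (x * Gx + b * Gb * (1 + b * Gb + x * Gx)) +
        a * Ga * (1 + a * Ga + x * Gx))) +
      a * Ga * (a * Ga * Gx) * (b * Gb * (1 + b * Gb + x * Gx)))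

theorem hasGF_gapWeight {a b x c Ga Gb Gx Gc Gab : A} (ha : ∀ N, a ^ N ∈ I N)
    (hb : ∀ N, b ^ N ∈ I N) (hx : ∀ N, x ^ N ∈ I N) (hc : ∀ N, c ^ N ∈ I N)
    (hGa : Ga * (1 - a) = 1) (hGb : Gb * (1 - b) = 1) (hGx : Gx * (1 - x) = 1)
    (hGc : Gc * (1 - c) = 1) (hGab : Gab * (1 - a * b) = 1) :
    HasGF I (gapWeight a b x c) (gapSum a b x c Ga Gb Gx Gc Gab) := by
  have hab : ∀ N, (a * b) ^ N ∈ I N := fun N => by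
    rw [mul_pow]; exact (I N).mul_mem_right _ (ha N)
  exact (hasGF_pair ha hx hGa hGx).mul
    (((hasGF_pair ha hab hGa hGab).mul (hasGF_triple ha hb hx hc hGa hGb hGx hGc)).sumElim
      (((HasGF.geom_succ ha hGa).mul ((HasGF.geom_succ ha hGa).mul (HasGF.geom hx hGx))).mul
        (hasGF_pair hb hx hGb hGx)))

end

/-! ### Parametrization of the chunks -/

namespace Chunk

def move (a : ℤ) (c : Chunk) : Chunk :=
  ⟨c.d₁ + a, c.d₂ + a, c.u₁ + a, c.u₂ + a, c.u₃ + a, c.u₄ + a, c.e₁ + a, c.e₂ + a⟩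

/-- Exchange of the outer rows. -/
def swap (c : Chunk) : Chunk := ⟨c.e₁, c.e₂, c.u₁, c.u₂, c.u₃, c.u₄, c.d₁, c.d₂⟩

/-- Reflection in a vertical line. -/
def mirror (c : Chunk) : Chunk :=
  ⟨-c.d₂, -c.d₁, -c.u₄, -c.u₃, -c.u₂, -c.u₁, -c.e₂, -c.e₁⟩

def normalize (c : Chunk) : Chunk := c.move (-c.e₁)

theorem normalize_e₁ (c : Chunk) : c.normalize.e₁ = 0 := add_neg_cancel _

/-- Equal normal forms mean equality up to translation, and a coordinate `φ` that moves along with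
the chunk fixes the translation. -/
theorem eq_of_normalize_eq {c c' : Chunk} (h : c.normalize = c'.normalize) (φ : Chunk → ℤ)
    (hφ : ∀ a c, φ (move a c) = φ c + a) (h0 : φ c = φ c') : c = c' := by
  have h1 := congrArg φ h
  rw [normalize, normalize, hφ, hφ, h0] at h1
  have h2 : c.e₁ = c'.e₁ := by omega
  rw [normalize, normalize, h2] at h
  have h3 := congrArg (move c'.e₁) h
  exact Chunk.ext_iff.2 (by simpa [move] using h3)

/-- The chunks in which both rows are linked to the middle row, the first one in the manner `M`, the
second one in the manner `L`. -/
structure IsML (c : Chunk) : Prop where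
  ord : c.IsOrdered
  up : c.Mu
  lo : c.Ll

end Chunk

open Chunk

/-- The origin is `u₂`; `d₁` and `u₁` lie to its left. In the first kind `d₂` exceeds `max e₁ u₃`,
and `d₂`, `u₄`, `e₂` are measured from that maximum. In the second kind the outer rows do not
overlap: `u₃ < d₂ ≤ e₁`, with `e₂` and `u₄` measured from `e₁`. Gaps that must be positive are
stored minus one. -/
def gapChunk (j : Gaps) : Chunk :=
  Sum.elim
    (fun k : (ℕ × ℕ) × (ℕ × ℕ × ℕ) => ⟨-(j.1.1 + 1), max k.1.1 k.1.2 + k.2.1 + 2, -(j.1.2 + 1), 0,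
      k.1.2 + 1, max k.1.1 k.1.2 + k.2.2.1 + 2, k.1.1 + 1, max k.1.1 k.1.2 + k.2.2.2 + 2⟩)
    (fun k : (ℕ × ℕ × ℕ) × (ℕ × ℕ) => ⟨-(j.1.1 + 1), k.1.1 + k.1.2.1 + 2, -(j.1.2 + 1), 0,
      k.1.1 + 1, k.1.1 + k.1.2.1 + k.1.2.2 + k.2.2 + 3, k.1.1 + k.1.2.1 + k.1.2.2 + 2,
      k.1.1 + k.1.2.1 + k.1.2.2 + k.2.1 + 3⟩) j.2

theorem gapChunk_u₂ (j : Gaps) : (gapChunk j).u₂ = 0 := by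
  rcases j with ⟨j, k | k⟩ <;> rfl

theorem gapChunk_isML (j : Gaps) : (gapChunk j).IsML := by
  rcases j with ⟨⟨a, b⟩, ⟨⟨c, d⟩, p, q, r⟩ | ⟨⟨d, p, r⟩, q₂, q₁⟩⟩
  · refine ⟨⟨?_, ?_, ?_, ?_, ?_⟩, ⟨?_, ?_⟩, ⟨?_, ?_, ?_⟩⟩ <;>
      simp only [gapChunk, Sum.elim_inl] <;> omega
  · refine ⟨⟨?_, ?_, ?_, ?_, ?_⟩, ⟨?_, ?_⟩, ⟨?_, ?_, ?_⟩⟩ <;>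
      simp only [gapChunk, Sum.elim_inr] <;> omega

theorem gapChunk_injective : Function.Injective gapChunk := by
  rintro ⟨⟨a, b⟩, ⟨⟨c, d⟩, p, q, r⟩ | ⟨⟨d, p, r⟩, q₂, q₁⟩⟩
    ⟨⟨a', b'⟩, ⟨⟨c', d'⟩, p', q', r'⟩ | ⟨⟨d', p', r'⟩, q₂', q₁'⟩⟩ h <;>
  simp only [gapChunk, Sum.elim_inl, Sum.elim_inr, Chunk.mk.injEq] at h <;>
  simp only [Prod.mk.injEq, Sum.inl.injEq, Sum.inr.injEq, reduceCtorEq] <;> omega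

theorem exists_gapChunk {c : Chunk} (h : c.IsML) (h0 : c.u₂ = 0) : ∃ j, gapChunk j = c := by
  obtain ⟨d₁, d₂, u₁, u₂, u₃, u₄, e₁, e₂⟩ := c
  obtain ⟨⟨o1, o2, o3, o4, o5⟩, ⟨m1, m2⟩, ⟨l1, l2, l3⟩⟩ := h
  dsimp only at o1 o2 o3 o4 o5 m1 m2 l1 l2 l3 h0
  subst h0
  obtain ⟨b, h1, h2, h3⟩ : ∃ b, e₁ ≤ b ∧ u₃ ≤ b ∧ (b = e₁ ∨ b = u₃) :=
    ⟨max e₁ u₃, le_max_left _ _, le_max_right _ _, max_choice _ _⟩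
  -- As `u₃ < d₂`, the negation means `d₂ ≤ e₁`, which is the second kind of gaps.
  by_cases hc : b < d₂
  · refine ⟨(((-d₁ - 1).toNat, (-u₁ - 1).toNat), Sum.inl (((e₁ - 1).toNat, (u₃ - 1).toNat),
      ((d₂ - b - 1).toNat, (u₄ - b - 1).toNat, (e₂ - b - 1).toNat))), ?_⟩
    simp only [gapChunk, Sum.elim_inl, Chunk.mk.injEq, true_and]
    omega
  · refine ⟨(((-d₁ - 1).toNat, (-u₁ - 1).toNat), Sum.inr (((u₃ - 1).toNat, (d₂ - u₃ - 1).toNat,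
      (e₁ - d₂).toNat), ((e₂ - e₁ - 1).toNat, (u₄ - e₁ - 1).toNat))), ?_⟩
    simp only [gapChunk, Sum.elim_inr, Chunk.mk.injEq, true_and]
    omega

/-- All chunks, up to translation. -/
abbrev AnyChunk : Type := {c : Chunk // c.IsGood ∧ c.e₁ = 0}

/-- Every chunk is a translate of a unique one obtained from a sequence of gaps, up to the symmetries
of the strip. -/
def anyChunkMap : (Gaps ⊕ Gaps) ⊕ (Gaps ⊕ Gaps) → Chunk :=
  Sum.elim (Sum.elim (fun j => (gapChunk j).normalize) fun j => (gapChunk j).swap.normalize)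
    (Sum.elim (fun j => (gapChunk j).mirror.normalize) fun j => (gapChunk j).swap.mirror.normalize)

theorem Chunk.IsML.normalize {c : Chunk} (h : c.IsML) :
    c.normalize.IsOrdered ∧ c.normalize.Mu ∧ c.normalize.Ll := by
  obtain ⟨⟨o1, o2, o3, o4, o5⟩, ⟨m1, m2⟩, ⟨l1, l2, l3⟩⟩ := h
  refine ⟨⟨?_, ?_, ?_, ?_, ?_⟩, ⟨?_, ?_⟩, ⟨?_, ?_, ?_⟩⟩ <;>
    simp only [Chunk.normalize, move] <;> omega

theorem Chunk.IsML.normalize_swap {c : Chunk} (h : c.IsML) :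
    c.swap.normalize.IsOrdered ∧ c.swap.normalize.Lu ∧ c.swap.normalize.Ml := by
  obtain ⟨⟨o1, o2, o3, o4, o5⟩, ⟨m1, m2⟩, ⟨l1, l2, l3⟩⟩ := h
  refine ⟨⟨?_, ?_, ?_, ?_, ?_⟩, ⟨?_, ?_, ?_⟩, ⟨?_, ?_⟩⟩ <;>
    simp only [Chunk.normalize, move, swap] <;> omega

theorem Chunk.IsML.normalize_mirror {c : Chunk} (h : c.IsML) :
    c.mirror.normalize.IsOrdered ∧ c.mirror.normalize.Mu ∧ c.mirror.normalize.Rl := by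
  obtain ⟨⟨o1, o2, o3, o4, o5⟩, ⟨m1, m2⟩, ⟨l1, l2, l3⟩⟩ := h
  refine ⟨⟨?_, ?_, ?_, ?_, ?_⟩, ⟨?_, ?_⟩, ⟨?_, ?_, ?_⟩⟩ <;>
    simp only [Chunk.normalize, move, mirror] <;> omega

theorem Chunk.IsML.normalize_swap_mirror {c : Chunk} (h : c.IsML) :
    c.swap.mirror.normalize.IsOrdered ∧ c.swap.mirror.normalize.Ru ∧
      c.swap.mirror.normalize.Ml := by
  obtain ⟨⟨o1, o2, o3, o4, o5⟩, ⟨m1, m2⟩, ⟨l1, l2, l3⟩⟩ := h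
  refine ⟨⟨?_, ?_, ?_, ?_, ?_⟩, ⟨?_, ?_, ?_⟩, ⟨?_, ?_⟩⟩ <;>
    simp only [Chunk.normalize, move, mirror, swap] <;> omega

theorem anyChunkMap_good (x : (Gaps ⊕ Gaps) ⊕ (Gaps ⊕ Gaps)) :
    (anyChunkMap x).IsGood ∧ (anyChunkMap x).e₁ = 0 := by
  rcases x with (j | j) | (j | j)
  · have := (gapChunk_isML j).normalize
    exact ⟨⟨this.1, Or.inl this.2⟩, normalize_e₁ _⟩
  · have := (gapChunk_isML j).normalize_swap
    exact ⟨⟨this.1, Or.inr (Or.inl this.2)⟩, normalize_e₁ _⟩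
  · have := (gapChunk_isML j).normalize_mirror
    exact ⟨⟨this.1, Or.inr (Or.inr (Or.inl this.2))⟩, normalize_e₁ _⟩
  · have := (gapChunk_isML j).normalize_swap_mirror
    exact ⟨⟨this.1, Or.inr (Or.inr (Or.inr this.2))⟩, normalize_e₁ _⟩

theorem Chunk.not_Lu_of_Mu {c : Chunk} (h : c.Mu) : ¬ c.Lu ∧ ¬ c.Ru := by
  unfold Chunk.Mu Chunk.Lu Chunk.Ru LinkM LinkL LinkR at *; omega

theorem Chunk.not_Ll_of_Rl {c : Chunk} (ho : c.IsOrdered) (h : c.Rl) : ¬ c.Ll := by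
  have := ho.h₂
  unfold Chunk.Rl Chunk.Ll LinkL LinkR at *; omega

theorem Chunk.not_Lu_of_Ru {c : Chunk} (ho : c.IsOrdered) (h : c.Ru) : ¬ c.Lu := by
  have := ho.h₂
  unfold Chunk.Ru Chunk.Lu LinkL LinkR at *; omega

/-- The four families have different link types. Within a family the translation is fixed by `u₂ =
0`, which for the reflected families concerns the coordinate `u₃`. -/
theorem anyChunkMap_injective : Function.Injective anyChunkMap := by
  rintro ((j | j) | (j | j)) ((k | k) | (k | k)) h <;>
    simp only [anyChunkMap, Sum.elim_inl, Sum.elim_inr] at h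
  · rw [gapChunk_injective (eq_of_normalize_eq h Chunk.u₂ (fun _ _ => rfl)
      (by rw [gapChunk_u₂, gapChunk_u₂]))]
  · exact absurd (h ▸ (gapChunk_isML k).normalize_swap.2.1)
      (Chunk.not_Lu_of_Mu (gapChunk_isML j).normalize.2.1).1
  · exact absurd (gapChunk_isML j).normalize.2.2 (h ▸ (Chunk.not_Ll_of_Rl
      (gapChunk_isML k).normalize_mirror.1 (gapChunk_isML k).normalize_mirror.2.2))
  · exact absurd (h ▸ (gapChunk_isML k).normalize_swap_mirror.2.1)
      (Chunk.not_Lu_of_Mu (gapChunk_isML j).normalize.2.1).2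
  · exact absurd (h ▸ (gapChunk_isML j).normalize_swap.2.1)
      (Chunk.not_Lu_of_Mu (gapChunk_isML k).normalize.2.1).1
  · have := eq_of_normalize_eq h Chunk.u₂ (fun _ _ => rfl)
      (by show (gapChunk j).u₂ = (gapChunk k).u₂; rw [gapChunk_u₂, gapChunk_u₂])
    rw [gapChunk_injective (show gapChunk j = gapChunk k from congrArg swap this)]
  · exact absurd (h ▸ (gapChunk_isML j).normalize_swap.2.1)
      (Chunk.not_Lu_of_Mu (gapChunk_isML k).normalize_mirror.2.1).1
  · exact absurd (gapChunk_isML j).normalize_swap.2.1 (h ▸ (Chunk.not_Lu_of_Ru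
      (gapChunk_isML k).normalize_swap_mirror.1 (gapChunk_isML k).normalize_swap_mirror.2.1))
  · exact absurd (gapChunk_isML k).normalize.2.2 (h ▸ (Chunk.not_Ll_of_Rl
      (gapChunk_isML j).normalize_mirror.1 (gapChunk_isML j).normalize_mirror.2.2))
  · exact absurd (h ▸ (gapChunk_isML k).normalize_swap.2.1)
      (Chunk.not_Lu_of_Mu (gapChunk_isML j).normalize_mirror.2.1).1
  · have := eq_of_normalize_eq h Chunk.u₃ (fun _ _ => rfl)
      (by show -(gapChunk j).u₂ = -(gapChunk k).u₂; rw [gapChunk_u₂, gapChunk_u₂])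
    have := congrArg mirror this
    simp only [mirror, neg_neg] at this
    rw [gapChunk_injective this]
  · exact absurd (h ▸ (gapChunk_isML k).normalize_swap_mirror.2.1)
      (Chunk.not_Lu_of_Mu (gapChunk_isML j).normalize_mirror.2.1).2
  · exact absurd (h ▸ (gapChunk_isML j).normalize_swap_mirror.2.1)
      (Chunk.not_Lu_of_Mu (gapChunk_isML k).normalize.2.1).2
  · exact absurd (gapChunk_isML k).normalize_swap.2.1 (h ▸ (Chunk.not_Lu_of_Ru
      (gapChunk_isML j).normalize_swap_mirror.1 (gapChunk_isML j).normalize_swap_mirror.2.1))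
  · exact absurd (h ▸ (gapChunk_isML j).normalize_swap_mirror.2.1)
      (Chunk.not_Lu_of_Mu (gapChunk_isML k).normalize_mirror.2.1).2
  · have := eq_of_normalize_eq h Chunk.u₃ (fun _ _ => rfl)
      (by show -(gapChunk j).u₂ = -(gapChunk k).u₂; rw [gapChunk_u₂, gapChunk_u₂])
    have := congrArg swap (congrArg mirror this)
    simp only [mirror, swap, neg_neg] at this
    rw [gapChunk_injective this]

theorem exists_anyChunkMap {c : Chunk} (h : c.IsGood) (h0 : c.e₁ = 0) :
    ∃ x, anyChunkMap x = c := by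
  obtain ⟨d₁, d₂, u₁, u₂, u₃, u₄, e₁, e₂⟩ := c
  obtain ⟨⟨o1, o2, o3, o4, o5⟩, h⟩ := h
  dsimp only at o1 o2 o3 o4 o5 h0
  subst h0
  rcases h with h | h | h | h
  · obtain ⟨⟨m1, m2⟩, ⟨l1, l2, l3⟩⟩ := h
    dsimp only at m1 m2 l1 l2 l3
    obtain ⟨j, hj⟩ := exists_gapChunk (c := move (-u₂) ⟨d₁, d₂, u₁, u₂, u₃, u₄, 0, e₂⟩)
      (by constructor <;> constructor <;> simp only [move] <;> omega) (by simp [move])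
    refine ⟨Sum.inl (Sum.inl j), ?_⟩
    simp only [anyChunkMap, Sum.elim_inl, hj, Chunk.normalize, move, Chunk.mk.injEq]
    omega
  · obtain ⟨⟨l1, l2, l3⟩, ⟨m1, m2⟩⟩ := h
    dsimp only at m1 m2 l1 l2 l3
    obtain ⟨j, hj⟩ := exists_gapChunk (c := swap (move (-u₂) ⟨d₁, d₂, u₁, u₂, u₃, u₄, 0, e₂⟩))
      (by constructor <;> constructor <;> simp only [move, swap] <;> omega)
      (by simp [move, swap])
    refine ⟨Sum.inl (Sum.inr j), ?_⟩
    simp only [anyChunkMap, Sum.elim_inl, Sum.elim_inr, hj, Chunk.normalize, move, swap, Chunk.mk.injEq]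
    omega
  · obtain ⟨⟨m1, m2⟩, ⟨l1, l2, l3⟩⟩ := h
    dsimp only at m1 m2 l1 l2 l3
    obtain ⟨j, hj⟩ := exists_gapChunk (c := mirror (move (-u₃) ⟨d₁, d₂, u₁, u₂, u₃, u₄, 0, e₂⟩))
      (by constructor <;> constructor <;> simp only [move, mirror] <;> omega)
      (by simp [move, mirror])
    refine ⟨Sum.inr (Sum.inl j), ?_⟩
    simp only [anyChunkMap, Sum.elim_inl, Sum.elim_inr, hj, Chunk.normalize, move, mirror,
      Chunk.mk.injEq]
    omega
  · obtain ⟨⟨l1, l2, l3⟩, ⟨m1, m2⟩⟩ := h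
    dsimp only at m1 m2 l1 l2 l3
    obtain ⟨j, hj⟩ := exists_gapChunk
      (c := swap (mirror (move (-u₃) ⟨d₁, d₂, u₁, u₂, u₃, u₄, 0, e₂⟩)))
      (by constructor <;> constructor <;> simp only [move, mirror, swap] <;> omega)
      (by simp [move, mirror, swap])
    refine ⟨Sum.inr (Sum.inr j), ?_⟩
    simp only [anyChunkMap, Sum.elim_inr, hj, Chunk.normalize, move, mirror, swap,
      Chunk.mk.injEq]
    omega

/-- The weight of a chunk. -/
noncomputable def chunkWeight {A : Type*} [CommRing A] (t s x : A) (c : Chunk) : A :=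
  t ^ (c.d₂ - c.d₁).toNat * s ^ (c.e₂ - c.e₁).toNat * x ^ c.cost

/-- Twice the cost of a chunk in which both rows are linked to the middle row, up to symmetry. -/
def Chunk.twiceCost (c : Chunk) : ℤ :=
  |c.d₁ - c.u₁| + |c.d₂ - c.u₄| + (c.u₃ - c.u₁) + |c.e₁ - c.u₃| + |c.e₂ - c.u₄|

theorem Chunk.IsML.cost_normalize {c : Chunk} (h : c.IsML) :
    (2 * c.normalize.cost : ℤ) = c.twiceCost + (c.e₂ - c.e₁) - (c.d₂ - c.d₁) := by
  obtain ⟨o, hn⟩ := h.normalize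
  rw [Chunk.IsGood.two_mul_cost ⟨o, Or.inl hn⟩, upperLevel, lowerLevel,
    LinkM.card hn.1 o.hd o.h₁ o.h₂ o.h₃, LinkL.card hn.2 o.he o.h₁ o.h₂ o.h₃]
  simp only [max_sub_min_eq_abs', twiceCost, Chunk.normalize, move, add_sub_add_right_eq_sub]
  ring

/-- The runs are unchanged by the exchange of the outer rows, but the removed and the added cap
trade places, so the two widths enter with opposite signs. -/
theorem Chunk.IsML.cost_normalize_swap {c : Chunk} (h : c.IsML) :
    (2 * c.swap.normalize.cost : ℤ) = c.twiceCost + (c.d₂ - c.d₁) - (c.e₂ - c.e₁) := by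
  obtain ⟨o, hn⟩ := h.normalize_swap
  rw [Chunk.IsGood.two_mul_cost ⟨o, Or.inr (Or.inl hn)⟩, upperLevel, lowerLevel,
    LinkL.card hn.1 o.hd o.h₁ o.h₂ o.h₃, LinkM.card hn.2 o.he o.h₁ o.h₂ o.h₃]
  simp only [max_sub_min_eq_abs', twiceCost, Chunk.normalize, move, swap, add_sub_add_right_eq_sub]
  ring

theorem Chunk.IsML.cost_normalize_mirror {c : Chunk} (h : c.IsML) :
    (2 * c.mirror.normalize.cost : ℤ) = c.twiceCost + (c.e₂ - c.e₁) - (c.d₂ - c.d₁) := by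
  obtain ⟨o, hn⟩ := h.normalize_mirror
  rw [Chunk.IsGood.two_mul_cost ⟨o, Or.inr (Or.inr (Or.inl hn))⟩, upperLevel, lowerLevel,
    LinkM.card hn.1 o.hd o.h₁ o.h₂ o.h₃, LinkR.card hn.2 o.he o.h₁ o.h₂ o.h₃]
  simp only [max_sub_min_eq_abs', twiceCost, Chunk.normalize, move, mirror,
    add_sub_add_right_eq_sub, neg_sub_neg, abs_sub_comm c.d₁, abs_sub_comm c.d₂, abs_sub_comm c.e₁,
    abs_sub_comm c.e₂]
  ring

theorem Chunk.IsML.cost_normalize_swap_mirror {c : Chunk} (h : c.IsML) :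
    (2 * c.swap.mirror.normalize.cost : ℤ) =
      c.twiceCost + (c.d₂ - c.d₁) - (c.e₂ - c.e₁) := by
  obtain ⟨o, hn⟩ := h.normalize_swap_mirror
  rw [Chunk.IsGood.two_mul_cost ⟨o, Or.inr (Or.inr (Or.inr hn))⟩, upperLevel, lowerLevel,
    LinkR.card hn.1 o.hd o.h₁ o.h₂ o.h₃, LinkM.card hn.2 o.he o.h₁ o.h₂ o.h₃]
  simp only [max_sub_min_eq_abs', twiceCost, Chunk.normalize, move, mirror, swap,
    add_sub_add_right_eq_sub, neg_sub_neg, abs_sub_comm c.d₁, abs_sub_comm c.d₂, abs_sub_comm c.e₁,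
    abs_sub_comm c.e₂]
  ring

/-! ### Weights of chunks in terms of gaps -/

section
variable {A : Type*} [CommRing A] (t s x : A) (j : Gaps)

/-- The exponent `C` is left abstract because the chunk and its mirror image have the same cost. A
gap under the upper row alone costs nothing, since it replaces part of the old cap, and has weight
`t`; one under the lower row alone has weight `s * x`. -/
theorem weight_gapChunk {C : ℕ} (hC : (2 * C : ℤ) = (gapChunk j).twiceCost +
      ((gapChunk j).e₂ - (gapChunk j).e₁) - ((gapChunk j).d₂ - (gapChunk j).d₁)) :
    t ^ ((gapChunk j).d₂ - (gapChunk j).d₁).toNat * s ^ ((gapChunk j).e₂ - (gapChunk j).e₁).toNat *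
      x ^ C = gapWeight t (s * x) x (s * t) j := by
  rcases j with ⟨⟨a, b⟩, ⟨⟨c, d⟩, p, q, r⟩ | ⟨⟨d, p, r⟩, q₂, q₁⟩⟩
  · simp only [gapChunk, twiceCost, abs_eq_max_neg, gapWeight, Sum.elim_inl] at hC ⊢
    rw [show C = (b - a) + (d - c) + (r - min p (min q r)) + (q - max p r) by omega,
      show ((max c d : ℕ) + p + 2 - -(a + 1) : ℤ).toNat
        = (a + 1) + (c + 1) + (d - c) + (min p (min q r) + 1) + (p - min p (min q r)) by omega,
      show ((max c d : ℕ) + r + 2 - (c + 1) : ℤ).toNat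
        = (d - c) + (min p (min q r) + 1) + (r - min p (min q r)) by omega]
    ring
  · simp only [gapChunk, twiceCost, abs_eq_max_neg, gapWeight, Sum.elim_inr] at hC ⊢
    rw [show C = (b - a) + r + (q₂ + 1) + (q₁ - q₂) by omega,
      show ((d : ℤ) + p + 2 - -(a + 1)).toNat = (a + 1) + (d + 1) + (p + 1) by omega,
      show ((d : ℤ) + p + r + q₂ + 3 - (d + p + r + 2)).toNat = q₂ + 1 by omega]
    ring

/-- Exchanging the outer rows exchanges the weights `t` and `s * x`, while the joint weight `s * t`
is symmetric. -/
theorem weight_gapChunk_swap {C : ℕ} (hC : (2 * C : ℤ) = (gapChunk j).twiceCost +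
      ((gapChunk j).d₂ - (gapChunk j).d₁) - ((gapChunk j).e₂ - (gapChunk j).e₁)) :
    t ^ ((gapChunk j).e₂ - (gapChunk j).e₁).toNat * s ^ ((gapChunk j).d₂ - (gapChunk j).d₁).toNat *
      x ^ C = gapWeight (s * x) t x (s * t) j := by
  rcases j with ⟨⟨a, b⟩, ⟨⟨c, d⟩, p, q, r⟩ | ⟨⟨d, p, r⟩, q₂, q₁⟩⟩
  · simp only [gapChunk, twiceCost, abs_eq_max_neg, gapWeight, Sum.elim_inl] at hC ⊢
    rw [show C = (a + 1) + (b - a) + (c + 1) + (d - c) + (p - min p (min q r)) + (q - max p r) by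
        omega,
      show ((max c d : ℕ) + p + 2 - -(a + 1) : ℤ).toNat
        = (a + 1) + (c + 1) + (d - c) + (min p (min q r) + 1) + (p - min p (min q r)) by omega,
      show ((max c d : ℕ) + r + 2 - (c + 1) : ℤ).toNat
        = (d - c) + (min p (min q r) + 1) + (r - min p (min q r)) by omega]
    ring
  · simp only [gapChunk, twiceCost, abs_eq_max_neg, gapWeight, Sum.elim_inr] at hC ⊢
    rw [show C = (a + 1) + (b - a) + (d + 1) + (p + 1) + r + (q₁ - q₂) by omega,
      show ((d : ℤ) + p + 2 - -(a + 1)).toNat = (a + 1) + (d + 1) + (p + 1) by omega,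
      show ((d : ℤ) + p + r + q₂ + 3 - (d + p + r + 2)).toNat = q₂ + 1 by omega]
    ring

theorem chunkWeight_normalize :
    chunkWeight t s x (gapChunk j).normalize = gapWeight t (s * x) x (s * t) j := by
  rw [← weight_gapChunk t s x j (gapChunk_isML j).cost_normalize]
  simp only [chunkWeight, Chunk.normalize, move, add_sub_add_right_eq_sub]

theorem chunkWeight_normalize_swap :
    chunkWeight t s x (gapChunk j).swap.normalize = gapWeight (s * x) t x (s * t) j := by
  rw [← weight_gapChunk_swap t s x j (gapChunk_isML j).cost_normalize_swap]
  simp only [chunkWeight, Chunk.normalize, move, swap, add_sub_add_right_eq_sub]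

theorem chunkWeight_normalize_mirror :
    chunkWeight t s x (gapChunk j).mirror.normalize = gapWeight t (s * x) x (s * t) j := by
  rw [← weight_gapChunk t s x j (gapChunk_isML j).cost_normalize_mirror]
  simp only [chunkWeight, Chunk.normalize, move, mirror, add_sub_add_right_eq_sub, neg_sub_neg]

theorem chunkWeight_normalize_swap_mirror :
    chunkWeight t s x (gapChunk j).swap.mirror.normalize = gapWeight (s * x) t x (s * t) j := by
  rw [← weight_gapChunk_swap t s x j (gapChunk_isML j).cost_normalize_swap_mirror]
  simp only [chunkWeight, Chunk.normalize, move, swap, mirror, add_sub_add_right_eq_sub,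
    neg_sub_neg]

end

theorem hasGF_chunkWeight {A : Type*} [CommRing A] {I : ℕ → Ideal A} {t s x Gt Gsx Gx Gst Gstx : A}
    (ht : ∀ N, t ^ N ∈ I N) (hx : ∀ N, x ^ N ∈ I N)
    (hGt : Gt * (1 - t) = 1) (hGsx : Gsx * (1 - s * x) = 1) (hGx : Gx * (1 - x) = 1)
    (hGst : Gst * (1 - s * t) = 1) (hGstx : Gstx * (1 - s * t * x) = 1) :
    HasGF I (fun c : AnyChunk => chunkWeight t s x c.1)
      (2 * (gapSum t (s * x) x (s * t) Gt Gsx Gx Gst Gstx +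
        gapSum (s * x) t x (s * t) Gsx Gt Gx Gst Gstx)) := by
  have hsx : ∀ N, (s * x) ^ N ∈ I N := fun N => by
    rw [mul_pow]; exact (I N).mul_mem_left _ (hx N)
  have hst : ∀ N, (s * t) ^ N ∈ I N := fun N => by
    rw [mul_pow]; exact (I N).mul_mem_left _ (ht N)
  have h1 := hasGF_gapWeight ht hsx hx hst hGt hGsx hGx hGst
    (Gab := Gstx) (by linear_combination hGstx)
  have h2 := hasGF_gapWeight hsx ht hx hst hGsx hGt hGx hGst
    (Gab := Gstx) (by linear_combination hGstx)
  convert ((h1.sumElim h2).sumElim (h1.sumElim h2)).of_bijective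
    (f := fun j => (⟨anyChunkMap j, anyChunkMap_good j⟩ : AnyChunk)) ⟨?_, ?_⟩ ?_ using 1
  · ring
  · exact fun j k h => anyChunkMap_injective (congrArg Subtype.val h)
  · rintro ⟨c, hc, h0⟩
    obtain ⟨j, hj⟩ := exists_anyChunkMap hc h0
    exact ⟨j, Subtype.ext hj⟩
  · rintro ((j | j) | (j | j))
    exacts [chunkWeight_normalize t s x j, chunkWeight_normalize_swap t s x j,
      chunkWeight_normalize_mirror t s x j, chunkWeight_normalize_swap_mirror t s x j]

/-! ### The partial fraction decomposition -/

/-- The numbers `k! * c_{k+1}` (and `c₀`, `c₇`, `c₈`) as polynomials in `u = 1 / (1 - s x)`,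
`v = 1 / (1 - x)` and `w = 1 / (1 - s)`. -/
def coeffInt {A : Type*} [CommRing A] (u v w : A) : Fin 9 → A :=
  ![-2*u^6 - 4*u^5*v - 4*u^4*v^2 - 2*u^3*v^3 + 12*u^5 + 22*u^4*v + 18*u^3*v^2 + 6*u^2*v^3 -
    30*u^4 - 48*u^3*v - 32*u^2*v^2 - 8*u*v^3 + 40*u^3 + 56*u^2*v + 30*u*v^2 + 4*v^3 - 32*u^2 -
    38*u*v - 12*v^2 + 16*u + 12*v - 4,
    4*u^5*v + 8*u^5*w + 8*u^4*v^2 - 8*u^4*w^2 + 2*u^3*v^3 - 8*u^2*w^4 + 8*u*w^5 - 2*w^6 - 8*u^5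
    - 28*u^4*v - 20*u^4*w - 26*u^3*v^2 + 24*u^3*w^2 - 6*u^2*v^3 + 8*u^2*w^3 - 4*u*w^4 + 28*u^4 +
    60*u^3*v + 16*u^3*w + 38*u^2*v^2 - 28*u^2*w^2 + 8*u*v^3 - 40*u^3 - 64*u^2*v - 4*u^2*w -
    32*u*v^2 + 12*u*w^2 - 4*v^3 + 32*u^2 + 40*u*v + 12*v^2 - 2*w^2 - 16*u - 12*v + 4,
    8*u^4*v + 8*u^4*w + 8*u^2*w^3 - 8*u*w^4 + 2*w^5 - 8*u^4 - 24*u^3*v - 24*u^3*w - 6*u^2*v^2 -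
    8*u^2*w^2 - 2*u*v^3 + 4*u*w^3 + 24*u^3 + 34*u^2*v + 28*u^2*w + 14*u*v^2 + 2*v^3 - 28*u^2 -
    28*u*v - 12*u*w - 8*v^2 + 16*u + 10*v + 2*w - 4,
    -2*u^3*v + 4*u^2*v^2 - 8*u^2*w^2 + 2*u*v^3 + 8*u*w^3 - 2*w^4 - 2*u^2*v + 8*u^2*w - 10*u*v^2
    - 4*u*w^2 - 2*v^3 + 10*u*v + 6*v^2 - 4*u - 6*v + 2,
    8*u^2*v + 8*u^2*w + 4*u*v^2 - 8*u*w^2 + 2*w^3 - 8*u^2 - 14*u*v + 4*u*w - 4*v^2 + 4*u + 6*v -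
    2,
    4*u*v + 8*u*w - 2*w^2 - 8*u - 4*v + 2,
    2*w - 2,
    2*u^6 - 8*u^5*w + 8*u^4*w^2 + 8*u^2*w^4 - 8*u*w^5 + 2*w^6 - 4*u^5 + 20*u^4*w - 24*u^3*w^2 -
    8*u^2*w^3 + 4*u*w^4 + 2*u^4 - 16*u^3*w + 28*u^2*w^2 + 4*u^2*w - 12*u*w^2 + 2*w^2,
    -4*u^4*v^2 + 6*u^4*v + 8*u^3*v^2 - 12*u^3*v - 6*u^2*v^2 + 8*u^2*v + 2*u*v^2 - 2*u*v]

/-- The coefficients `k! * ĉ_{k+1}` (and `ĉ₀`, `ĉ₈`) as polynomials in `v = 1 / (1 - x)`. -/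
def coeffIntOne {A : Type*} [CommRing A] (v : A) : Fin 9 → A :=
  ![-12*v^6 + 58*v^5 - 118*v^4 + 130*v^3 - 82*v^2 + 28*v - 4,
    16*v^6 - 72*v^5 + 136*v^4 - 140*v^3 + 84*v^2 - 28*v + 4,
    16*v^5 - 60*v^4 + 90*v^3 - 68*v^2 + 26*v - 4,
    12*v^4 - 38*v^3 + 44*v^2 - 22*v + 4,
    12*v^3 - 18*v^2 + 10*v - 2,
    12*v^2 - 8*v + 2,
    8*v - 2,
    2,
    -4*v^6 + 14*v^5 - 18*v^4 + 10*v^3 - 2*v^2]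

/-- Everything is rewritten in the inverses `p, q, r, u, v, w`. Products of two factors with
different poles in `t` are separated by `hpq`, `hpr`, `hqr`, and iterating these separates `p ^ n *
q` and `p ^ n * r`. -/
theorem gapSum_partialFraction {A : Type*} [CommRing A] {t s x p q r u v w : A}
    (hp : p * (1 - t) = 1) (hu : u * (1 - s * x) = 1) (hv : v * (1 - x) = 1)
    (hq : q * (1 - s * t) = 1) (hr : r * (1 - s * t * x) = 1) (hw : w * (1 - s) = 1) :
    2 * (gapSum t (s * x) x (s * t) p u v q r + gapSum (s * x) t x (s * t) u p v q r) =
      coeffInt u v w 0 + ∑ k : Fin 6, coeffInt u v w ⟨k + 1, by omega⟩ *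
        (t ^ (k : ℕ) * p ^ (k + 1 : ℕ))
        + coeffInt u v w 7 * q + coeffInt u v w 8 * r := by
  have htp : t * p = p - 1 := by linear_combination -hp
  have hsxu : s * x * u = u - 1 := by linear_combination -hu
  have hxv : x * v = v - 1 := by linear_combination -hv
  have hstq : s * t * q = q - 1 := by linear_combination -hq
  have hr' : t * (s * x) * r = r - 1 := by linear_combination -hr
  have hr'' : s * x * t * r = r - 1 := by linear_combination -hr
  have hsw : s * w = w - 1 := by linear_combination -hw
  have hpq : p * q = w * p + (1 - w) * q := by
    linear_combination w * (p * hq - s * q * hp) - p * q * hw - q * hsw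
  have hpr : p * r = u * p + (1 - u) * r := by
    linear_combination u * (p * hr - s * x * r * hp) - p * r * hu - r * hsxu
  have hqr : q * r = v * q + (1 - v) * r := by
    linear_combination v * (q * hr - x * r * hq) - q * r * hv - r * hxv
  -- Besides the separation rules there is the algebraic relation between `u`, `v`, `w` that comes
  -- from `s = 1 - 1 / w`, `x = 1 - 1 / v`.
  have hvw : v * w = u * (v + w - 1) := by
    linear_combination -v * w * hu + u * (v * hw + w * hv - w * (1 - s) * hv - hw)
  have htk (k : ℕ) : t ^ k * p ^ (k + 1) = p * (p - 1) ^ k := by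
    rw [pow_succ, ← mul_assoc, ← mul_pow, htp, mul_comm]
  have hq1 : p ^ 1 * q = w * p + (1 - w) * q := by rw [pow_one, hpq]
  have hq2 : p ^ 2 * q = w * (1 - w) ^ 1 * p ^ 1 + w * (1 - w) ^ 0 * p ^ 2 + (1 - w) ^ 2 * q := by
    linear_combination p * hq1 + (1 - w) ^ 1 * hpq
  have hq3 : p ^ 3 * q = w * (1 - w) ^ 2 * p ^ 1 + w * (1 - w) ^ 1 * p ^ 2 +
      w * (1 - w) ^ 0 * p ^ 3 + (1 - w) ^ 3 * q := by
    linear_combination p * hq2 + (1 - w) ^ 2 * hpq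
  have hq4 : p ^ 4 * q = w * (1 - w) ^ 3 * p ^ 1 + w * (1 - w) ^ 2 * p ^ 2 +
      w * (1 - w) ^ 1 * p ^ 3 + w * (1 - w) ^ 0 * p ^ 4 + (1 - w) ^ 4 * q := by
    linear_combination p * hq3 + (1 - w) ^ 3 * hpq
  have hq5 : p ^ 5 * q = w * (1 - w) ^ 4 * p ^ 1 + w * (1 - w) ^ 3 * p ^ 2 +
      w * (1 - w) ^ 2 * p ^ 3 + w * (1 - w) ^ 1 * p ^ 4 + w * (1 - w) ^ 0 * p ^ 5 +
      (1 - w) ^ 5 * q := by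
    linear_combination p * hq4 + (1 - w) ^ 4 * hpq
  have hq6 : p ^ 6 * q = w * (1 - w) ^ 5 * p ^ 1 + w * (1 - w) ^ 4 * p ^ 2 +
      w * (1 - w) ^ 3 * p ^ 3 + w * (1 - w) ^ 2 * p ^ 4 + w * (1 - w) ^ 1 * p ^ 5 +
      w * (1 - w) ^ 0 * p ^ 6 + (1 - w) ^ 6 * q := by
    linear_combination p * hq5 + (1 - w) ^ 5 * hpq
  have hr1 : p ^ 1 * r = u * p + (1 - u) * r := by rw [pow_one, hpr]
  have hr2 : p ^ 2 * r = u * (1 - u) ^ 1 * p ^ 1 + u * (1 - u) ^ 0 * p ^ 2 + (1 - u) ^ 2 * r := by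
    linear_combination p * hr1 + (1 - u) ^ 1 * hpr
  have hr3 : p ^ 3 * r = u * (1 - u) ^ 2 * p ^ 1 + u * (1 - u) ^ 1 * p ^ 2 +
      u * (1 - u) ^ 0 * p ^ 3 + (1 - u) ^ 3 * r := by
    linear_combination p * hr2 + (1 - u) ^ 2 * hpr
  have hr4 : p ^ 4 * r = u * (1 - u) ^ 3 * p ^ 1 + u * (1 - u) ^ 2 * p ^ 2 +
      u * (1 - u) ^ 1 * p ^ 3 + u * (1 - u) ^ 0 * p ^ 4 + (1 - u) ^ 4 * r := by
    linear_combination p * hr3 + (1 - u) ^ 3 * hpr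
  have hr5 : p ^ 5 * r = u * (1 - u) ^ 4 * p ^ 1 + u * (1 - u) ^ 3 * p ^ 2 +
      u * (1 - u) ^ 2 * p ^ 3 + u * (1 - u) ^ 1 * p ^ 4 + u * (1 - u) ^ 0 * p ^ 5 +
      (1 - u) ^ 5 * r := by
    linear_combination p * hr4 + (1 - u) ^ 4 * hpr
  have hr6 : p ^ 6 * r = u * (1 - u) ^ 5 * p ^ 1 + u * (1 - u) ^ 4 * p ^ 2 +
      u * (1 - u) ^ 3 * p ^ 3 + u * (1 - u) ^ 2 * p ^ 4 + u * (1 - u) ^ 1 * p ^ 5 +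
      u * (1 - u) ^ 0 * p ^ 6 + (1 - u) ^ 6 * r := by
    linear_combination p * hr5 + (1 - u) ^ 5 * hpr
  simp only [gapSum, htp, hsxu, hxv, hstq, hr', hr'', htk,
    coeffInt, Fin.sum_univ_six,
    Matrix.cons_val, Fin.isValue, Fin.reduceFinMk, zero_add, Fin.coe_ofNat_eq_mod,
    Nat.reduceMod, Nat.reduceAdd]
  linear_combination (6*p^5 + 6*p^4*u + 6*p^4*v - 6*p^4*w + 2*p^3*u*v - 6*p^3*u*w + 2*p^3*v^2 - 6*p^3*v*w +
    6*p^3*w^2 + 6*p^2*u^3 + 2*p^2*u^2*v - 2*p^2*u*v*w + 6*p^2*u*w^2 - 2*p^2*v^2*w + 6*p^2*v*w^2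
    - 6*p^2*w^3 + 6*p*u^4 + 6*p*u^3*v - 6*p*u^3*w + 2*p*u^2*v^2 - 2*p*u^2*v*w + 2*p*u*v*w^2 -
    6*p*u*w^3 + 2*p*v^2*w^2 - 6*p*v*w^3 + 6*p*w^4 - 6*q*u^4 - 6*q*u^3*v + 6*q*u^3*w -
    2*q*u^2*v^2 + 2*q*u^2*v*w - 2*q*u*v*w^2 + 6*q*u*w^3 - 2*q*v^2*w^2 + 6*q*v*w^3 - 6*q*w^4 -
    24*p^4 - 16*p^3*u - 18*p^3*v + 18*p^3*w - 16*p^2*u^2 - 8*p^2*u*v + 10*p^2*u*w - 4*p^2*v^2 +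
    12*p^2*v*w - 12*p^2*w^2 - 24*p*u^3 - 18*p*u^2*v + 16*p*u^2*w - 4*p*u*v^2 + 6*p*u*v*w -
    4*p*u*w^2 + 2*p*v^2*w - 6*p*v*w^2 + 6*p*w^3 + 18*q*u^3 + 16*q*u^2*v - 16*q*u^2*w + 4*q*u*v^2
    - 4*q*u*v*w - 2*q*u*w^2 + 36*p^3 + 28*p^2*u + 20*p^2*v - 18*p^2*w + 36*p*u^2 + 20*p*u*v -
    18*p*u*w + 4*p*v^2 - 8*p*v*w + 6*p*w^2 - 20*q*u^2 - 14*q*u*v + 14*q*u*w - 2*q*v^2 + 2*q*v*w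
    - 28*p^2 - 28*p*u - 12*p*v + 10*p*w + 10*q*u + 4*q*v - 4*q*w + 12*p - 2*q) * hvw +
    (2*p^5 + 2*p^4*u + 4*p^4*v + 2*p^3*u^2 + 4*p^3*u*v + 2*p^3*v^2 + 2*p^2*u^3 + 4*p^2*u^2*v +
    2*p^2*u*v^2 + 2*p*u^4 + 4*p*u^3*v + 2*p*u^2*v^2 + 2*u^5 + 4*u^4*v + 2*u^3*v^2 - 10*p^4 -
    10*p^3*u - 16*p^3*v - 12*p^2*u^2 - 18*p^2*u*v - 6*p^2*v^2 - 10*p*u^3 - 18*p*u^2*v -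
    8*p*u*v^2 - 10*u^4 - 16*u^3*v - 6*u^2*v^2 + 20*p^3 + 24*p^2*u + 26*p^2*v + 24*p*u^2 +
    32*p*u*v + 8*p*v^2 + 20*u^3 + 26*u^2*v + 8*u*v^2 - 22*p^2 - 28*p*u - 22*p*v - 22*u^2 -
    22*u*v - 4*v^2 + 14*p + 14*u + 8*v - 4) * hqr +
    (2*u^5 + 6*u^4*v + 6*u^3*v^2 + 2*u^2*v^3 - 12*u^4 - 28*u^3*v - 24*u^2*v^2 - 8*u*v^3 + 28*u^3
    + 60*u^2*v + 44*u*v^2 + 8*v^3 - 40*u^2 - 72*u*v - 32*v^2 + 36*u + 40*v - 16) * hq1 +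
    (2*u^4 + 4*u^3*v + 4*u^2*v^2 + 2*u*v^3 - 8*u^3 - 24*u^2*v - 24*u*v^2 - 6*v^3 + 24*u^2 +
    60*u*v + 38*v^2 - 40*u - 64*v + 32) * hq2 +
    (4*u^2*v + 6*u*v^2 + 2*v^3 - 8*u^2 - 28*u*v - 24*v^2 + 28*u + 60*v - 40) * hq3 +
    (2*u^2 + 6*u*v + 6*v^2 - 12*u - 30*v + 30) * hq4 +
    (2*u + 6*v - 12) * hq5 +
    (2) * hq6 +
    (-2*u^4*v - 4*u^3*v^2 - 2*u^2*v^3 + 10*u^3*v + 18*u^2*v^2 + 8*u*v^3 - 24*u^2*v - 32*u*v^2 -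
    8*v^3 + 28*u*v + 22*v^2 - 14*v) * hr1 +
    (-2*u^3*v - 4*u^2*v^2 - 2*u*v^3 + 12*u^2*v + 18*u*v^2 + 6*v^3 - 24*u*v - 26*v^2 + 22*v) * hr2 +
    (-2*u^2*v - 4*u*v^2 - 2*v^3 + 10*u*v + 16*v^2 - 20*v) * hr3 +
    (-2*u*v - 4*v^2 + 10*v) * hr4 +
    (-2*v) * hr5

/-- At `s = 1` the inverses `q` and `u` become `p` and `v`, so a product `p ^ 6 * q` turns into a
pole of order 7 at `t = 1`. -/
theorem gapSum_partialFraction_one {A : Type*} [CommRing A] {t x p r v : A}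
    (hp : p * (1 - t) = 1) (hv : v * (1 - x) = 1) (hr : r * (1 - t * x) = 1) :
    2 * (gapSum t x x t p v v p r + gapSum x t x t v p v p r) =
      coeffIntOne v 0 + ∑ k : Fin 7, coeffIntOne v ⟨k + 1, by omega⟩ *
        (t ^ (k : ℕ) * p ^ (k + 1 : ℕ))
        + coeffIntOne v 8 * r := by
  have htp : t * p = p - 1 := by linear_combination -hp
  have hxv : x * v = v - 1 := by linear_combination -hv
  have hr' : t * x * r = r - 1 := by linear_combination -hr
  have hr'' : x * t * r = r - 1 := by linear_combination -hr
  have hpr : p * r = v * p + (1 - v) * r := by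
    linear_combination v * (p * hr - x * r * hp) - p * r * hv - r * hxv
  have htk (k : ℕ) : t ^ k * p ^ (k + 1) = p * (p - 1) ^ k := by
    rw [pow_succ, ← mul_assoc, ← mul_pow, htp, mul_comm]
  have hr1 : p ^ 1 * r = v * p + (1 - v) * r := by rw [pow_one, hpr]
  have hr2 : p ^ 2 * r = v * (1 - v) ^ 1 * p ^ 1 + v * (1 - v) ^ 0 * p ^ 2 + (1 - v) ^ 2 * r := by
    linear_combination p * hr1 + (1 - v) ^ 1 * hpr
  have hr3 : p ^ 3 * r = v * (1 - v) ^ 2 * p ^ 1 + v * (1 - v) ^ 1 * p ^ 2 +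
      v * (1 - v) ^ 0 * p ^ 3 + (1 - v) ^ 3 * r := by
    linear_combination p * hr2 + (1 - v) ^ 2 * hpr
  have hr4 : p ^ 4 * r = v * (1 - v) ^ 3 * p ^ 1 + v * (1 - v) ^ 2 * p ^ 2 +
      v * (1 - v) ^ 1 * p ^ 3 + v * (1 - v) ^ 0 * p ^ 4 + (1 - v) ^ 4 * r := by
    linear_combination p * hr3 + (1 - v) ^ 3 * hpr
  have hr5 : p ^ 5 * r = v * (1 - v) ^ 4 * p ^ 1 + v * (1 - v) ^ 3 * p ^ 2 +
      v * (1 - v) ^ 2 * p ^ 3 + v * (1 - v) ^ 1 * p ^ 4 + v * (1 - v) ^ 0 * p ^ 5 +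
      (1 - v) ^ 5 * r := by
    linear_combination p * hr4 + (1 - v) ^ 4 * hpr
  have hr6 : p ^ 6 * r = v * (1 - v) ^ 5 * p ^ 1 + v * (1 - v) ^ 4 * p ^ 2 +
      v * (1 - v) ^ 3 * p ^ 3 + v * (1 - v) ^ 2 * p ^ 4 + v * (1 - v) ^ 1 * p ^ 5 +
      v * (1 - v) ^ 0 * p ^ 6 + (1 - v) ^ 6 * r := by
    linear_combination p * hr5 + (1 - v) ^ 5 * hpr
  simp only [gapSum, htp, hxv, hr', hr'', htk, coeffIntOne, Fin.sum_univ_seven,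
    Matrix.cons_val, Fin.isValue, Fin.reduceFinMk, zero_add, Fin.coe_ofNat_eq_mod,
    Nat.reduceMod, Nat.reduceAdd]
  linear_combination (8*v^5 - 40*v^4 + 90*v^3 - 112*v^2 + 72*v - 18) * hr1 +
    (8*v^4 - 44*v^3 + 100*v^2 - 100*v + 36) * hr2 +
    (8*v^3 - 44*v^2 + 76*v - 42) * hr3 +
    (8*v^2 - 32*v + 30) * hr4 +
    (6*v - 12) * hr5 +
    (2) * hr6

/-! ### The coefficients in a field and the function `T` -/

theorem map_coeffInt {A B : Type*} [CommRing A] [CommRing B] (φ : A →+* B) (u v w : A) (i : Fin 9) :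
    φ (coeffInt u v w i) = coeffInt (φ u) (φ v) (φ w) i := by
  fin_cases i <;> simp [coeffInt, map_ofNat]

theorem map_coeffIntOne {A B : Type*} [CommRing A] [CommRing B] (φ : A →+* B) (v : A) (i : Fin 9) :
    φ (coeffIntOne v i) = coeffIntOne (φ v) i := by
  fin_cases i <;> simp [coeffIntOne, map_ofNat]

/-- The factorials in the partial fraction decomposition of `T(t/x, s; x, y)`. -/
def fact : Fin 9 → ℕ := ![1, 1, 1, 2, 6, 24, 120, 1, 1]

/-- The factorials in the partial fraction decomposition of `T(t/x, 1; x, y)`. -/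
def factOne : Fin 9 → ℕ := ![1, 1, 1, 2, 6, 24, 120, 720, 1]

theorem fact_succ (k : Fin 6) : fact ⟨k + 1, by omega⟩ = (k : ℕ).factorial := by
  fin_cases k <;> rfl

theorem factOne_succ (k : Fin 7) : factOne ⟨k + 1, by omega⟩ = (k : ℕ).factorial := by
  fin_cases k <;> rfl

theorem fact_ne_zero (i : Fin 9) : fact i ≠ 0 := by
  fin_cases i <;> simp [fact]

section
variable {K : Type*} [Field K]

/-- The coefficients `c₀, …, c₈`. -/
def coeff (s x : K) (i : Fin 9) : K :=
  coeffInt (1 - s * x)⁻¹ (1 - x)⁻¹ (1 - s)⁻¹ i / fact i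

theorem map_coeff {L : Type*} [Field L] (φ : K →+* L) (s x : K) (i : Fin 9) :
    φ (coeff s x i) = coeff (φ s) (φ x) i := by
  simp [coeff, map_coeffInt]

theorem map_chat {L : Type*} [Field L] (φ : K →+* L) (x : K) (i : Fin 9) :
    φ (chat x i) = chat (φ x) i := by
  fin_cases i <;> simp [chat, map_ofNat]

theorem chat_eq [CharZero K] {x : K} (hx : 1 - x ≠ 0) (i : Fin 9) :
    chat x i = coeffIntOne (1 - x)⁻¹ i / factOne i := by
  -- In the variable `v` both sides become Laurent polynomials.
  obtain ⟨v, hv, rfl⟩ : ∃ v : K, v ≠ 0 ∧ x = 1 - v⁻¹ := ⟨(1 - x)⁻¹, inv_ne_zero hx, by simp⟩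
  rw [sub_sub_cancel, inv_inv]
  fin_cases i <;> simp [chat, coeffIntOne, factOne] <;> field_simp <;> ring

theorem sq_eq {a : K} (ha : 1 - a ≠ 0) : sq a = (1 - a)⁻¹ - 1 := by
  rw [sq]; field_simp; ring

/-- With `t / x` for `t`, the brackets of `T` are those of `t`, `s x`, `x`, `s t`, `s t x`. The
first three terms of `That` group into the first kind of gaps and the last two into the second. -/
theorem T_div_eq {t s x y : K} (hx : x ≠ 0) (hy : y ≠ 0) (ht : 1 - t ≠ 0) (hsx : 1 - s * x ≠ 0)
    (hx1 : 1 - x ≠ 0) (hst : 1 - s * t ≠ 0) (hstx : 1 - s * t * x ≠ 0) :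
    T (t / x) s x y / y = y ^ 3 * (2 *
      (gapSum t (s * x) x (s * t) (1 - t)⁻¹ (1 - s * x)⁻¹ (1 - x)⁻¹ (1 - s * t)⁻¹ (1 - s * t * x)⁻¹ +
      gapSum (s * x) t x (s * t) (1 - s * x)⁻¹ (1 - t)⁻¹ (1 - x)⁻¹ (1 - s * t)⁻¹
        (1 - s * t * x)⁻¹)) := by
  have e1 : t / x * x = t := by field_simp
  have e2 : s * (t / x) * x = s * t := by field_simp
  have e3 : s * (t / x) * x ^ 2 = s * t * x := by field_simp
  have e4 : t / x * s * x = s * t := by field_simp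
  have e5 : t / x * s * x ^ 2 = s * t * x := by field_simp
  rw [div_eq_iff hy]
  simp only [T, That, frillA, frillB, frillC, e1, e2, e3, e4, e5, sq_eq ht, sq_eq hsx, sq_eq hx1,
    sq_eq hst, sq_eq hstx]
  have hG {a : K} (ha : 1 - a ≠ 0) : a * (1 - a)⁻¹ = (1 - a)⁻¹ - 1 := by field_simp; ring
  have e6 : t * (s * x) * (1 - s * t * x)⁻¹ = (1 - s * t * x)⁻¹ - 1 := by
    rw [← hG hstx]; ring
  have e7 : s * x * t * (1 - s * t * x)⁻¹ = (1 - s * t * x)⁻¹ - 1 := by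
    rw [← hG hstx]; ring
  simp only [gapSum, e6, e7, hG ht, hG hsx, hG hx1, hG hst]
  ring

theorem T_partialFraction [CharZero K] {t s x y : K} (hx : x ≠ 0) (hy : y ≠ 0) (ht : 1 - t ≠ 0)
    (hsx : 1 - s * x ≠ 0) (hx1 : 1 - x ≠ 0) (hst : 1 - s * t ≠ 0) (hstx : 1 - s * t * x ≠ 0)
    (hs : 1 - s ≠ 0) :
    T (t / x) s x y / y = y ^ 3 * (coeff s x 0 + ∑ k : Fin 6, coeff s x ⟨k + 1, by omega⟩ *
      ((k : ℕ).factorial * t ^ (k : ℕ) / (1 - t) ^ (k + 1 : ℕ)) + coeff s x 7 * (1 / (1 - s * t)) +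
      coeff s x 8 * (1 / (1 - s * t * x))) := by
  rw [T_div_eq hx hy ht hsx hx1 hst hstx, gapSum_partialFraction (inv_mul_cancel₀ ht)
    (inv_mul_cancel₀ hsx) (inv_mul_cancel₀ hx1) (inv_mul_cancel₀ hst) (inv_mul_cancel₀ hstx)
    (inv_mul_cancel₀ hs)]
  have h0 : (fact 0 : K) = 1 := by simp [fact]
  have h7 : (fact 7 : K) = 1 := by simp [fact]
  have h8 : (fact 8 : K) = 1 := by simp [fact]
  simp only [coeff, h0, h7, h8, div_one, one_div, fact_succ, inv_pow]
  congr! 5 with k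
  have : ((k : ℕ).factorial : K) ≠ 0 := by exact_mod_cast (k : ℕ).factorial_ne_zero
  field_simp

theorem T_partialFraction_one [CharZero K] {t x y : K} (hx : x ≠ 0) (hy : y ≠ 0) (ht : 1 - t ≠ 0)
    (hx1 : 1 - x ≠ 0) (htx : 1 - t * x ≠ 0) :
    T (t / x) 1 x y / y = y ^ 3 * (chat x 0 + ∑ k : Fin 7, chat x ⟨k + 1, by omega⟩ *
      ((k : ℕ).factorial * t ^ (k : ℕ) / (1 - t) ^ (k + 1 : ℕ)) +
      chat x 8 * (1 / (1 - t * x))) := by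
  rw [T_div_eq hx hy ht (by rwa [one_mul]) hx1 (by rwa [one_mul]) (by rwa [one_mul])]
  simp only [one_mul]
  rw [gapSum_partialFraction_one (inv_mul_cancel₀ ht) (inv_mul_cancel₀ hx1) (inv_mul_cancel₀ htx)]
  have h0 : (factOne 0 : K) = 1 := by simp [factOne]
  have h8 : (factOne 8 : K) = 1 := by simp [factOne]
  simp only [chat_eq hx1, h0, h8, div_one, one_div, factOne_succ, inv_pow]
  congr! 4 with k
  have : ((k : ℕ).factorial : K) ≠ 0 := by exact_mod_cast (k : ℕ).factorial_ne_zero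
  field_simp

/-! ### Uniqueness of the partial fraction decomposition -/

-- At `X = 1` only the term with the highest pole survives; it vanishes, and the rest is divisible
-- by `1 - X`.
open Polynomial in
theorem eq_zero_of_sum_X_pow_mul {n : ℕ} {a₀ : K} {a : ℕ → K}
    (h : Polynomial.C a₀ * (1 - Polynomial.X) ^ n +
      ∑ k ∈ Finset.range n, Polynomial.C (a k) * (X ^ k * (1 - X) ^ (n - 1 - k)) = 0) :
    a₀ = 0 ∧ ∀ k < n, a k = 0 := by
  induction n with
  | zero => simpa using h
  | succ n ih =>
    have hs : ∑ k ∈ Finset.range n, Polynomial.C (a k) * (X ^ k * (1 - X) ^ (n + 1 - 1 - k)) =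
        (1 - X) * ∑ k ∈ Finset.range n, Polynomial.C (a k) * (X ^ k * (1 - X) ^ (n - 1 - k)) := by
      rw [Finset.mul_sum]
      refine Finset.sum_congr rfl fun k hk => ?_
      rw [Finset.mem_range] at hk
      rw [show n + 1 - 1 - k = n - 1 - k + 1 by omega]
      ring
    rw [Finset.sum_range_succ, hs] at h
    have hn : a n = 0 := by simpa using congrArg (Polynomial.eval 1) h
    have h1 : (1 - X : K[X]) ≠ 0 := fun e => by simpa using congrArg (Polynomial.eval 0) e
    rw [hn, map_zero, zero_mul, add_zero] at h
    obtain ⟨h2, h3⟩ := ih (mul_left_cancel₀ h1 (by linear_combination h))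
    refine ⟨h2, fun k hk => ?_⟩
    rcases Nat.lt_succ_iff_lt_or_eq.1 hk with hk | rfl
    exacts [h3 k hk, hn]

open Polynomial in
theorem partialFraction_eq_zero {n : ℕ} {a₀ a₁ a₂ α β : K} {a : ℕ → K} (hα : α ≠ 0) (hα1 : α ≠ 1)
    (hβ : β ≠ 0) (hβ1 : β ≠ 1) (hαβ : α ≠ β)
    (h : RatFunc.C a₀ + ∑ k ∈ Finset.range n, RatFunc.C (a k) *
        (RatFunc.X ^ k / (1 - RatFunc.X) ^ (k + 1)) +
      RatFunc.C a₁ * (1 / (1 - RatFunc.C α * RatFunc.X)) +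
      RatFunc.C a₂ * (1 / (1 - RatFunc.C β * RatFunc.X)) = 0) :
    a₀ = 0 ∧ (∀ k < n, a k = 0) ∧ a₁ = 0 ∧ a₂ = 0 := by
  have hne (γ : K) : (1 - Polynomial.C γ * X : K[X]) ≠ 0 :=
    fun e => by simpa using congrArg (Polynomial.eval 0) e
  have hne' (γ : K) : (1 - RatFunc.C γ * RatFunc.X : RatFunc K) ≠ 0 := fun e => hne γ <|
    RatFunc.algebraMap_injective K (by simpa [RatFunc.algebraMap_X, RatFunc.algebraMap_C] using e)
  have h1 : (1 - RatFunc.X : RatFunc K) ≠ 0 := by simpa using hne' 1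
  have hpoly : Polynomial.C a₀ * ((1 - X) ^ n * ((1 - Polynomial.C α * X) * (1 - Polynomial.C β * X))) +
      (∑ k ∈ Finset.range n, Polynomial.C (a k) * (X ^ k * (1 - X) ^ (n - 1 - k))) *
        ((1 - Polynomial.C α * X) * (1 - Polynomial.C β * X)) +
      Polynomial.C a₁ * ((1 - X) ^ n * (1 - Polynomial.C β * X)) +
      Polynomial.C a₂ * ((1 - X) ^ n * (1 - Polynomial.C α * X)) = 0 := by
    apply RatFunc.algebraMap_injective K
    have hs : ∑ k ∈ Finset.range n, RatFunc.C (a k) * (RatFunc.X ^ k * (1 - RatFunc.X) ^ (n - 1 - k)) =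
        (1 - RatFunc.X) ^ n * ∑ k ∈ Finset.range n, RatFunc.C (a k) *
          (RatFunc.X ^ k / (1 - RatFunc.X) ^ (k + 1)) := by
      rw [Finset.mul_sum]
      refine Finset.sum_congr rfl fun k hk => ?_
      rw [Finset.mem_range] at hk
      obtain ⟨m, rfl⟩ := Nat.exists_eq_add_of_lt hk
      rw [show k + m + 1 - 1 - k = m by omega]
      field_simp
      ring
    simp only [map_add, map_mul, map_sub, map_pow, map_one, map_zero, map_sum, RatFunc.algebraMap_X,
      RatFunc.algebraMap_C, hs]
    have hA := one_div_mul_cancel (hne' α)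
    have hB := one_div_mul_cancel (hne' β)
    linear_combination (1 - RatFunc.X) ^ n * (1 - RatFunc.C α * RatFunc.X) *
      (1 - RatFunc.C β * RatFunc.X) * h -
      RatFunc.C a₁ * (1 - RatFunc.X) ^ n * (1 - RatFunc.C β * RatFunc.X) * hA -
      RatFunc.C a₂ * (1 - RatFunc.X) ^ n * (1 - RatFunc.C α * RatFunc.X) * hB
  have hα2 : (1 - α⁻¹ : K) ≠ 0 := by rw [sub_ne_zero, ne_comm, Ne, inv_eq_one]; exact hα1
  have hβ2 : (1 - β⁻¹ : K) ≠ 0 := by rw [sub_ne_zero, ne_comm, Ne, inv_eq_one]; exact hβ1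
  -- After clearing denominators, evaluation at the simple poles `α⁻¹` and `β⁻¹` isolates `a₁` and
  -- `a₂`.
  have ha1 : a₁ = 0 := by
    have e := congrArg (Polynomial.eval α⁻¹) hpoly
    have : 1 - β * α⁻¹ ≠ 0 := fun e => hαβ (by field_simp at e; linear_combination e)
    simpa [hα, hα2, this] using e
  have ha2 : a₂ = 0 := by
    have e := congrArg (Polynomial.eval β⁻¹) hpoly
    have : 1 - α * β⁻¹ ≠ 0 := fun e => hαβ (by field_simp at e; linear_combination -e)
    simpa [hβ, hβ2, this] using e
  rw [ha1, ha2, map_zero] at hpoly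
  have := eq_zero_of_sum_X_pow_mul (n := n) (a₀ := a₀) (a := a)
    (mul_right_cancel₀ (mul_ne_zero (hne α) (hne β)) (by linear_combination hpoly))
  exact ⟨this.1, this.2, ha1, ha2⟩

end

/-! ### The coefficients in lowest terms -/

set_option maxHeartbeats 1000000 in
/-- The numerators of `c₀, …, c₈`, up to factorials. -/
def num {A : Type*} [CommRing A] (s x : A) : Fin 9 → A :=
  ![-s*2*x^3 + s^2*(8*x^4 + 2*x^5) + s^3*(-2*x^4 - 12*x^5 - 8*x^6) + s^4*(-2*x^4 + 6*x^5 +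
    10*x^6 + 12*x^7) + s^5*(2*x^6 - 10*x^7 - 8*x^8) + s^6*4*x^9,
    s*2*x^2 + s^2*(-16*x^2 + 8*x^3 - 12*x^4) + s^3*(4*x + 30*x^2 + 8*x^3 + 14*x^4 + 36*x^5) +
    s^4*(-2 + 6*x - 90*x^2 + 62*x^3 - 136*x^4 - 40*x^5 - 56*x^6) + s^5*(6*x + 60*x^2 - 6*x^3 +
    100*x^4 + 180*x^5 + 92*x^6 + 44*x^7) + s^6*(-60*x^2 + 52*x^3 - 160*x^4 - 140*x^5 - 200*x^6 -
    92*x^7 - 16*x^8) + s^7*(22*x^2 - 16*x^3 + 82*x^4 + 100*x^5 + 200*x^6 + 124*x^7 + 48*x^8) +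
    s^8*(-4*x^2 + 4*x^3 - 34*x^4 - 26*x^5 - 134*x^6 - 86*x^7 - 72*x^8) + s^9*(6*x^4 + 2*x^5 +
    50*x^6 + 30*x^7 + 58*x^8) + s^10*(-8*x^6 - 4*x^7 - 24*x^8) + s^11*4*x^8,
    -s*2*x^2 + s^2*(14*x^2 - 10*x^3 + 10*x^4) + s^3*(-4*x - 16*x^2 + 6*x^3 - 14*x^4 - 14*x^5) +
    s^4*(2 - 6*x + 42*x^2 - 54*x^3 + 68*x^4 + 6*x^5 + 12*x^6) + s^5*(-2*x - 12*x^2 + 34*x^3 -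
    62*x^4 - 28*x^6) + s^6*(4*x^2 - 20*x^3 + 36*x^4 - 10*x^5 + 32*x^6) + s^7*(4*x^3 - 8*x^4 +
    8*x^5 - 18*x^6) + s^8*(-2*x^5 + 4*x^6),
    s*2*x^2 + s^2*(-12*x^2 + 8*x^3 - 8*x^4) + s^3*(4*x + 8*x^2 + 6*x^3 - 2*x^4 + 14*x^5) +
    s^4*(-2 + 6*x - 30*x^2 + 26*x^3 - 24*x^4 - 8*x^5 - 8*x^6) + s^5*(2*x + 4*x^2 - 2*x^3 + 6*x^4
    + 8*x^5 + 12*x^6) + s^6*(-2*x^2 + 2*x^3 - 2*x^4 - 2*x^5 - 8*x^6) + s^7*2*x^6,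
    s*(2 + 2*x) + s^2*(-6 - 4*x + 4*x^2 - 6*x^3) + s^3*(6 - 4*x + 4*x^2 + 6*x^3) + s^4*(-2*x^2 -
    2*x^3),
    s*4 + s^2*(-6 + 2*x - 4*x^2) + s^3*(2*x + 2*x^2),
    s*2,
    s^2*2*x^2 + s^3*(-4*x - 8*x^3) + s^4*(2 + 18*x^2 + 12*x^4) + s^5*(-8*x - 8*x^2 - 24*x^3 -
    4*x^4 - 8*x^5) + s^6*(24*x^2 + 32*x^4 + 4*x^6) + s^7*(-8*x^2 - 8*x^3 - 24*x^4 - 4*x^5 -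
    8*x^6) + s^8*(2*x^2 + 18*x^4 + 12*x^6) + s^9*(-4*x^4 - 8*x^6) + s^10*2*x^6,
    -s*2*x^2 + s^2*(2*x^2 - 2*x^3) - s^3*2*x^4]

set_option maxHeartbeats 2000000 in
theorem coeffInt_eq_div {K : Type*} [Field K] {s x : K} (hsx : 1 - s * x ≠ 0) (hx : 1 - x ≠ 0)
    (hs : 1 - s ≠ 0) (i : Fin 9) :
    coeffInt (1 - s * x)⁻¹ (1 - x)⁻¹ (1 - s)⁻¹ i = num s x i / den s x i := by
  fin_cases i <;> simp only [coeffInt, num, den, Matrix.cons_val, Fin.isValue, Fin.reduceFinMk,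
    Fin.zero_eta, Fin.mk_one] <;> field_simp <;> ring

theorem map_num {A B : Type*} [CommRing A] [CommRing B] (φ : A →+* B) (s x : A) (i : Fin 9) :
    φ (num s x i) = num (φ s) (φ x) i := by
  fin_cases i <;> simp [num, map_ofNat]

theorem map_den {A B : Type*} [CommRing A] [CommRing B] (φ : A →+* B) (s x : A) (i : Fin 9) :
    φ (den s x i) = den (φ s) (φ x) i := by
  fin_cases i <;> simp [den]

section
open MvPolynomial

theorem isRelPrime_of_eval_ne_zero {q N : MvPolynomial (Fin 2) ℚ} (hq : Irreducible q)
    (a : Fin 2 → ℚ) (h0 : eval a q = 0) (h : eval a N ≠ 0) : IsRelPrime N q :=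
  (hq.isRelPrime_iff_not_dvd.2 fun ⟨r, hr⟩ => h (by rw [hr, map_mul, h0, zero_mul])).symm

theorem irreducible_one_sub_X (i : Fin 2) : Irreducible (1 - X i : MvPolynomial (Fin 2) ℚ) := by
  have h := irreducible_mul_X_add (-1 : MvPolynomial (Fin 2) ℚ) 1 i (by simp)
    (by rw [vars_neg]; simp) (by simp) isRelPrime_one_right
  convert h using 1
  ring

theorem irreducible_one_sub_X_mul_X :
    Irreducible (1 - X 0 * X 1 : MvPolynomial (Fin 2) ℚ) := by
  have h := irreducible_mul_X_add (-X 0 : MvPolynomial (Fin 2) ℚ) 1 1 (by simp)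
    (by rw [vars_neg, vars_X]; simp) (by simp) isRelPrime_one_right
  convert h using 1
  ring

/-- Each denominator is a product of powers of the irreducible polynomials `1 - x`, `1 - s x`, `1 -
s`. For each of these there is a rational zero, `(2, 1)`, `(2, 1/2)` and `(1, 2)`, at which none of
the nine numerators vanishes. -/
theorem isRelPrime_num_den (i : Fin 9) :
    IsRelPrime (num (X 0) (X 1) i : MvPolynomial (Fin 2) ℚ) (den (X 0) (X 1) i) := by
  have h1 : IsRelPrime (num (X 0) (X 1) i : MvPolynomial (Fin 2) ℚ) (1 - X 1) := by
    refine isRelPrime_of_eval_ne_zero (irreducible_one_sub_X 1) ![2, 1] (by simp) ?_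
    rw [map_num]
    fin_cases i <;> norm_num [num]
  have h2 : IsRelPrime (num (X 0) (X 1) i : MvPolynomial (Fin 2) ℚ) (1 - X 0 * X 1) := by
    refine isRelPrime_of_eval_ne_zero irreducible_one_sub_X_mul_X ![2, 1 / 2] (by simp) ?_
    rw [map_num]
    fin_cases i <;> norm_num [num]
  have h3 : IsRelPrime (num (X 0) (X 1) i : MvPolynomial (Fin 2) ℚ) (1 - X 0) := by
    refine isRelPrime_of_eval_ne_zero (irreducible_one_sub_X 0) ![1, 2] (by simp) ?_
    rw [map_num]
    fin_cases i <;> norm_num [num]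
  have hp {p : MvPolynomial (Fin 2) ℚ} (h : IsRelPrime (num (X 0) (X 1) i) p) (n : ℕ) :
      IsRelPrime (num (X 0) (X 1) i) (p ^ n) := h.pow_right
  unfold den
  fin_cases i
  · exact (hp h1 _).mul_right (hp h2 _)
  · exact ((hp h1 _).mul_right (hp h2 _)).mul_right (hp h3 _)
  · exact ((hp h1 _).mul_right (hp h2 _)).mul_right (hp h3 _)
  · exact ((hp h1 _).mul_right (hp h2 _)).mul_right (hp h3 _)
  · exact ((hp h1 _).mul_right h2).mul_right (hp h3 _)
  · exact (h1.mul_right h2).mul_right (hp h3 _)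
  · exact h3
  · exact (hp h2 _).mul_right (hp h3 _)
  · exact (hp h2 _).mul_right (hp h1 _)

end

/-! ### The partial fractions over `ℚ(s, x)` and `ℚ(x)` -/

theorem s₀_ne_one : s₀ ≠ 1 := by
  intro h
  have : (Polynomial.X : ℚ[X]) = 1 := RatFunc.algebraMap_injective ℚ (by
    rw [RatFunc.algebraMap_X, map_one]; exact h)
  simpa using congrArg (Polynomial.eval 0) this

theorem one_sub_C_mul_X_ne_zero {K : Type*} [Field K] (a : K) :
    (1 - RatFunc.C a * RatFunc.X : RatFunc K) ≠ 0 := by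
  have h : (1 - Polynomial.C a * Polynomial.X : K[X]) ≠ 0 :=
    fun e => by simpa using congrArg (Polynomial.eval 0) e
  exact fun e => h (RatFunc.algebraMap_injective K
    (by simpa [RatFunc.algebraMap_X, RatFunc.algebraMap_C] using e))

theorem one_sub_X_ne_zero {K : Type*} [Field K] : (1 - RatFunc.X : RatFunc K) ≠ 0 := by
  simpa using one_sub_C_mul_X_ne_zero (1 : K)

theorem one_sub_sv_ne_zero : 1 - sv ≠ 0 := by
  rw [sv, ← map_one RatFunc.C, ← map_sub]
  exact (map_ne_zero _).2 (sub_ne_zero.2 s₀_ne_one.symm)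

theorem one_sub_xv_ne_zero : 1 - xv ≠ 0 := one_sub_X_ne_zero

theorem one_sub_sv_mul_xv_ne_zero : 1 - sv * xv ≠ 0 := one_sub_C_mul_X_ne_zero _

theorem coeff_hasDenominator (i : Fin 9) :
    HasDenominator (coeff sv xv i) (den (MvPolynomial.X 0) (MvPolynomial.X 1) i) := by
  have hf : ((fact i : ℚ)) ≠ 0 := by exact_mod_cast fact_ne_zero i
  refine ⟨MvPolynomial.C (fact i : ℚ)⁻¹ * num (MvPolynomial.X 0) (MvPolynomial.X 1) i, ?_, ?_⟩
  · refine IsRelPrime.mul_left ?_ (isRelPrime_num_den i)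
    exact IsUnit.isRelPrime_left ((inv_ne_zero hf).isUnit.map MvPolynomial.C)
  · rw [coeff, coeffInt_eq_div one_sub_sv_mul_xv_ne_zero one_sub_xv_ne_zero one_sub_sv_ne_zero,
      map_mul, ← AlgHom.coe_toRingHom, map_num, map_den]
    simp [div_eq_inv_mul]
    ring

theorem coeff_eight : coeff sv xv 8 = c8 sv xv := by
  rw [coeff, coeffInt_eq_div one_sub_sv_mul_xv_ne_zero one_sub_xv_ne_zero one_sub_sv_ne_zero]
  simp only [num, den, c8, fact, Matrix.cons_val, Fin.isValue, Nat.cast_one, div_one]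
  congr 1
  ring

theorem coeff_isPartialFraction : IsPartialFraction (coeff sv xv) := by
  intro y hy
  have h1 : (1 - RatFunc.C sv * RatFunc.C xv : RatFunc Qsx) ≠ 0 := by
    have := (map_ne_zero (RatFunc.C : Qsx →+* RatFunc Qsx)).2 one_sub_sv_mul_xv_ne_zero
    simpa using this
  have h2 : (1 - RatFunc.C xv : RatFunc Qsx) ≠ 0 := by
    have := (map_ne_zero (RatFunc.C : Qsx →+* RatFunc Qsx)).2 one_sub_xv_ne_zero
    simpa using this
  have h3 : (1 - RatFunc.C sv : RatFunc Qsx) ≠ 0 := by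
    have := (map_ne_zero (RatFunc.C : Qsx →+* RatFunc Qsx)).2 one_sub_sv_ne_zero
    simpa using this
  have h4 : (1 - RatFunc.C sv * RatFunc.X * RatFunc.C xv : RatFunc Qsx) ≠ 0 := by
    have := one_sub_C_mul_X_ne_zero (sv * xv)
    rwa [map_mul, mul_right_comm] at this
  rw [T_partialFraction ((map_ne_zero _).2 RatFunc.X_ne_zero) hy one_sub_X_ne_zero h1 h2
    (one_sub_C_mul_X_ne_zero sv) h4 h3]
  simp only [map_coeff]

theorem coeff_isPartialFraction_unique {c : Fin 9 → Qsx} (hc : IsPartialFraction c) :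
    c = coeff sv xv := by
  have h := (hc 1 one_ne_zero).symm.trans (coeff_isPartialFraction 1 one_ne_zero)
  simp only [one_pow, one_mul] at h
  obtain ⟨h0, hk, h7, h8⟩ := partialFraction_eq_zero (n := 6) (a₀ := c 0 - coeff sv xv 0)
    (a₁ := c 7 - coeff sv xv 7) (a₂ := c 8 - coeff sv xv 8) (α := sv) (β := sv * xv)
    (a := fun k => if hk : k < 6 then (c ⟨k + 1, by omega⟩ - coeff sv xv ⟨k + 1, by omega⟩) *
      (k.factorial : Qsx) else 0) (by simp [sv, s₀, RatFunc.X_ne_zero])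
    (sub_ne_zero.1 one_sub_sv_ne_zero).symm (by simp [sv, s₀, xv, RatFunc.X_ne_zero])
    (sub_ne_zero.1 one_sub_sv_mul_xv_ne_zero).symm (by
      rw [Ne, left_eq_mul₀ (by simp [sv, s₀, RatFunc.X_ne_zero])]
      exact (sub_ne_zero.1 one_sub_xv_ne_zero).symm) (by
    rw [Finset.sum_range]
    simp only [Fin.is_lt, dite_true, map_sub, map_mul, map_natCast]
    rw [← sub_eq_zero] at h
    rw [← h]
    simp only [Fin.sum_univ_six]
    ring)
  funext i
  rw [← sub_eq_zero]
  have hk' (k : ℕ) (hk6 : k < 6) : c ⟨k + 1, by omega⟩ - coeff sv xv ⟨k + 1, by omega⟩ = 0 := by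
    have := hk k hk6
    rw [dif_pos hk6] at this
    exact (mul_eq_zero.1 this).resolve_right (by exact_mod_cast k.factorial_ne_zero)
  fin_cases i
  exacts [h0, hk' 0 (by omega), hk' 1 (by omega), hk' 2 (by omega), hk' 3 (by omega),
    hk' 4 (by omega), hk' 5 (by omega), h7, h8]

theorem chat_isPartialFractionOne : IsPartialFractionOne (chat RatFunc.X) := by
  intro y hy
  have h2 : (1 - RatFunc.C (RatFunc.X : RatFunc ℚ) : RatFunc (RatFunc ℚ)) ≠ 0 := by
    have := (map_ne_zero (RatFunc.C : RatFunc ℚ →+* RatFunc (RatFunc ℚ))).2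
      (one_sub_X_ne_zero (K := ℚ))
    simpa using this
  have h4 : (1 - RatFunc.X * RatFunc.C (RatFunc.X : RatFunc ℚ) : RatFunc (RatFunc ℚ)) ≠ 0 := by
    rw [mul_comm]; exact one_sub_C_mul_X_ne_zero _
  rw [T_partialFraction_one ((map_ne_zero _).2 RatFunc.X_ne_zero) hy one_sub_X_ne_zero h2 h4]
  simp only [map_chat]

theorem chat_isPartialFractionOne_unique {c : Fin 9 → RatFunc ℚ} (hc : IsPartialFractionOne c) :
    c = chat RatFunc.X := by
  have h := (hc 1 one_ne_zero).symm.trans (chat_isPartialFractionOne 1 one_ne_zero)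
  simp only [one_pow, one_mul] at h
  have h2 : (2 : RatFunc ℚ) = RatFunc.C 2 := by rw [map_ofNat]
  have hX : (2 : RatFunc ℚ) ≠ RatFunc.X := by
    rw [h2]
    intro e
    have : (Polynomial.C 2 : ℚ[X]) = Polynomial.X := RatFunc.algebraMap_injective ℚ (by
      rw [RatFunc.algebraMap_X, RatFunc.algebraMap_C]; exact e)
    simpa using congrArg (Polynomial.eval 0) this
  -- There is only one simple pole here. The other one is a dummy with coefficient 0, at `α = 2`,
  -- which differs from 0, 1 and `x`.
  obtain ⟨h0, hk, -, h8⟩ := partialFraction_eq_zero (n := 7) (a₀ := c 0 - chat RatFunc.X 0)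
    (a₁ := 0) (a₂ := c 8 - chat RatFunc.X 8) (α := 2) (β := RatFunc.X)
    (a := fun k => if hk : k < 7 then (c ⟨k + 1, by omega⟩ - chat RatFunc.X ⟨k + 1, by omega⟩) *
      (k.factorial : RatFunc ℚ) else 0) (by norm_num) (by norm_num) RatFunc.X_ne_zero
    (sub_ne_zero.1 one_sub_X_ne_zero).symm hX (by
    rw [Finset.sum_range]
    simp only [Fin.is_lt, dite_true, map_sub, map_mul, map_natCast]
    rw [← sub_eq_zero] at h
    rw [← h]
    simp only [Fin.sum_univ_seven, map_zero]
    ring)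
  funext i
  rw [← sub_eq_zero]
  have hk' (k : ℕ) (hk6 : k < 7) : c ⟨k + 1, by omega⟩ - chat RatFunc.X ⟨k + 1, by omega⟩ = 0 := by
    have := hk k hk6
    rw [dif_pos hk6] at this
    exact (mul_eq_zero.1 this).resolve_right (by exact_mod_cast k.factorial_ne_zero)
  fin_cases i
  exacts [h0, hk' 0 (by omega), hk' 1 (by omega), hk' 2 (by omega), hk' 3 (by omega),
    hk' 4 (by omega), hk' 5 (by omega), hk' 6 (by omega), h8]

theorem chat_eight {K : Type*} [Field K] {x : K} (hx : 1 - x ≠ 0) : chat x 8 = c8 1 x := by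
  simp only [chat, c8, Matrix.cons_val, Fin.isValue, one_mul]
  field_simp
  ring

/-! ### The generating function of the chunks below a row of given width -/

section
variable {R : Type*} [CommRing R]

/-- The ideals of the `x`-adic topology. -/
noncomputable def xIdeal (N : ℕ) : Ideal R⟦X⟧ := Ideal.span {PowerSeries.X ^ N}

theorem mem_xIdeal {N : ℕ} {a : R⟦X⟧} : a ∈ xIdeal N ↔ ∀ n < N, PowerSeries.coeff n a = 0 := by
  rw [xIdeal, Ideal.mem_span_singleton, PowerSeries.X_pow_dvd_iff]

theorem X_pow_mem_xIdeal {N n : ℕ} (h : N ≤ n) : (PowerSeries.X ^ n : R⟦X⟧) ∈ xIdeal N :=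
  Ideal.mem_span_singleton.2 (pow_dvd_pow _ h)

theorem le_of_X_pow_mem_xIdeal [Nontrivial R] {N n : ℕ} (h : (PowerSeries.X ^ n : R⟦X⟧) ∈ xIdeal N) :
    N ≤ n := by
  by_contra! hn
  have := mem_xIdeal.1 h n hn
  rw [PowerSeries.coeff_X_pow_self] at this
  exact one_ne_zero this

theorem eq_zero_of_mem_xIdeal (a : R⟦X⟧) (h : ∀ N, a ∈ xIdeal N) : a = 0 := by
  ext n
  exact mem_xIdeal.1 (h (n + 1)) n n.lt_succ_self

/-- The ideals of the `(t, x)`-adic topology on `R⟦x⟧⟦t⟧`. -/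
noncomputable def txIdeal (N : ℕ) : Ideal R⟦X⟧⟦X⟧ :=
  Ideal.span {PowerSeries.X ^ N, PowerSeries.C PowerSeries.X ^ N}

/-- Continuity of taking the coefficient of `t ^ w`: a multiple of `t ^ (w + 1)` does not
contribute, and a multiple of `x ^ N` stays one. -/
theorem coeff_mem_xIdeal {N w : ℕ} {a : R⟦X⟧⟦X⟧} (h : a ∈ txIdeal (max (w + 1) N)) :
    PowerSeries.coeff w a ∈ xIdeal (R := R) N := by
  rw [txIdeal, Ideal.mem_span_pair] at h
  obtain ⟨b, c, rfl⟩ := h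
  rw [map_add, ← map_pow, mul_comm c, PowerSeries.coeff_C_mul, PowerSeries.coeff_mul_X_pow',
    if_neg (by omega), zero_add]
  exact Ideal.mul_mem_right _ _ (X_pow_mem_xIdeal (le_max_right _ _))

theorem coeff_chunkWeight (s : R) (w : ℕ) (c : Chunk) :
    PowerSeries.coeff w (chunkWeight (PowerSeries.X : R⟦X⟧⟦X⟧) (PowerSeries.C (PowerSeries.C s))
      (PowerSeries.C PowerSeries.X) c) =
    if (c.d₂ - c.d₁).toNat = w then
      PowerSeries.C s ^ (c.e₂ - c.e₁).toNat * PowerSeries.X ^ c.cost else 0 := by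
  have h : chunkWeight (PowerSeries.X : R⟦X⟧⟦X⟧) (PowerSeries.C (PowerSeries.C s))
      (PowerSeries.C PowerSeries.X) c = PowerSeries.C (PowerSeries.C s ^ (c.e₂ - c.e₁).toNat *
        PowerSeries.X ^ c.cost) * PowerSeries.X ^ (c.d₂ - c.d₁).toNat := by
    rw [chunkWeight, map_mul, map_pow, map_pow]
    ring
  rw [h, PowerSeries.coeff_C_mul, PowerSeries.coeff_X_pow]
  simp only [eq_comm, mul_ite, mul_one, mul_zero]

theorem HasGF.chunkBelow {s : R} {F : R⟦X⟧⟦X⟧}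
    (h : HasGF txIdeal (fun c : AnyChunk => chunkWeight (PowerSeries.X : R⟦X⟧⟦X⟧)
      (PowerSeries.C (PowerSeries.C s)) (PowerSeries.C PowerSeries.X) c.1) F) (w : ℕ) :
    HasGF xIdeal (fun c : ChunkBelow w =>
      PowerSeries.C s ^ (c.1.e₂ - c.1.e₁).toNat * PowerSeries.X ^ c.1.cost)
      (PowerSeries.coeff w F) := by
  have h1 := h.map (J := xIdeal) (PowerSeries.coeff (R := R⟦X⟧) w).toAddMonoidHom
    fun N => ⟨max (w + 1) N, fun a ha => coeff_mem_xIdeal ha⟩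
  simp only [LinearMap.toAddMonoidHom_coe, coeff_chunkWeight] at h1
  have h2 := h1.subtype (fun c => c.1.d₂ - c.1.d₁ = w) fun c hc => if_neg fun e => hc (by
    have := c.2.1.1.hd
    omega)
  refine h2.of_equiv ⟨fun c => ⟨c.1.1, c.1.2.1, c.1.2.2, c.2⟩, fun c => ⟨⟨c.1, c.2.1, c.2.2.1⟩, c.2.2.2⟩,
    fun c => rfl, fun c => rfl⟩ ?_
  rintro ⟨c, hc⟩
  exact (if_pos (by rw [hc, Int.toNat_natCast])).symm

theorem mk_pow_mul_one_sub (a : R) :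
    PowerSeries.mk (fun n => a ^ n) * (1 - PowerSeries.C a * PowerSeries.X) = 1 := by
  have h := congrArg (PowerSeries.rescale a) (PowerSeries.mk_one_mul_one_sub_eq_one R)
  rw [map_mul, map_sub, map_one, PowerSeries.rescale_X] at h
  convert h using 2
  ext n
  simp

theorem coeff_X_pow_mul_mk_one_pow (w k : ℕ) :
    PowerSeries.coeff w (PowerSeries.X ^ k * PowerSeries.mk 1 ^ (k + 1) : R⟦X⟧) = w.choose k := by
  rw [PowerSeries.mk_one_pow_eq_mk_choose_add R, PowerSeries.coeff_X_pow_mul']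
  split_ifs with h
  · rw [PowerSeries.coeff_mk, Nat.add_sub_cancel' h]
  · rw [Nat.choose_eq_zero_of_lt (by omega), Nat.cast_zero]

end

section
variable {R : Type*} [Field R]

/-- The series `1 / (1 - s x)`. -/
noncomputable def geomSeries (s : R) : R⟦X⟧ := PowerSeries.mk fun n => s ^ n

theorem geomSeries_mul (s : R) :
    geomSeries s * (1 - PowerSeries.C s * PowerSeries.X) = 1 := mk_pow_mul_one_sub s

theorem geomSeries_one_mul : geomSeries (1 : R) * (1 - PowerSeries.X) = 1 := by
  simpa using geomSeries_mul (1 : R)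

/-- The integral coefficients, as power series in `x`. -/
noncomputable def coeffSeries (s : R) : Fin 9 → R⟦X⟧ :=
  coeffInt (geomSeries s) (geomSeries 1) (PowerSeries.C (1 - s)⁻¹)

theorem hasGF_chunkBelow {s : R} (hs : s ≠ 1) {w : ℕ} (hw : 1 ≤ w) :
    HasGF xIdeal (fun c : ChunkBelow w =>
      PowerSeries.C s ^ (c.1.e₂ - c.1.e₁).toNat * PowerSeries.X ^ c.1.cost)
      (∑ k : Fin 6, coeffSeries s ⟨k + 1, by omega⟩ * (w.choose k : R⟦X⟧) +
        coeffSeries s 7 * PowerSeries.C s ^ w +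
        coeffSeries s 8 * (PowerSeries.C s * PowerSeries.X) ^ w) := by
  have hp : PowerSeries.mk (1 : ℕ → R⟦X⟧) * (1 - PowerSeries.X) = 1 :=
    PowerSeries.mk_one_mul_one_sub_eq_one _
  have hu : (PowerSeries.C (geomSeries s) : R⟦X⟧⟦X⟧) *
      (1 - PowerSeries.C (PowerSeries.C s) * PowerSeries.C PowerSeries.X) = 1 := by
    rw [← map_mul, ← map_one PowerSeries.C, ← map_sub, ← map_mul, geomSeries_mul]
  have hv : (PowerSeries.C (geomSeries 1) : R⟦X⟧⟦X⟧) * (1 - PowerSeries.C PowerSeries.X) = 1 := by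
    rw [← map_one PowerSeries.C, ← map_sub, ← map_mul, geomSeries_one_mul]
  have hq := mk_pow_mul_one_sub (PowerSeries.C s : R⟦X⟧)
  have hr : (PowerSeries.mk fun n => (PowerSeries.C s * PowerSeries.X) ^ n : R⟦X⟧⟦X⟧) *
      (1 - PowerSeries.C (PowerSeries.C s) * PowerSeries.X * PowerSeries.C PowerSeries.X) = 1 := by
    have h := mk_pow_mul_one_sub (PowerSeries.C s * PowerSeries.X : R⟦X⟧)
    rw [map_mul] at h
    linear_combination h
  have hw' : (PowerSeries.C (PowerSeries.C (1 - s)⁻¹) : R⟦X⟧⟦X⟧) *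
      (1 - PowerSeries.C (PowerSeries.C s)) = 1 := by
    rw [← map_one PowerSeries.C, ← map_one PowerSeries.C, ← map_sub, ← map_sub, ← map_mul,
      ← map_mul, inv_mul_cancel₀ (sub_ne_zero.2 hs.symm)]
  have h := hasGF_chunkWeight (I := txIdeal) (t := (PowerSeries.X : R⟦X⟧⟦X⟧))
    (s := PowerSeries.C (PowerSeries.C s)) (x := PowerSeries.C PowerSeries.X)
    (fun N => Ideal.subset_span (by simp)) (fun N => Ideal.subset_span (by simp)) hp hu hv hq hr
  rw [gapSum_partialFraction hp hu hv hq hr hw'] at h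
  simp only [← map_coeffInt] at h
  convert h.chunkBelow w using 1
  -- The term `c₀` is constant in `t` and drops out because `w ≠ 0`.
  simp only [map_add, map_sum, PowerSeries.coeff_C_mul, coeff_X_pow_mul_mk_one_pow,
    PowerSeries.coeff_mk, PowerSeries.coeff_C, if_neg (by omega : w ≠ 0), zero_add]
  rfl

theorem hasGF_chunkBelow_one {w : ℕ} (hw : 1 ≤ w) :
    HasGF xIdeal (fun c : ChunkBelow w =>
      PowerSeries.C (1 : R) ^ (c.1.e₂ - c.1.e₁).toNat * PowerSeries.X ^ c.1.cost)
      (∑ k : Fin 7, coeffIntOne (geomSeries (1 : R)) ⟨k + 1, by omega⟩ * (w.choose k : R⟦X⟧) +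
        coeffIntOne (geomSeries (1 : R)) 8 * PowerSeries.X ^ w) := by
  have hp : PowerSeries.mk (1 : ℕ → R⟦X⟧) * (1 - PowerSeries.X) = 1 :=
    PowerSeries.mk_one_mul_one_sub_eq_one _
  have hv : (PowerSeries.C (geomSeries 1) : R⟦X⟧⟦X⟧) * (1 - PowerSeries.C PowerSeries.X) = 1 := by
    rw [← map_one PowerSeries.C, ← map_sub, ← map_mul, geomSeries_one_mul]
  have hr : (PowerSeries.mk fun n => PowerSeries.X ^ n : R⟦X⟧⟦X⟧) *
      (1 - PowerSeries.X * PowerSeries.C PowerSeries.X) = 1 := by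
    linear_combination mk_pow_mul_one_sub (PowerSeries.X : R⟦X⟧)
  have h := hasGF_chunkWeight (I := txIdeal) (t := (PowerSeries.X : R⟦X⟧⟦X⟧))
    (s := PowerSeries.C (PowerSeries.C 1)) (x := PowerSeries.C PowerSeries.X)
    (fun N => Ideal.subset_span (by simp)) (fun N => Ideal.subset_span (by simp)) hp
    (by simpa only [map_one, one_mul] using hv) hv (by simpa only [map_one, one_mul] using hp)
    (by simpa only [map_one, one_mul] using hr)
  simp only [map_one, one_mul] at h
  rw [gapSum_partialFraction_one hp hv hr] at h
  simp only [← map_coeffIntOne] at h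
  convert HasGF.chunkBelow (s := (1 : R)) (by simpa only [map_one] using h) w using 1
  simp only [map_add, map_sum, PowerSeries.coeff_C_mul, coeff_X_pow_mul_mk_one_pow,
    PowerSeries.coeff_mk, PowerSeries.coeff_C, if_neg (by omega : w ≠ 0), zero_add]

end

/-! ### The recurrences -/

/-- Finiteness is a by-product of summability: all but finitely many of the terms `x ^ cost` lie in
the ideal of `x ^ (h + 1)`. There is no chunk for `w = 0`, as `d₁ < d₂`. -/
theorem finite_chunkBelow (w h : ℕ) : {c : ChunkBelow w | c.1.cost ≤ h}.Finite := by
  have hw : 1 ≤ w ∨ w = 0 := by omega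
  rcases hw with hw | rfl
  · obtain ⟨s, hs, -⟩ := hasGF_chunkBelow_one (R := ℚ) hw (h + 1)
    refine s.finite_toSet.subset fun c hc => ?_
    by_contra hcs
    have h1 : (PowerSeries.X ^ c.1.cost : ℚ⟦X⟧) ∈ xIdeal (h + 1) := by
      simpa only [map_one, one_pow, one_mul] using hs c hcs
    have := le_of_X_pow_mem_xIdeal h1
    have : c.1.cost ≤ h := hc
    omega
  · convert Set.finite_empty
    ext c
    have h1 := c.2.1.1.hd
    have h2 := c.2.2.2
    exfalso
    omega

theorem finite_poly (m h : ℕ) : {P : Poly m | P.half ≤ h}.Finite := by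
  induction m with
  | zero =>
    refine ((Finset.range h).map rectEquiv.toEmbedding).finite_toSet.subset fun P hP => ?_
    rw [Finset.mem_coe, Finset.mem_map_equiv, Finset.mem_range]
    have := half_rectEquiv (rectEquiv.symm P)
    rw [Equiv.apply_symm_apply] at this
    have : P.half ≤ h := hP
    omega
  | succ m ih =>
    refine ((ih.toFinset.sigma fun P => (finite_chunkBelow P.width h).toFinset).map
      (attachEquiv m).toEmbedding).finite_toSet.subset fun P hP => ?_
    rw [Finset.mem_coe, Finset.mem_map_equiv, Finset.mem_sigma, Set.Finite.mem_toFinset,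
      Set.Finite.mem_toFinset]
    have := half_attachEquiv m ((attachEquiv m).symm P)
    rw [Equiv.apply_symm_apply] at this
    have hP : P.half ≤ h := hP
    show _ ≤ h ∧ _ ≤ h
    omega

theorem finite_polygons (h v : ℕ) : (polygons h v).Finite := by
  by_cases hv : ∃ m, v = 3 * m + 1
  · obtain ⟨m, rfl⟩ := hv
    rw [polygons_eq_image]
    exact ((finite_poly m h).subset fun P hP => le_of_eq hP).image _
  · rw [polygons_eq_empty (by simpa using hv)]
    exact Set.finite_empty

/-- The polygons with `2 * m + 1` rows and horizontal half-perimeter less than `N`. -/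
noncomputable def polyLT (m N : ℕ) : Finset (Poly m) :=
  ((finite_poly m N).subset (t := {P | P.half < N}) fun P hP =>
    (show P.half ≤ N from le_of_lt (show P.half < N from hP))).toFinset

theorem mem_polyLT {m N : ℕ} {P : Poly m} : P ∈ polyLT m N ↔ P.half < N := by
  rw [polyLT, Set.Finite.mem_toFinset, Set.mem_ofPred_eq]

/-! ### The series `fₙ` as sums over polygons -/

theorem fn_succ (m : ℕ) : fn (m + 1) = PowerSeries.coeff (3 * m + 1) f := by
  rw [fn, show 3 * (m + 1) - 2 = 3 * m + 1 by omega]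

theorem coeff_fn {m h N : ℕ} (hN : h < N) : PowerSeries.coeff h (fn (m + 1)) =
    ∑ P ∈ polyLT m N with P.half = h, (Polynomial.X : ℚ[X]) ^ P.width := by
  rw [fn_succ, f, PowerSeries.coeff_mk, PowerSeries.coeff_mk, polygons_eq_image,
    finsum_mem_image Subtype.val_injective.injOn]
  refine finsum_mem_eq_sum_of_inter_support_eq (s := {P : Poly m | P.half = h})
    (fun P : Poly m => (Polynomial.X : ℚ[X]) ^ P.width) ?_
  congr 1
  ext P
  simp only [Set.mem_ofPred_eq, Finset.coe_filter, mem_polyLT]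
  constructor
  · rintro rfl
    exact ⟨hN, rfl⟩
  · exact fun h => h.2

theorem coeff_dS_iterate (k h : ℕ) (φ : ℚ[X]⟦X⟧) :
    PowerSeries.coeff h (dS^[k] φ) = Polynomial.derivative^[k] (PowerSeries.coeff h φ) := by
  induction k generalizing φ with
  | zero => rfl
  | succ k ih =>
    rw [Function.iterate_succ_apply, ih, dS, PowerSeries.coeff_mk, Function.iterate_succ_apply]

section
variable {R : Type*} [Field R] [Algebra ℚ R]

/-- Grouping the polygons by half-perimeter turns the partial sums into those of `substS`; the
truncation in `substS` is harmless since `x ^ h` only affects coefficients from `h` on. -/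
theorem hasGF_fn (g : R⟦X⟧) (k m : ℕ) :
    HasGF xIdeal (fun P : Poly m =>
      Polynomial.aeval g (Polynomial.derivative^[k] ((Polynomial.X : ℚ[X]) ^ P.width)) *
        PowerSeries.X ^ P.half) (substS g (dS^[k] (fn (m + 1)))) := by
  intro N
  refine ⟨polyLT m N, fun P hP => ?_, ?_⟩
  · rw [mem_polyLT, not_lt] at hP
    exact Ideal.mul_mem_left _ _ (X_pow_mem_xIdeal hP)
  · have e : ∑ P ∈ polyLT m N, Polynomial.aeval g (Polynomial.derivative^[k]
        ((Polynomial.X : ℚ[X]) ^ P.width)) * PowerSeries.X ^ P.half =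
        ∑ h ∈ Finset.range N, Polynomial.aeval g (PowerSeries.coeff h (dS^[k] (fn (m + 1)))) *
          PowerSeries.X ^ h := by
      rw [← Finset.sum_fiberwise_of_maps_to (s := polyLT m N) (t := Finset.range N)
        (g := fun P => P.half) fun P hP => Finset.mem_range.2 (mem_polyLT.1 hP)]
      refine Finset.sum_congr rfl fun h hh => ?_
      rw [coeff_dS_iterate, coeff_fn (Finset.mem_range.1 hh), Polynomial.iterate_derivative_sum,
        map_sum, Finset.sum_mul]
      refine Finset.sum_congr rfl fun P hP => ?_
      rw [(Finset.mem_filter.1 hP).2]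
    rw [e, mem_xIdeal]
    intro n hn
    rw [map_sub, sub_eq_zero, substS, PowerSeries.coeff_mk, map_sum]
    simp only [PowerSeries.coeff_mul_X_pow']
    rw [← Finset.sum_filter]
    refine Finset.sum_congr ?_ fun _ _ => rfl
    ext h
    simp only [Finset.mem_range, Finset.mem_filter]
    omega

theorem hasGF_fn_zero (g : R⟦X⟧) (m : ℕ) :
    HasGF xIdeal (fun P : Poly m => g ^ P.width * PowerSeries.X ^ P.half)
      (substS g (fn (m + 1))) := by
  simpa using hasGF_fn g 0 m

/-- The `k`-th derivative of `s ^ w` at `s = 1` is `k! * w.choose k`. -/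
theorem hasGF_fn_choose (k m : ℕ) :
    HasGF xIdeal (fun P : Poly m => (P.width.choose k : R⟦X⟧) * PowerSeries.X ^ P.half)
      (PowerSeries.C (k.factorial : R)⁻¹ * substS 1 (dS^[k] (fn (m + 1)))) := by
  have : CharZero R := algebraRat.charZero R
  refine ((hasGF_fn (1 : R⟦X⟧) k m).mul_left _).congr fun P => ?_
  have h1 : PowerSeries.C (k.factorial : R)⁻¹ * (k.factorial : R⟦X⟧) = 1 := by
    rw [← map_natCast PowerSeries.C, ← map_mul, inv_mul_cancel₀ (by exact_mod_cast k.factorial_ne_zero),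
      map_one]
  rw [Polynomial.iterate_derivative_X_pow_eq_natCast_mul, Nat.descFactorial_eq_factorial_mul_choose]
  simp only [map_mul, map_natCast, map_pow, Polynomial.aeval_X, one_pow, mul_one, Nat.cast_mul]
  linear_combination (-(P.width.choose k : R⟦X⟧) * PowerSeries.X ^ P.half) * h1

/-- A generating function of the chunks below a row of width `w`, for all `w`, gives one step of the
recurrence. -/
theorem HasGF.poly_succ {s : R} {K : ℕ → R⟦X⟧} {m : ℕ} {F : R⟦X⟧}
    (hK : ∀ w, 1 ≤ w → HasGF xIdeal (fun c : ChunkBelow w =>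
      PowerSeries.C s ^ (c.1.e₂ - c.1.e₁).toNat * PowerSeries.X ^ c.1.cost) (K w))
    (hF : HasGF xIdeal (fun P : Poly m => K P.width * PowerSeries.X ^ P.half) F) :
    substS (PowerSeries.C s) (fn (m + 2)) = F := by
  refine (hasGF_fn_zero (PowerSeries.C s) (m + 1)).unique ?_ eq_zero_of_mem_xIdeal
  have h : HasGF xIdeal (fun x : Σ P : Poly m, ChunkBelow P.width => PowerSeries.X ^ x.1.half *
      (PowerSeries.C s ^ (x.2.1.e₂ - x.2.1.e₁).toNat * PowerSeries.X ^ x.2.1.cost)) F := by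
    refine HasGF.sigma (fun P => ((hK P.width P.width_pos).mul_left (PowerSeries.X ^ P.half)))
      (hF.congr fun P => mul_comm _ _) fun N => ⟨polyLT m N, fun P hP c => ?_⟩
    rw [mem_polyLT, not_lt] at hP
    exact Ideal.mul_mem_right _ _ (X_pow_mem_xIdeal hP)
  refine h.of_equiv (attachEquiv m) fun x => ?_
  rw [half_attachEquiv, ← width_attachEquiv, Int.toNat_natCast]
  ring

theorem substS_fn_one (s : R) : substS (PowerSeries.C s) (fn 1) =
    PowerSeries.C s * PowerSeries.X * geomSeries s := by
  refine (hasGF_fn_zero (PowerSeries.C s) 0).unique ?_ eq_zero_of_mem_xIdeal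
  have h := HasGF.geom_succ (I := xIdeal) (r := (PowerSeries.C s * PowerSeries.X : R⟦X⟧))
    (G := geomSeries s) (fun N => by
      rw [mul_pow]
      exact Ideal.mul_mem_left _ _ (X_pow_mem_xIdeal le_rfl)) (geomSeries_mul s)
  refine h.of_equiv rectEquiv fun n => ?_
  rw [width_rectEquiv, half_rectEquiv, mul_pow]

/-- The chunk count below a row of width `w` is a combination of `w.choose k`, `s ^ w` and `(s x) ^
w`; summed over polygons term by term, these are the series on the right. -/
theorem substS_fn_succ {s : R} (hs : s ≠ 1) (m : ℕ) :
    substS (PowerSeries.C s) (fn (m + 2)) =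
      ∑ k : Fin 6, coeffSeries s ⟨k + 1, by omega⟩ *
        (PowerSeries.C ((k : ℕ).factorial : R)⁻¹ * substS 1 (dS^[k] (fn (m + 1)))) +
      coeffSeries s 7 * substS (PowerSeries.C s) (fn (m + 1)) +
      coeffSeries s 8 * substS (PowerSeries.C s * PowerSeries.X) (fn (m + 1)) := by
  refine HasGF.poly_succ (fun w hw => hasGF_chunkBelow hs hw) ?_
  refine (((HasGF.sum Finset.univ fun (k : Fin 6) _ => (hasGF_fn_choose (R := R) k m).mul_left
    (coeffSeries s ⟨k + 1, by omega⟩)).add ((hasGF_fn_zero (PowerSeries.C s) m).mul_left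
      (coeffSeries s 7))).add ((hasGF_fn_zero (PowerSeries.C s * PowerSeries.X) m).mul_left
      (coeffSeries s 8))).congr fun P => ?_
  simp only [add_mul, Finset.sum_mul, mul_assoc]

theorem substS_fn_succ_one (m : ℕ) :
    substS (1 : R⟦X⟧) (fn (m + 2)) =
      ∑ k : Fin 7, coeffIntOne (geomSeries (1 : R)) ⟨k + 1, by omega⟩ *
        (PowerSeries.C ((k : ℕ).factorial : R)⁻¹ * substS 1 (dS^[k] (fn (m + 1)))) +
      coeffIntOne (geomSeries (1 : R)) 8 * substS PowerSeries.X (fn (m + 1)) := by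
  rw [← map_one PowerSeries.C]
  refine HasGF.poly_succ (fun w hw => hasGF_chunkBelow_one hw) ?_
  rw [map_one]
  refine ((HasGF.sum Finset.univ fun (k : Fin 7) _ => (hasGF_fn_choose (R := R) k m).mul_left
    (coeffIntOne (geomSeries (1 : R)) ⟨k + 1, by omega⟩)).add
      ((hasGF_fn_zero PowerSeries.X m).mul_left (coeffIntOne (geomSeries (1 : R)) 8))).congr
      fun P => ?_
  simp only [add_mul, Finset.sum_mul, mul_assoc]

end

/-! ### Expansion of the coefficients -/

section
variable {K : Type*} [Field K]

theorem toL_X : toL (RatFunc.X : RatFunc K) = HahnSeries.ofPowerSeries ℤ K PowerSeries.X := by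
  simp [toL]

theorem toL_C (a : K) : toL (RatFunc.C a) = HahnSeries.ofPowerSeries ℤ K (PowerSeries.C a) := by
  have h := RatFunc.coe_coe (Polynomial.C a)
  rw [Polynomial.coe_C] at h
  rw [h, toL]
  congr 1

/-- The bridge between rational functions and series: inverses in a field are unique, so the
expansion is the geometric series, and the polynomials `coeffInt` in the inverses follow. -/
theorem toL_inv (a : K) : toL (1 - RatFunc.C a * RatFunc.X : RatFunc K)⁻¹ =
    HahnSeries.ofPowerSeries ℤ K (geomSeries a) := by
  rw [map_inv₀, map_sub, map_mul, map_one, toL_X, toL_C, ← map_mul,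
    ← map_one (HahnSeries.ofPowerSeries ℤ K), ← map_sub]
  symm
  apply eq_inv_of_mul_eq_one_left
  rw [← map_mul, geomSeries_mul, map_one]

theorem toL_one_sub_X_inv : toL (1 - RatFunc.X : RatFunc K)⁻¹ =
    HahnSeries.ofPowerSeries ℤ K (geomSeries 1) := by
  rw [← toL_inv, map_one, one_mul]

theorem toL_div (a : K) : toL (RatFunc.C a * RatFunc.X / (1 - RatFunc.C a * RatFunc.X)) =
    HahnSeries.ofPowerSeries ℤ K (PowerSeries.C a * PowerSeries.X * geomSeries a) := by
  rw [div_eq_mul_inv, map_mul, map_mul, toL_inv, toL_X, toL_C, map_mul, map_mul]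

theorem toL_coeff (a : K) (i : Fin 9) : toL (coeff (RatFunc.C a) RatFunc.X i : RatFunc K) =
    HahnSeries.ofPowerSeries ℤ K (coeffSeries a i) / fact i := by
  have h : toL (1 - RatFunc.C a : RatFunc K)⁻¹ =
      HahnSeries.ofPowerSeries ℤ K (PowerSeries.C (1 - a)⁻¹) := by
    rw [← toL_C, map_inv₀ RatFunc.C, map_sub, map_one]
  rw [coeff, map_div₀, map_natCast, map_coeffInt, toL_inv, toL_one_sub_X_inv, h, coeffSeries,
    map_coeffInt]

theorem toL_chat [CharZero K] (i : Fin 9) : toL (chat RatFunc.X i : RatFunc K) =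
    HahnSeries.ofPowerSeries ℤ K (coeffIntOne (geomSeries 1) i) / factOne i := by
  rw [chat_eq one_sub_X_ne_zero, map_div₀, map_natCast, map_coeffIntOne, toL_one_sub_X_inv,
    map_coeffIntOne]

theorem ofPowerSeries_C_natCast_inv (n : ℕ) :
    HahnSeries.ofPowerSeries ℤ K (PowerSeries.C (n : K)⁻¹) = (n : K⸨X⸩)⁻¹ := by
  rw [← toL_C, map_inv₀, map_inv₀, map_natCast, map_natCast]

variable [Algebra ℚ K]

theorem evS_fn_one (a : K) : evS (PowerSeries.C a) (fn 1) =
    toL (RatFunc.C a * RatFunc.X / (1 - RatFunc.C a * RatFunc.X)) := by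
  rw [evS, substS_fn_one, toL_div]

theorem evS_fn_succ {a : K} (ha : a ≠ 1) (m : ℕ) :
    evS (PowerSeries.C a) (fn (m + 2)) =
      ∑ k : Fin 6, toL (coeff (RatFunc.C a) RatFunc.X ⟨k + 1, by omega⟩) *
        evS 1 (dS^[k] (fn (m + 1))) +
      toL (coeff (RatFunc.C a) RatFunc.X 7) * evS (PowerSeries.C a) (fn (m + 1)) +
      toL (coeff (RatFunc.C a) RatFunc.X 8) *
        evS (PowerSeries.C a * PowerSeries.X) (fn (m + 1)) := by
  have h7 : (fact 7 : K⸨X⸩) = 1 := by simp [fact]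
  have h8 : (fact 8 : K⸨X⸩) = 1 := by simp [fact]
  simp only [evS, substS_fn_succ ha, map_add, map_sum, map_mul, toL_coeff, fact_succ, h7, h8,
    inv_one, one_mul, ofPowerSeries_C_natCast_inv, div_eq_mul_inv, mul_assoc]

theorem evS_fn_succ_one (m : ℕ) :
    evS (1 : K⟦X⟧) (fn (m + 2)) =
      ∑ k : Fin 7, toL (chat RatFunc.X ⟨k + 1, by omega⟩) * evS 1 (dS^[k] (fn (m + 1))) +
      toL (chat RatFunc.X 8) * evS PowerSeries.X (fn (m + 1)) := by
  have : CharZero K := algebraRat.charZero K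
  have h8 : (factOne 8 : K⸨X⸩) = 1 := by simp [factOne]
  simp only [evS, substS_fn_succ_one, map_add, map_sum, map_mul, toL_chat, factOne_succ, h8,
    inv_one, one_mul, ofPowerSeries_C_natCast_inv, div_eq_mul_inv, mul_assoc]

/-! ### The functional equations -/

theorem coeff_f_eq_zero {v : ℕ} (hv : ∀ m, v ≠ 3 * m + 1) : PowerSeries.coeff v f = 0 := by
  ext1 h
  simp [f, polygons_eq_empty hv]

theorem coeff_evSY (g : K⟦X⟧) (k v : ℕ) (F : ℚ[X]⟦X⟧⟦X⟧) :
    PowerSeries.coeff v (evSY g k F) = evS g (dS^[k] (PowerSeries.coeff v F)) :=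
  PowerSeries.coeff_mk _ _

theorem evS_dS_zero (g : K⟦X⟧) (k : ℕ) : evS g (dS^[k] 0) = 0 := by
  have h : substS g (dS^[k] 0) = 0 := by
    ext n
    simp [substS, coeff_dS_iterate]
  rw [evS, h, map_zero]

/-- A series `∑ aₙ y ^ (3 n + 1)` satisfies a functional equation if the `aₙ` satisfy a recurrence. -/
theorem evSY_eq {L : Type*} [CommRing L] {A B : L⟦X⟧} {a : L} (h1 : PowerSeries.coeff 1 A = a)
    (hA : ∀ v, (∀ m, v ≠ 3 * m + 1) → PowerSeries.coeff v A = 0)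
    (hB : ∀ v, (∀ m, v ≠ 3 * m + 1) → PowerSeries.coeff v B = 0)
    (h : ∀ m, PowerSeries.coeff (3 * (m + 1) + 1) A = PowerSeries.coeff (3 * m + 1) B) :
    A = PowerSeries.C a * PowerSeries.X + PowerSeries.X ^ 3 * B := by
  ext v
  rw [map_add, PowerSeries.coeff_C_mul, PowerSeries.coeff_X, PowerSeries.coeff_X_pow_mul']
  by_cases hv : ∃ m, v = 3 * m + 1
  · obtain ⟨_ | m, rfl⟩ := hv
    · simpa using h1
    · rw [h, if_neg (by omega), if_pos (by omega), mul_zero, zero_add]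
      congr 1
  · rw [hA v (by simpa using hv), if_neg (fun e => hv ⟨0, by omega⟩), mul_zero, zero_add]
    split_ifs with h3
    · exact (hB _ fun m hm => hv ⟨m + 1, by omega⟩).symm
    · rfl

/-- Compared coefficient by coefficient in `y`, this is the rectangle series for `y` and the
recurrence for `y ^ (3 m + 4)`; all other coefficients vanish on both sides. -/
theorem evSY_f {a : K} (ha : a ≠ 1) : evSY (PowerSeries.C a) 0 f =
    PowerSeries.C (toL (RatFunc.C a * RatFunc.X / (1 - RatFunc.C a * RatFunc.X))) * PowerSeries.X +
      PowerSeries.X ^ 3 * (∑ k : Fin 6,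
        PowerSeries.C (toL (coeff (RatFunc.C a) RatFunc.X ⟨k + 1, by omega⟩)) * evSY 1 k f +
      PowerSeries.C (toL (coeff (RatFunc.C a) RatFunc.X 7)) * evSY (PowerSeries.C a) 0 f +
      PowerSeries.C (toL (coeff (RatFunc.C a) RatFunc.X 8)) *
        evSY (PowerSeries.C a * PowerSeries.X) 0 f) := by
  refine evSY_eq ?_ (fun v hv => ?_) (fun v hv => ?_) fun m => ?_
  · rw [coeff_evSY]
    exact evS_fn_one a
  · rw [coeff_evSY, coeff_f_eq_zero hv, evS_dS_zero]
  · simp only [map_add, map_sum, PowerSeries.coeff_C_mul, coeff_evSY, coeff_f_eq_zero hv,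
      evS_dS_zero, mul_zero, Finset.sum_const_zero, add_zero]
  · simp only [map_add, map_sum, PowerSeries.coeff_C_mul, coeff_evSY, ← fn_succ]
    exact evS_fn_succ ha m

theorem evSY_f_one : evSY (1 : K⟦X⟧) 0 f =
    PowerSeries.C (toL (RatFunc.X / (1 - RatFunc.X))) * PowerSeries.X +
      PowerSeries.X ^ 3 * (∑ k : Fin 7,
        PowerSeries.C (toL (chat RatFunc.X ⟨k + 1, by omega⟩)) * evSY 1 k f +
      PowerSeries.C (toL (chat RatFunc.X 8)) * evSY PowerSeries.X 0 f) := by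
  refine evSY_eq ?_ (fun v hv => ?_) (fun v hv => ?_) fun m => ?_
  · rw [coeff_evSY]
    have h := evS_fn_one (1 : K)
    rw [map_one, map_one, one_mul] at h
    exact h
  · rw [coeff_evSY, coeff_f_eq_zero hv, evS_dS_zero]
  · simp only [map_add, map_sum, PowerSeries.coeff_C_mul, coeff_evSY, coeff_f_eq_zero hv,
      evS_dS_zero, mul_zero, Finset.sum_const_zero, add_zero]
  · simp only [map_add, map_sum, PowerSeries.coeff_C_mul, coeff_evSY, ← fn_succ]
    exact evS_fn_succ_one m

end

end SAP242

theorem mainTheorem5 :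
    -- the generating function is well defined
    (∀ h v : ℕ, (SAP242.polygons h v).Finite) ∧
    ∃ c : Fin 9 → SAP242.Qsx,
      -- the coefficients `cᵢ` and `ĉᵢ`
      (SAP242.IsPartialFraction c ∧ ∀ c', SAP242.IsPartialFraction c' → c' = c) ∧
      (∀ i, SAP242.HasDenominator (c i)
        (SAP242.den (MvPolynomial.X 0) (MvPolynomial.X 1) i)) ∧
      c 8 = SAP242.c8 SAP242.sv SAP242.xv ∧
      (SAP242.IsPartialFractionOne (SAP242.chat RatFunc.X) ∧
        ∀ c', SAP242.IsPartialFractionOne c' → c' = SAP242.chat RatFunc.X) ∧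
      SAP242.chat (RatFunc.X : RatFunc ℚ) 8 = SAP242.c8 1 RatFunc.X ∧
      -- the functional equation for `f(s; x, y)`, in `ℚ(s)((x))⟦y⟧`
      SAP242.evSY (PowerSeries.C SAP242.s₀) 0 SAP242.f =
        PowerSeries.C (SAP242.toL (SAP242.sv * SAP242.xv / (1 - SAP242.sv * SAP242.xv)))
            * PowerSeries.X
          + PowerSeries.X ^ 3 *
            (∑ k : Fin 6, PowerSeries.C (SAP242.toL (c ⟨k + 1, by omega⟩))
                * SAP242.evSY (R := SAP242.Qs) 1 k SAP242.f
              + PowerSeries.C (SAP242.toL (c 7))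
                * SAP242.evSY (PowerSeries.C SAP242.s₀) 0 SAP242.f
              + PowerSeries.C (SAP242.toL (c 8))
                * SAP242.evSY (PowerSeries.C SAP242.s₀ * PowerSeries.X) 0 SAP242.f) ∧
      -- the functional equation for `f(1; x, y)`, in `ℚ((x))⟦y⟧`
      SAP242.evSY (R := ℚ) 1 0 SAP242.f =
        PowerSeries.C (SAP242.toL (RatFunc.X / (1 - RatFunc.X))) * PowerSeries.X
          + PowerSeries.X ^ 3 *
            (∑ k : Fin 7, PowerSeries.C (SAP242.toL (SAP242.chat RatFunc.X ⟨k + 1, by omega⟩))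
                * SAP242.evSY (R := ℚ) 1 k SAP242.f
              + PowerSeries.C (SAP242.toL (SAP242.chat RatFunc.X 8))
                * SAP242.evSY (R := ℚ) PowerSeries.X 0 SAP242.f) ∧
      -- `f(s; x, y) = ∑_{n ≥ 1} fₙ(s; x) y ^ (3 n - 2)`
      (∀ m : ℕ, (∀ n : ℕ, 1 ≤ n → m ≠ 3 * n - 2) → PowerSeries.coeff m SAP242.f = 0) ∧
      -- the recurrences, in `ℚ(s)((x))` and in `ℚ((x))`
      SAP242.evS (PowerSeries.C SAP242.s₀) (SAP242.fn 1) =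
        SAP242.toL (SAP242.sv * SAP242.xv / (1 - SAP242.sv * SAP242.xv)) ∧
      (∀ n : ℕ, 1 ≤ n →
        SAP242.evS (PowerSeries.C SAP242.s₀) (SAP242.fn (n + 1)) =
          ∑ k : Fin 6, SAP242.toL (c ⟨k + 1, by omega⟩)
              * SAP242.evS (R := SAP242.Qs) 1 (SAP242.dS^[k] (SAP242.fn n))
            + SAP242.toL (c 7) * SAP242.evS (PowerSeries.C SAP242.s₀) (SAP242.fn n)
            + SAP242.toL (c 8)
              * SAP242.evS (PowerSeries.C SAP242.s₀ * PowerSeries.X) (SAP242.fn n)) ∧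
      (∀ n : ℕ, 1 ≤ n →
        SAP242.evS (R := ℚ) 1 (SAP242.fn (n + 1)) =
          ∑ k : Fin 7, SAP242.toL (SAP242.chat RatFunc.X ⟨k + 1, by omega⟩)
              * SAP242.evS (R := ℚ) 1 (SAP242.dS^[k] (SAP242.fn n))
            + SAP242.toL (SAP242.chat RatFunc.X 8)
              * SAP242.evS (R := ℚ) PowerSeries.X (SAP242.fn n)) := by
  refine ⟨SAP242.finite_polygons, SAP242.coeff SAP242.sv SAP242.xv,
    ⟨SAP242.coeff_isPartialFraction, fun _ => SAP242.coeff_isPartialFraction_unique⟩,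
    SAP242.coeff_hasDenominator, SAP242.coeff_eight,
    ⟨SAP242.chat_isPartialFractionOne, fun _ => SAP242.chat_isPartialFractionOne_unique⟩,
    SAP242.chat_eight SAP242.one_sub_X_ne_zero, SAP242.evSY_f SAP242.s₀_ne_one, SAP242.evSY_f_one,
    -- The index shift is `3 n + 1 = 3 (n + 1) - 2`.
    fun m hm => SAP242.coeff_f_eq_zero fun n hn => hm (n + 1) (by omega) (by omega),
    SAP242.evS_fn_one SAP242.s₀, fun n hn => ?_, fun n hn => ?_⟩
  · obtain ⟨m, rfl⟩ := Nat.exists_eq_add_of_le' hn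
    exact SAP242.evS_fn_succ SAP242.s₀_ne_one m
  · obtain ⟨m, rfl⟩ := Nat.exists_eq_add_of_le' hn
    exact SAP242.evS_fn_succ_one m
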